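/- A temporal graph on a finite vertex set $V$ with $n=|V|$ vertices and lifetime $L$ is given by a finite set $\mathcal E$ of temporal edges $(e,t)$, where $e=\{u,v\}$ with $u\neq v$ is an undirected edge on $V$ and $t\in\{1,\dots,L\}$ is a time label (an edge may have several labels), together with a nonnegative rational weight $w(e,t)$ for each $(e,t)\in\mathcal E$. A temporal path from $x$ to $y$ in $S\subseteq\mathcal E$ is a sequence of vertices $v_1=x,v_2,\dots,v_{k+1}=y$ and labels $t_1\le t_2\le\dots\le t_k$, $k\ge 0$, with $(\{v_i,v_{i+1}\},t_i)\in S$ for all $i$; $S$ is temporally connected if for every ordered pair $(x,y)\in V\times V$ there is a temporal path from $x$ to $y$ in $S$. The problem Minimum All-Pairs Temporal Connectivity (TC) asks, given a temporally connected temporal graph, for a temporally connected $S\subseteq\mathcal E$ of minimum total weight $\sum_{(e,t)\in S}w(e,t)$. For every constant $\varepsilon>0$, TC admits a polynomial-time $O(n^{1+\varepsilon})$-approximation. That is, there are a function $\rho:\mathbb N\to[1,\infty)$ with $\rho(n)=O(n^{1+\varepsilon})$ and an algorithm that, given any temporal graph (as a list of its temporal edges, with all numbers, including the numerators and denominators of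 the weights, in binary), halts in time polynomial in the length of the input and, if the given graph is temporally connected and has $n$ vertices, outputs a temporally connected set of its temporal edges whose total weight is at most $\rho(n)$ times the minimum. The algorithm, $\rho$ and the polynomial bounding the running time may depend on $\varepsilon$. -/

import Mathlib

/-! ### Temporal graphs and temporal connectivity -/

/-- An edge-weighted temporal graph on the vertex set `V`. A pair `(e, t)` in `tedges` is a temporal
edge: the undirected edge `e` is available at time `t`, where `t ∈ {1, …, lifetime}`. An edge may
carry any number of time labels. Only the weights of temporal edges are meaningful. -/
structure TemporalGraph (V : Type*) where
  lifetime : ℕ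
  tedges : Finset (Sym2 V × ℕ)
  loopless : ∀ x ∈ tedges, ¬ x.1.IsDiag
  label_mem : ∀ x ∈ tedges, x.2 ∈ Finset.Icc 1 lifetime
  weight : Sym2 V × ℕ → ℚ≥0

namespace TemporalGraph

variable {V : Type*}

/-- There is a temporal path from `x` to `y` in the set `S` of temporal edges: vertices
`v 0 = x, v 1, …, v k = y` and labels `t 0 ≤ t 1 ≤ ⋯ ≤ t (k - 1)` such that the edge joining `v i`
and `v (i + 1)` is available at time `t i`. -/
def TemporalReach (S : Finset (Sym2 V × ℕ)) (x y : V) : Prop :=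
  ∃ (k : ℕ) (v : Fin (k + 1) → V) (t : Fin k → ℕ),
    v 0 = x ∧ v (Fin.last k) = y ∧ Monotone t ∧
      ∀ i : Fin k, (s(v i.castSucc, v i.succ), t i) ∈ S

/-- The temporal edges in `S` form a (temporally) connected graph on all of `V`. -/
def TemporallyConnected (S : Finset (Sym2 V × ℕ)) : Prop :=
  ∀ x y : V, TemporalReach S x y

/-- The total weight of the spanning subgraph of `G` with temporal edges `S`. -/
def totalWeight (G : TemporalGraph V) (S : Finset (Sym2 V × ℕ)) : ℚ≥0 :=
  ∑ x ∈ S, G.weight x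

/-- `S` is a feasible solution of Minimum All-Pairs Temporal Connectivity on `G`: a temporally
connected spanning subgraph of `G`. -/
def IsFeasible (G : TemporalGraph V) (S : Finset (Sym2 V × ℕ)) : Prop :=
  S ⊆ G.tedges ∧ TemporallyConnected S

/-- `S` is a feasible solution of minimum total weight. -/
def IsOptimal (G : TemporalGraph V) (S : Finset (Sym2 V × ℕ)) : Prop :=
  G.IsFeasible S ∧ ∀ S', G.IsFeasible S' → G.totalWeight S ≤ G.totalWeight S'

/-- Every temporally connected temporal graph has an optimal solution. -/
theorem exists_isOptimal (G : TemporalGraph V) (hG : TemporallyConnected G.tedges) :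
    ∃ S, G.IsOptimal S := by
  classical
  obtain ⟨S, hS, hmin⟩ := Finset.exists_min_image
    (G.tedges.powerset.filter fun S => TemporallyConnected S) G.totalWeight
    ⟨G.tedges, by simp [hG]⟩
  simp only [Finset.mem_filter, Finset.mem_powerset] at hS hmin
  exact ⟨S, hS, hmin⟩

end TemporalGraph

/-! ### Random access machines

Programs of a random access machine in structured form: finitely many registers and arrays of
natural numbers are used, the arithmetic operations are addition, truncated subtraction and halving,
and every operation is charged one unit. There is no multiplication, so that `k` steps lengthen the
binary representation of the numbers by `O(k)` bits only, and polynomial time on this machine, in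
the bit length of the input, is polynomial time on Turing machines. -/

namespace RAM

/-- A memory state: register `x` holds `reg x`, cell `i` of array `a` holds `arr a i`. -/
structure State where
  reg : ℕ → ℕ
  arr : ℕ → ℕ → ℕ

/-- Expressions: `get a i` reads the cell of the array `a` with index the value of `i`. -/
inductive Expr where
  | lit (c : ℕ)
  | var (x : ℕ)
  | get (a : ℕ) (i : Expr)
  | add (e f : Expr)
  | sub (e f : Expr)
  | half (e : Expr)

namespace Expr

/-- The value of an expression. -/
def eval (s : State) : Expr → ℕ
  | lit c => c
  | var x => s.reg x
  | get a i => s.arr a (eval s i)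
  | add e f => eval s e + eval s f
  | sub e f => eval s e - eval s f
  | half e => eval s e / 2

/-- The number of steps charged for the evaluation of an expression. -/
def cost : Expr → ℕ
  | lit _ => 1
  | var _ => 1
  | get _ i => cost i + 1
  | add e f => cost e + cost f + 1
  | sub e f => cost e + cost f + 1
  | half e => cost e + 1

end Expr

/-- Programs. The conditions of `cond` and `loop` hold when the expression is not `0`. -/
inductive Program where
  | skip
  | assign (x : ℕ) (e : Expr)
  | store (a : ℕ) (i e : Expr)
  | seq (P Q : Program)
  | cond (e : Expr) (P Q : Program)
  | loop (e : Expr) (P : Program)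

/-- Assign the value `c` to the register `x`. -/
def State.setReg (s : State) (x c : ℕ) : State where
  reg := Function.update s.reg x c
  arr := s.arr

/-- Store the value `c` in cell `i` of the array `a`. -/
def State.setArr (s : State) (a i c : ℕ) : State where
  reg := s.reg
  arr := Function.update s.arr a (Function.update (s.arr a) i c)

/-- `Exec P s k s'`: started in the state `s`, the program `P` halts after exactly `k` steps in the
state `s'`. -/
inductive Exec : Program → State → ℕ → State → Prop
  | skip (s : State) : Exec .skip s 1 s
  | assign (x : ℕ) (e : Expr) (s : State) :
      Exec (.assign x e) s (e.cost + 1) (s.setReg x (e.eval s))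
  | store (a : ℕ) (i e : Expr) (s : State) :
      Exec (.store a i e) s (i.cost + e.cost + 1) (s.setArr a (i.eval s) (e.eval s))
  | seq {P Q : Program} {s s' s'' : State} {k l : ℕ} :
      Exec P s k s' → Exec Q s' l s'' → Exec (.seq P Q) s (k + l) s''
  | cond_true {e : Expr} {P Q : Program} {s s' : State} {k : ℕ} :
      e.eval s ≠ 0 → Exec P s k s' → Exec (.cond e P Q) s (e.cost + 1 + k) s'
  | cond_false {e : Expr} {P Q : Program} {s s' : State} {k : ℕ} :
      e.eval s = 0 → Exec Q s k s' → Exec (.cond e P Q) s (e.cost + 1 + k) s'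
  | loop_true {e : Expr} {P : Program} {s s' s'' : State} {k l : ℕ} :
      e.eval s ≠ 0 → Exec P s k s' → Exec (.loop e P) s' l s'' →
        Exec (.loop e P) s (e.cost + 1 + k + l) s''
  | loop_false {e : Expr} {P : Program} {s : State} :
      e.eval s = 0 → Exec (.loop e P) s (e.cost + 1) s

/-- The start state on the input `l`: the array `0` holds the entries of `l`, the register `0` holds
its length, and everything else is `0`. -/
def start (l : List ℕ) : State where
  reg := fun x => if x = 0 then l.length else 0
  arr := fun a i => if a = 0 then l.getD i 0 else 0

/-- The output of a halted program: the first cells of the array `1`, as many as the register `1`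
tells. -/
def State.output (s : State) : List ℕ :=
  (List.range (s.reg 1)).map (s.arr 1)

/-- The length of a list of natural numbers written in binary, with separators. -/
def bitLength (l : List ℕ) : ℕ :=
  (l.map fun c => Nat.size c + 1).sum

end RAM

/-! ### Approximation algorithms for Minimum All-Pairs Temporal Connectivity -/

namespace TemporalGraph

/-- The list `xs` of triples `(u, v, t)` lists every temporal edge in `S` exactly once, with the
endpoints of an edge in either order. -/
def IsListing {n : ℕ} (xs : List (Fin n × Fin n × ℕ)) (S : Finset (Sym2 (Fin n) × ℕ)) : Prop :=
  (xs.map fun x => (s(x.1, x.2.1), x.2.2)).Nodup ∧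
    ∀ y, y ∈ S ↔ y ∈ xs.map fun x => (s(x.1, x.2.1), x.2.2)

/-- The input that presents a temporal graph whose temporal edges are listed by `xs`: the number of
vertices, the lifetime, the number of temporal edges, and for each temporal edge its two endpoints,
its label, and the numerator and the denominator of its weight. -/
def encodeInput {n : ℕ} (G : TemporalGraph (Fin n)) (xs : List (Fin n × Fin n × ℕ)) : List ℕ :=
  [n, G.lifetime, xs.length] ++ xs.flatMap fun x =>
    [x.1.val, x.2.1.val, x.2.2, (G.weight (s(x.1, x.2.1), x.2.2)).num,
      (G.weight (s(x.1, x.2.1), x.2.2)).den]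

/-- The output that presents a set of temporal edges listed by `ys`. -/
def encodeOutput {n : ℕ} (ys : List (Fin n × Fin n × ℕ)) : List ℕ :=
  ys.flatMap fun y => [y.1.val, y.2.1.val, y.2.2]

end TemporalGraph

namespace RAM.Program

open TemporalGraph

/-- On every temporal graph, however its temporal edges are listed, the program halts within a
number of steps that is polynomial in the bit length of the input. -/
def RunsInPolyTime (P : RAM.Program) : Prop :=
  ∃ p : Polynomial ℕ, ∀ (n : ℕ) (G : TemporalGraph (Fin n)) (xs : List (Fin n × Fin n × ℕ)),
    IsListing xs G.tedges →
      ∃ (k : ℕ) (s : RAM.State), RAM.Exec P (RAM.start (encodeInput G xs)) k s ∧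
        k ≤ p.eval (RAM.bitLength (encodeInput G xs))

/-- On every temporally connected temporal graph with `n` vertices, however its temporal edges are
listed, the program computes a feasible solution whose total weight is at most `ρ n` times the
optimal one. -/
def HasApproxRatio (P : RAM.Program) (ρ : ℕ → ℝ) : Prop :=
  (∀ n, 1 ≤ ρ n) ∧
  ∀ (n : ℕ) (G : TemporalGraph (Fin n)) (xs : List (Fin n × Fin n × ℕ)),
    IsListing xs G.tedges → TemporallyConnected G.tedges →
      ∃ (k : ℕ) (s : RAM.State) (ys : List (Fin n × Fin n × ℕ)) (S : Finset (Sym2 (Fin n) × ℕ)),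
        RAM.Exec P (RAM.start (encodeInput G xs)) k s ∧
        s.output = encodeOutput ys ∧ IsListing ys S ∧ G.IsFeasible S ∧
        ∀ T, G.IsOptimal T → (G.totalWeight S : ℝ) ≤ ρ n * (G.totalWeight T : ℝ)

end RAM.Program

/-! The problem splits into one directed Steiner tree problem per root. Let the nodes be both
orientations of every temporal edge, with the weight of that edge, together with a free source and a
free sink for every vertex; an arc leads from one node to another if the head of the first is the
tail of the second and time does not decrease. Walks from the source of `r` to the sink of `x` are
then the temporal paths from `r` to `x` (`TemporalGraph.temporallyConnected_of_spans`,
`TemporalGraph.spans_of_temporallyConnected`). A feasible solution contains, for every root, a tree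
to all sinks of at most twice its weight, since each temporal edge occurs in two orientations
(`TCInput.exists_cov`). Conversely, the temporal edges of one tree per root form a feasible
solution. Approximating the trees within a factor `ρ` thus yields the factor `2 * n * ρ`.

The trees come from the recursive greedy algorithm `Greedy.cover`. Level `i + 1` repeatedly chooses
a node `u` and a number of terminals such that the distance to `u`, plus the cost of covering so
many terminals from `u` at level `i`, is minimal per terminal. Any tree can be cut into pieces with
at least `g` and fewer than `2 * g` terminals (`Greedy.Cov.exists_remainder`), and the greedy choice
is no denser than any of these pieces. Summing the densities gives a harmonic number, hence the
recursion `ratio (i + 1) = (2 * b + ratio i) * h` (`Greedy.cover_le`). With `b` about `n ^ (1 / i)`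
and `h = 1 + log n` the ratio is `O(n ^ (1 / i) * (log n) ^ i)`, and `i` is taken with `1 / i < ε`.

The algorithm keeps track of costs only, not of trees. Weights are made integral, scaled by a large
power of two, and the weight of edge `j` is increased by `2 ^ (bits * j)`. Every finite cost is the
weight of a multiset of nodes that carries the required walks (`NodeGraph.exists_bill_cover`), so
the low digits of the total cost in base `2 ^ bits` count the uses of each temporal edge, and the
solution is read off from this single number (`TCInput.used_spec`). The perturbation costs another
factor of 2.

For the running time, a weakest precondition calculus bounds the rounds of all loops by one number
`L`, and a fixed program takes polynomially many steps in `L` (`RAM.exists_exec_of_wp`). The number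
`n` is given in binary and may be exponential in the input length, but connectivity forces `n ≤ 2 *
m + 1` (`TemporalGraph.card_le_of_temporallyConnected`), and the program stops at once when this
fails. -/

/-! ### A program logic for the random access machine -/

namespace RAM

set_option linter.unusedSimpArgs false

/-- Run one program after another. -/
infixr:60 " ;; " => Program.seq

/-- A bound on the number of steps of a program, provided that every loop, whenever it is entered,
is run at most `L` times. -/
def Program.time (L : ℕ) : Program → ℕ
  | .skip => 1
  | .assign _ e => e.cost + 1
  | .store _ i e => i.cost + e.cost + 1
  | .seq P Q => P.time L + Q.time L
  | .cond e P Q => e.cost + 1 + (P.time L + Q.time L)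
  | .loop e P => L * (e.cost + 1 + P.time L) + (e.cost + 1)

/-- The bound on the number of steps is a polynomial in the bound on the number of iterations. -/
theorem Program.exists_polynomial_time (P : Program) :
    ∃ p : Polynomial ℕ, ∀ L, P.time L = p.eval L := by
  induction P with
  | skip => exact ⟨1, fun L => by simp [time]⟩
  | assign x e => exact ⟨(e.cost + 1 : ℕ), fun L => by simp [time]⟩
  | store a i e => exact ⟨(i.cost + e.cost + 1 : ℕ), fun L => by simp [time]⟩
  | seq P Q hP hQ =>
    obtain ⟨p, hp⟩ := hP
    obtain ⟨q, hq⟩ := hQ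
    exact ⟨p + q, fun L => by simp [time, hp, hq]⟩
  | cond e P Q hP hQ =>
    obtain ⟨p, hp⟩ := hP
    obtain ⟨q, hq⟩ := hQ
    exact ⟨Polynomial.C (e.cost + 1) + (p + q), fun L => by
      simp only [time, hp, hq, Polynomial.eval_add, Polynomial.eval_C]⟩
  | loop e P hP =>
    obtain ⟨p, hp⟩ := hP
    exact ⟨Polynomial.X * (Polynomial.C (e.cost + 1) + p) + Polynomial.C (e.cost + 1), fun L => by
      simp only [time, hp, Polynomial.eval_add, Polynomial.eval_mul, Polynomial.eval_X,
        Polynomial.eval_C]⟩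

/-- The program may write the register `y`. -/
def Program.WritesReg : Program → ℕ → Prop
  | .skip, _ => False
  | .assign x _, y => y = x
  | .store _ _ _, _ => False
  | .seq P Q, y => P.WritesReg y ∨ Q.WritesReg y
  | .cond _ P Q, y => P.WritesReg y ∨ Q.WritesReg y
  | .loop _ P, y => P.WritesReg y

/-- The program may write the array `b`. -/
def Program.WritesArr : Program → ℕ → Prop
  | .skip, _ => False
  | .assign _ _, _ => False
  | .store a _ _, b => b = a
  | .seq P Q, b => P.WritesArr b ∨ Q.WritesArr b
  | .cond _ P Q, b => P.WritesArr b ∨ Q.WritesArr b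
  | .loop _ P, b => P.WritesArr b

/-- The states `s` and `s'` agree on everything that the program does not write. -/
structure Frame (P : Program) (s s' : State) : Prop where
  reg : ∀ y, ¬ P.WritesReg y → s'.reg y = s.reg y
  arr : ∀ a, ¬ P.WritesArr a → s'.arr a = s.arr a

/-- The precondition that makes the program halt in a state satisfying `Q`, entering no loop body
more than `L` times in a row. For loops, an invariant indexed by the number of iterations is asked
for. -/
def wp (L : ℕ) : Program → (State → Prop) → State → Prop
  | .skip, Q, s => Q s
  | .assign x e, Q, s => Q (s.setReg x (e.eval s))
  | .store a i e, Q, s => Q (s.setArr a (i.eval s) (e.eval s))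
  | .seq P P', Q, s => wp L P (wp L P' Q) s
  | .cond e P P', Q, s => (e.eval s ≠ 0 → wp L P Q s) ∧ (e.eval s = 0 → wp L P' Q s)
  | .loop e P, Q, s => ∃ B ≤ L, ∃ I : ℕ → State → Prop, I 0 s ∧
      (∀ j < B, ∀ s', I j s' → e.eval s' ≠ 0 ∧ wp L P (I (j + 1)) s') ∧
      ∀ s', I B s' → e.eval s' = 0 ∧ Q s'

theorem wp_mono {L : ℕ} {P : Program} {Q Q' : State → Prop} {s : State} (h : wp L P Q s)
    (hQ : ∀ s', Q s' → Q' s') : wp L P Q' s := by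
  induction P generalizing Q Q' s with
  | skip => exact hQ _ h
  | assign x e => exact hQ _ h
  | store a i e => exact hQ _ h
  | seq P P' hP hP' => exact hP h fun s' h' => hP' h' hQ
  | cond e P P' hP hP' => exact ⟨fun he => hP (h.1 he) hQ, fun he => hP' (h.2 he) hQ⟩
  | loop e P hP =>
    obtain ⟨B, hB, I, h0, h1, h2⟩ := h
    exact ⟨B, hB, I, h0, h1, fun s' h' => ⟨(h2 s' h').1, hQ _ (h2 s' h').2⟩⟩

theorem Frame.refl (P : Program) (s : State) : Frame P s s :=
  ⟨fun _ _ => rfl, fun _ _ => rfl⟩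

theorem Frame.trans {P : Program} {s s' s'' : State} (h : Frame P s s') (h' : Frame P s' s'') :
    Frame P s s'' :=
  ⟨fun y hy => (h'.reg y hy).trans (h.reg y hy), fun y hy => (h'.arr y hy).trans (h.arr y hy)⟩

theorem Frame.mono {P P' : Program} {s s' : State} (h : Frame P s s')
    (hr : ∀ y, P.WritesReg y → P'.WritesReg y) (ha : ∀ y, P.WritesArr y → P'.WritesArr y) :
    Frame P' s s' :=
  ⟨fun y hy => h.reg y (mt (hr y) hy), fun y hy => h.arr y (mt (ha y) hy)⟩

/-- Specifications need to mention only what a program changes; everything else is supplied by this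
lemma. For loops the frame is carried along as part of the invariant. -/
theorem wp_frame {L : ℕ} {P : Program} {Q : State → Prop} {s : State} (h : wp L P Q s) :
    wp L P (fun s' => Q s' ∧ Frame P s s') s := by
  induction P generalizing Q s with
  | skip => exact ⟨h, Frame.refl _ _⟩
  | assign x e =>
    refine ⟨h, fun y hy => ?_, fun a _ => rfl⟩
    exact Function.update_of_ne hy _ _
  | store a i e =>
    refine ⟨h, fun y _ => rfl, fun b hb => ?_⟩
    exact Function.update_of_ne hb _ _
  | seq P P' hP hP' =>
    change wp L P (wp L P' _) s
    refine wp_mono (hP h) fun s' h' => wp_mono (hP' h'.1) fun s'' h'' => ⟨h''.1, ?_⟩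
    exact (h'.2.mono (fun _ => Or.inl) fun _ => Or.inl).trans
      (h''.2.mono (fun _ => Or.inr) fun _ => Or.inr)
  | cond e P P' hP hP' =>
    exact ⟨fun he => wp_mono (hP (h.1 he)) fun s' h' =>
        ⟨h'.1, h'.2.mono (fun _ => Or.inl) fun _ => Or.inl⟩,
      fun he => wp_mono (hP' (h.2 he)) fun s' h' =>
        ⟨h'.1, h'.2.mono (fun _ => Or.inr) fun _ => Or.inr⟩⟩
  | loop e P hP =>
    obtain ⟨B, hB, I, h0, h1, h2⟩ := h
    refine ⟨B, hB, fun j s' => I j s' ∧ Frame (.loop e P) s s', ⟨h0, Frame.refl _ _⟩,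
      fun j hj s' h' => ⟨(h1 j hj s' h'.1).1, ?_⟩,
      fun s' h' => ⟨(h2 s' h'.1).1, (h2 s' h'.1).2, h'.2⟩⟩
    exact wp_mono (hP (h1 j hj s' h'.1).2) fun s'' h'' =>
      ⟨h''.1, h'.2.trans (h''.2.mono (fun _ => id) fun _ => id)⟩

/-- The rule of consequence, with the frame condition. -/
theorem wp_call {L : ℕ} {P : Program} {R Q : State → Prop} {s : State} (h : wp L P R s)
    (hQ : ∀ s', R s' → Frame P s s' → Q s') : wp L P Q s :=
  wp_mono (wp_frame h) fun s' h' => hQ s' h'.1 h'.2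

/-- Soundness of the program logic. -/
theorem exists_exec_of_wp {L : ℕ} {P : Program} {Q : State → Prop} {s : State} (h : wp L P Q s) :
    ∃ k s', Exec P s k s' ∧ k ≤ P.time L ∧ Q s' := by
  induction P generalizing Q s with
  | skip => exact ⟨_, _, .skip s, le_rfl, h⟩
  | assign x e => exact ⟨_, _, .assign x e s, le_rfl, h⟩
  | store a i e => exact ⟨_, _, .store a i e s, le_rfl, h⟩
  | seq P P' hP hP' =>
    obtain ⟨k, s', hk, hkt, h'⟩ := hP h
    obtain ⟨l, s'', hl, hlt, h''⟩ := hP' h'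
    exact ⟨_, _, .seq hk hl, Nat.add_le_add hkt hlt, h''⟩
  | cond e P P' hP hP' =>
    by_cases he : e.eval s = 0
    · obtain ⟨k, s', hk, hkt, h'⟩ := hP' (h.2 he)
      exact ⟨_, _, .cond_false he hk, by simp only [Program.time]; omega, h'⟩
    · obtain ⟨k, s', hk, hkt, h'⟩ := hP (h.1 he)
      exact ⟨_, _, .cond_true he hk, by simp only [Program.time]; omega, h'⟩
  | loop e P hP =>
    obtain ⟨B, hB, I, h0, h1, h2⟩ := h
    -- Induction on the number `r` of iterations that are left, so the invariant is taken at index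
    -- `B - r`.
    have key : ∀ r ≤ B, ∀ s, I (B - r) s → ∃ k s', Exec (.loop e P) s k s' ∧
        k ≤ r * (e.cost + 1 + P.time L) + (e.cost + 1) ∧ Q s' := by
      intro r
      induction r with
      | zero => exact fun _ s hs => ⟨_, s, .loop_false (h2 s hs).1, by simp, (h2 s hs).2⟩
      | succ r ih =>
        intro hr s hs
        obtain ⟨he, hw⟩ := h1 (B - (r + 1)) (by omega) s hs
        obtain ⟨k, s', hk, hkt, h'⟩ := hP hw
        obtain ⟨l, s'', hl, hlt, h''⟩ := ih (by omega) s' (by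
          rwa [show B - r = B - (r + 1) + 1 by omega])
        refine ⟨_, s'', .loop_true he hk hl, ?_, h''⟩
        rw [add_mul]
        omega
    obtain ⟨k, s', hk, hkt, h'⟩ := key B le_rfl s (by simpa using h0)
    refine ⟨k, s', hk, hkt.trans ?_, h'⟩
    simp only [Program.time]
    gcongr

/-- Run `P` for `x = 0, …, e - 1`. -/
def Program.for (x : ℕ) (e : Expr) (P : Program) : Program :=
  .assign x (.lit 0) ;; .loop (.sub e (.var x)) (P ;; .assign x (.add (.var x) (.lit 1)))

theorem Program.writesReg_for {x : ℕ} {e : Expr} {P : Program} {y : ℕ} :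
    (Program.for x e P).WritesReg y ↔ y = x ∨ P.WritesReg y := by
  simp only [Program.for, WritesReg]
  tauto

theorem Program.writesArr_for {x : ℕ} {e : Expr} {P : Program} {y : ℕ} :
    (Program.for x e P).WritesArr y ↔ P.WritesArr y := by
  simp [Program.for, WritesArr]

/-- The bound `e` is evaluated anew before every round; by `he` its value is the same in all states
that differ from `s` only in what the loop writes. The invariant `I (j + 1)` is required after the
counter has been advanced. -/
theorem wp_for {L x : ℕ} {e : Expr} {P : Program} {Q : State → Prop} {s : State} (B : ℕ)
    (I : ℕ → State → Prop) (hB : B ≤ L) (hx : ¬ P.WritesReg x)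
    (he : ∀ s', Frame (Program.for x e P) s s' → e.eval s' = B)
    (h0 : I 0 (s.setReg x 0))
    (hI : ∀ j < B, ∀ s', Frame (Program.for x e P) s s' → s'.reg x = j → I j s' →
      wp L P (fun s'' => I (j + 1) (s''.setReg x (j + 1))) s')
    (hQ : ∀ s', Frame (Program.for x e P) s s' → s'.reg x = B → I B s' → Q s') :
    wp L (Program.for x e P) Q s := by
  refine ⟨B, hB, fun j s' => Frame (Program.for x e P) s s' ∧ s'.reg x = j ∧ I j s', ?_, ?_, ?_⟩
  · refine ⟨⟨fun y hy => ?_, fun a _ => rfl⟩, Function.update_self _ _ _, h0⟩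
    rw [Program.writesReg_for] at hy
    exact Function.update_of_ne (fun h => hy (.inl h)) _ _
  · rintro j hj s' ⟨hf, hr, hs⟩
    refine ⟨?_, ?_⟩
    · simp only [Expr.eval, he s' hf, hr]
      omega
    · change wp L P (wp L (.assign x _) _) s'
      refine wp_call (hI j hj s' hf hr hs) fun s'' h'' hf'' => ?_
      have hx'' : s''.reg x = j := by rw [hf''.reg x hx, hr]
      simp only [wp, Expr.eval, hx'']
      refine ⟨⟨fun y hy => ?_, fun a ha => ?_⟩, Function.update_self _ _ _, h''⟩
      · have hy' := hy
        rw [Program.writesReg_for, not_or] at hy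
        rw [← hf.reg y hy', ← hf''.reg y hy.2]
        exact Function.update_of_ne hy.1 _ _
      · have ha' := ha
        rw [Program.writesArr_for] at ha
        rw [← hf.arr a ha', ← hf''.arr a ha]
        rfl
  · rintro s' ⟨hf, hr, hs⟩
    refine ⟨?_, hQ s' hf hr hs⟩
    simp only [Expr.eval, he s' hf, hr]
    omega

theorem State.reg_setReg (s : State) (x c y : ℕ) :
    (s.setReg x c).reg y = if y = x then c else s.reg y := by
  simp [State.setReg, Function.update_apply]

theorem State.arr_setReg (s : State) (x c : ℕ) : (s.setReg x c).arr = s.arr := rfl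

theorem State.reg_setArr (s : State) (a i c : ℕ) : (s.setArr a i c).reg = s.reg := rfl

theorem State.arr_setArr (s : State) (a i c b k : ℕ) :
    (s.setArr a i c).arr b k = if b = a then if k = i then c else s.arr a k else s.arr b k := by
  simp only [State.setArr, Function.update_apply]
  split_ifs <;> simp [Function.update_apply, *]

/-- Multiply the registers `x` and `y`, which are overwritten, into the register `z`. -/
def Program.mul (z x y : ℕ) : Program :=
  .assign z (.lit 0) ;;
  .loop (.var y)
    (.cond (.sub (.var y) (.add (.half (.var y)) (.half (.var y))))
      (.assign z (.add (.var z) (.var x))) .skip ;;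
    .assign x (.add (.var x) (.var x)) ;;
    .assign y (.half (.var y)))

theorem Program.writesReg_mul {x y z w : ℕ} :
    (Program.mul z x y).WritesReg w ↔ w = x ∨ w = y ∨ w = z := by
  simp only [Program.mul, WritesReg]
  tauto

theorem Program.writesArr_mul {x y z w : ℕ} : ¬ (Program.mul z x y).WritesArr w := by
  simp [Program.mul, WritesArr]

/-- Doubling `x`, halving `y` and adding `x` to `z` when `y` is odd preserves `z + x * y`. The
number of rounds is the bit length of the second factor only; the first factor may be arbitrarily
long. -/
theorem wp_mul {L x y z : ℕ} {s : State} {Q : State → Prop} (hxy : x ≠ y) (hxz : x ≠ z)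
    (hyz : y ≠ z) (hy : (s.reg y).size ≤ L)
    (hQ : ∀ s', Frame (Program.mul z x y) s s' → s'.reg z = s.reg x * s.reg y → Q s') :
    wp L (Program.mul z x y) Q s := by
  refine wp_call (R := fun s' => s'.reg z = s.reg x * s.reg y) ?_ fun s' h hf => hQ s' hf h
  refine ⟨(s.reg y).size, hy, fun j s' => s'.reg y = s.reg y / 2 ^ j ∧
    s'.reg z + s'.reg x * s'.reg y = s.reg x * s.reg y, ?_, ?_, ?_⟩
  · simp [State.reg_setReg, hxy, hxz, hyz, hxy.symm, hxz.symm, hyz.symm, Expr.eval]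
  · rintro j hj s' ⟨h1, h2⟩
    have h3 : s'.reg y ≠ 0 := by
      have := Nat.lt_size.mp hj
      rw [h1]
      exact (Nat.div_pos this (by positivity)).ne'
    have h4 : s'.reg y / 2 = s.reg y / 2 ^ (j + 1) := by
      rw [h1, Nat.div_div_eq_div_mul, pow_succ]
    refine ⟨h3, ?_⟩
    simp only [wp, Expr.eval, State.reg_setReg, hxy, hxz, hyz, hxy.symm, hxz.symm, hyz.symm,
      if_true, if_false]
    refine ⟨fun h => ⟨h4, ?_⟩, fun h => ⟨h4, ?_⟩⟩
    · rw [← h2]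
      obtain ⟨q, hq⟩ : ∃ q, s'.reg y = 2 * q + 1 := ⟨s'.reg y / 2, by omega⟩
      rw [hq, show (2 * q + 1) / 2 = q by omega]
      ring
    · rw [← h2]
      obtain ⟨q, hq⟩ : ∃ q, s'.reg y = 2 * q := ⟨s'.reg y / 2, by omega⟩
      rw [hq, show 2 * q / 2 = q by omega]
      ring
  · rintro s' ⟨h1, h2⟩
    have h3 : s'.reg y = 0 := by
      rw [h1]
      exact Nat.div_eq_of_lt (Nat.lt_size_self _)
    refine ⟨h3, ?_⟩
    rw [← h2, h3]
    simp

/-- Double the register `z`, as often as the value of `e` tells; `x` is the counter. -/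
def Program.shift (x z : ℕ) (e : Expr) : Program :=
  .for x e (.assign z (.add (.var z) (.var z)))

theorem wp_shift {L x z : ℕ} {e : Expr} {s : State} {Q : State → Prop} (B : ℕ) (hxz : x ≠ z)
    (hB : B ≤ L) (he : ∀ s', Frame (Program.shift x z e) s s' → e.eval s' = B)
    (hQ : ∀ s', Frame (Program.shift x z e) s s' → s'.reg z = s.reg z * 2 ^ B → Q s') :
    wp L (Program.shift x z e) Q s := by
  refine wp_for B (fun j s' => s'.reg z = s.reg z * 2 ^ j) hB ?_ he ?_ ?_ ?_
  · simpa [Program.WritesReg] using hxz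
  · simp [State.reg_setReg, hxz.symm]
  · intro j _ s' _ _ h
    simp only [wp, Expr.eval, State.reg_setReg, hxz.symm, if_true, if_false, h]
    ring
  · exact fun s' hf _ h => hQ s' hf h

end RAM

/-! ### Recursive greedy covering from a root in a metric -/

namespace Greedy

/-- Among the nodes `0, …, l - 1` outside `X`, one that is nearest to `v`, with its distance. -/
def nearest (d : ℕ → ℕ → ℕ) (v : ℕ) (X : Finset ℕ) : ℕ → ℕ × Finset ℕ
  | 0 => (0, ∅)
  | x + 1 =>
    if x ∈ X then nearest d v X x
    else if (nearest d v X x).2 = ∅ ∨ d v x < (nearest d v X x).1 then (d v x, {x})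
    else nearest d v X x

/-- Keep the one of two candidates (cost, number of covered terminals, covered terminals) that has
the smaller cost per covered terminal. -/
def better (p q : ℕ × ℕ × Finset ℕ) : ℕ × ℕ × Finset ℕ :=
  if q.1 * p.2.1 < p.1 * q.2.1 then q else p

/-- A candidate of minimum cost per covered terminal. -/
def best (X : Finset ℕ) (l : List (ℕ × ℕ × Finset ℕ)) : ℕ × ℕ × Finset ℕ :=
  -- The initial candidate has cost 1 for no terminal, that is, infinite density, so any candidate
  -- with a positive number of terminals replaces it.
  l.foldl better (1, 0, X)

/-- The candidates for one step of the greedy algorithm with root `v`: cover `q + 1` further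
terminals by the algorithm `A` with root `u`, where `q + 1` is at most `r`. -/
def candidates (d : ℕ → ℕ → ℕ) (N : ℕ) (A : ℕ → ℕ → Finset ℕ → ℕ × Finset ℕ) (v r : ℕ)
    (X : Finset ℕ) : List (ℕ × ℕ × Finset ℕ) :=
  (List.range N).flatMap fun u => (List.range r).map fun q =>
    (d v u + (A (q + 1) u X).1, q + 1, (A (q + 1) u X).2)

/-- One step of the greedy algorithm; the state is (cost, covered terminals, number of terminals
that are still to be covered). -/
def step (d : ℕ → ℕ → ℕ) (N : ℕ) (A : ℕ → ℕ → Finset ℕ → ℕ × Finset ℕ) (v : ℕ)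
    (p : ℕ × Finset ℕ × ℕ) : ℕ × Finset ℕ × ℕ :=
  if p.2.2 = 0 then p else
    (p.1 + (best p.2.1 (candidates d N A v p.2.2 p.2.1)).1,
      (best p.2.1 (candidates d N A v p.2.2 p.2.1)).2.2,
      p.2.2 - (best p.2.1 (candidates d N A v p.2.2 p.2.1)).2.1)

/-- One step of the greedy algorithm of level `0`. -/
def baseStep (d : ℕ → ℕ → ℕ) (n v : ℕ) (p : ℕ × Finset ℕ) : ℕ × Finset ℕ :=
  (p.1 + (nearest d v p.2 n).1, p.2 ∪ (nearest d v p.2 n).2)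

/-- The recursive greedy algorithm: from the root `v`, cover `k` further terminals besides those in
`X`. The terminals are the nodes `0, …, n - 1`, the nodes are `0, …, N - 1`. The result consists of
the cost and the set of covered terminals. -/
def cover (d : ℕ → ℕ → ℕ) (n N : ℕ) : ℕ → ℕ → ℕ → Finset ℕ → ℕ × Finset ℕ
  | 0, k, v, X => (baseStep d n v)^[k] (0, X)
  | i + 1, k, v, X =>
    (((step d N (cover d n N i) v)^[k] (0, X, k)).1, ((step d N (cover d n N i) v)^[k] (0, X, k)).2.1)

/-! ### Greedy choices and the number of covered terminals -/

theorem nearest_spec (d : ℕ → ℕ → ℕ) (v : ℕ) (X : Finset ℕ) (l : ℕ) :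
    (nearest d v X l = (0, ∅) ∧ ∀ x < l, x ∈ X) ∨
      ∃ x < l, x ∉ X ∧ nearest d v X l = (d v x, {x}) ∧ ∀ y < l, y ∉ X → d v x ≤ d v y := by
  induction l with
  | zero => exact .inl ⟨rfl, fun x hx => absurd hx (by omega)⟩
  | succ l ih =>
    rw [nearest]
    by_cases hl : l ∈ X
    · rw [if_pos hl]
      refine ih.imp (fun h => ⟨h.1, fun x hx => ?_⟩) ?_
      · rcases Nat.lt_succ_iff_lt_or_eq.mp hx with h' | rfl
        exacts [h.2 x h', hl]
      · rintro ⟨x, hx, hxX, h, hmin⟩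
        refine ⟨x, by omega, hxX, h, fun y hy hyX => ?_⟩
        rcases Nat.lt_succ_iff_lt_or_eq.mp hy with h' | rfl
        exacts [hmin y h' hyX, absurd hl hyX]
    · rw [if_neg hl]
      right
      rcases ih with ⟨h, hX⟩ | ⟨x, hx, hxX, h, hmin⟩
      · rw [h, if_pos (.inl rfl)]
        refine ⟨l, by omega, hl, rfl, fun y hy hyX => ?_⟩
        rcases Nat.lt_succ_iff_lt_or_eq.mp hy with h' | rfl
        exacts [absurd (hX y h') hyX, le_rfl]
      · by_cases hlt : d v l < d v x
        · rw [h, if_pos (.inr hlt)]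
          refine ⟨l, by omega, hl, rfl, fun y hy hyX => ?_⟩
          rcases Nat.lt_succ_iff_lt_or_eq.mp hy with h' | rfl
          exacts [hlt.le.trans (hmin y h' hyX), le_rfl]
        · rw [h, if_neg (by simpa using hlt)]
          refine ⟨x, by omega, hxX, rfl, fun y hy hyX => ?_⟩
          rcases Nat.lt_succ_iff_lt_or_eq.mp hy with h' | rfl
          exacts [hmin y h' hyX, not_lt.mp hlt]

/-- Densities are compared by cross multiplication. This comparison is transitive because the
numbers of terminals are positive and can be cancelled. -/
theorem best_spec (X : Finset ℕ) {l : List (ℕ × ℕ × Finset ℕ)} (hl : l ≠ [])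
    (hpos : ∀ e ∈ l, 0 < e.2.1) :
    best X l ∈ l ∧ ∀ e ∈ l, (best X l).1 * e.2.1 ≤ e.1 * (best X l).2.1 := by
  induction l using List.reverseRecOn with
  | nil => exact absurd rfl hl
  | append_singleton l e ih =>
    have he : 0 < e.2.1 := hpos e (by simp)
    have hb : best X (l ++ [e]) = better (best X l) e := by simp [best]
    rw [hb]
    rcases eq_or_ne l [] with rfl | hl'
    · simp [best, better, he]
    · obtain ⟨h1, h2⟩ := ih hl' fun f hf => hpos f (by simp [hf])
      have hbp := hpos _ (List.mem_append_left _ h1)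
      unfold better
      split_ifs with h
      · refine ⟨by simp, fun f hf => ?_⟩
        rcases List.mem_append.mp hf with hf | hf
        · have h3 := h2 f hf
          refine Nat.le_of_mul_le_mul_right ?_ hbp
          calc e.1 * f.2.1 * (best X l).2.1 = e.1 * (best X l).2.1 * f.2.1 := by ring
            _ ≤ (best X l).1 * e.2.1 * f.2.1 := by gcongr
            _ = (best X l).1 * f.2.1 * e.2.1 := by ring
            _ ≤ f.1 * (best X l).2.1 * e.2.1 := by gcongr
            _ = _ := by ring
        · rw [List.mem_singleton.mp hf]
      · refine ⟨by simp [h1], fun f hf => ?_⟩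
        rcases List.mem_append.mp hf with hf | hf
        · exact h2 f hf
        · rw [List.mem_singleton.mp hf]
          exact not_lt.mp h

theorem mem_candidates {d : ℕ → ℕ → ℕ} {N : ℕ} {A : ℕ → ℕ → Finset ℕ → ℕ × Finset ℕ} {v r : ℕ}
    {X : Finset ℕ} {e : ℕ × ℕ × Finset ℕ} :
    e ∈ candidates d N A v r X ↔ ∃ u < N, ∃ k, 0 < k ∧ k ≤ r ∧
      e = (d v u + (A k u X).1, k, (A k u X).2) := by
  simp only [candidates, List.mem_flatMap, List.mem_range, List.mem_map]
  constructor
  · rintro ⟨u, hu, q, hq, rfl⟩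
    exact ⟨u, hu, q + 1, by omega, by omega, rfl⟩
  · rintro ⟨u, hu, k, hk, hkr, rfl⟩
    exact ⟨u, hu, k - 1, by omega, by rw [Nat.sub_add_cancel hk]⟩

theorem best_candidates {d : ℕ → ℕ → ℕ} {N : ℕ} {A : ℕ → ℕ → Finset ℕ → ℕ × Finset ℕ} {v r : ℕ}
    (X : Finset ℕ) (hN : 0 < N) (hr : 0 < r) :
    ∃ u < N, ∃ k, 0 < k ∧ k ≤ r ∧
      best X (candidates d N A v r X) = (d v u + (A k u X).1, k, (A k u X).2) ∧
      ∀ u' < N, ∀ k', 0 < k' → k' ≤ r →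
        (d v u + (A k u X).1) * k' ≤ (d v u' + (A k' u' X).1) * k := by
  have hne : candidates d N A v r X ≠ [] :=
    List.ne_nil_of_mem (mem_candidates.mpr ⟨0, hN, r, hr, le_rfl, rfl⟩)
  obtain ⟨h1, h2⟩ := best_spec X hne fun e he => by
    obtain ⟨u, hu, k, hk, -, rfl⟩ := mem_candidates.mp he
    exact hk
  obtain ⟨u, hu, k, hk, hkr, h⟩ := mem_candidates.mp h1
  refine ⟨u, hu, k, hk, hkr, h, fun u' hu' k' hk' hkr' => ?_⟩
  have := h2 _ (mem_candidates.mpr ⟨u', hu', k', hk', hkr', rfl⟩)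
  rwa [h] at this

/-- The set `X'` arises from `X` by adding `k` terminals. -/
structure Extends (n k : ℕ) (X X' : Finset ℕ) : Prop where
  subset : X ⊆ X'
  new : ∀ x ∈ X', x ∉ X → x < n
  card : X'.card = X.card + k

theorem Extends.refl (n : ℕ) (X : Finset ℕ) : Extends n 0 X X :=
  ⟨subset_rfl, fun _ h h' => absurd h h', rfl⟩

theorem Extends.trans {n k l : ℕ} {X X' X'' : Finset ℕ} (h : Extends n k X X')
    (h' : Extends n l X' X'') : Extends n (k + l) X X'' := by
  refine ⟨h.subset.trans h'.subset, fun x hx hx' => ?_, by rw [h'.card, h.card, add_assoc]⟩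
  by_cases hX : x ∈ X'
  exacts [h.new x hX hx', h'.new x hx hX]

theorem Extends.card_sdiff {n k : ℕ} {X X' : Finset ℕ} (h : Extends n k X X') :
    (X' \ X).card = k := by
  rw [Finset.card_sdiff_of_subset h.subset, h.card]
  omega

theorem Extends.card_range_sdiff {n k : ℕ} {X X' : Finset ℕ} (h : Extends n k X X') :
    (Finset.range n \ X').card + k = (Finset.range n \ X).card := by
  have h1 : Finset.range n \ X' = (Finset.range n \ X) \ (X' \ X) := by
    ext x
    have := @h.subset x
    simp only [Finset.mem_sdiff, Finset.mem_range]
    tauto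
  have h2 : X' \ X ⊆ Finset.range n \ X := fun x hx => by
    rw [Finset.mem_sdiff] at hx ⊢
    exact ⟨Finset.mem_range.mpr (h.new x hx.1 hx.2), hx.2⟩
  have h3 := Finset.card_le_card h2
  rw [h1, Finset.card_sdiff_of_subset h2]
  have := h.card_sdiff
  omega

theorem exists_nearest {d : ℕ → ℕ → ℕ} {n : ℕ} (v : ℕ) {X : Finset ℕ}
    (h : 0 < (Finset.range n \ X).card) :
    ∃ x < n, x ∉ X ∧ nearest d v X n = (d v x, {x}) ∧ ∀ y < n, y ∉ X → d v x ≤ d v y := by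
  rcases nearest_spec d v X n with ⟨-, h'⟩ | h'
  · obtain ⟨x, hx⟩ := Finset.card_pos.mp h
    rw [Finset.mem_sdiff, Finset.mem_range] at hx
    exact absurd (h' x hx.1) hx.2
  · exact h'

theorem extends_insert {n x : ℕ} {X : Finset ℕ} (hx : x < n) (hX : x ∉ X) :
    Extends n 1 X (X ∪ {x}) := by
  refine ⟨Finset.subset_union_left, fun y hy hyX => ?_, ?_⟩
  · rw [Finset.mem_union, Finset.mem_singleton] at hy
    rcases hy with hy | rfl
    exacts [absurd hy hyX, hx]
  · rw [Finset.card_union_of_disjoint (by simpa using hX), Finset.card_singleton]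

/-- An invariant rule for the algorithm of level `0`. -/
theorem baseStep_induction {d : ℕ → ℕ → ℕ} {n v k : ℕ} {X : Finset ℕ}
    (hX : k ≤ (Finset.range n \ X).card) (I : ℕ → ℕ → Finset ℕ → Prop) (h0 : I 0 0 X)
    (hs : ∀ j c Y x, j < k → Extends n j X Y → I j c Y → x < n → x ∉ Y →
      (∀ y < n, y ∉ Y → d v x ≤ d v y) → I (j + 1) (c + d v x) (Y ∪ {x})) :
    ∀ j ≤ k, Extends n j X ((baseStep d n v)^[j] (0, X)).2 ∧
      I j ((baseStep d n v)^[j] (0, X)).1 ((baseStep d n v)^[j] (0, X)).2 := by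
  intro j
  induction j with
  | zero => exact fun _ => ⟨Extends.refl n X, h0⟩
  | succ j ih =>
    intro hj
    obtain ⟨h1, h2⟩ := ih (by omega)
    rw [Function.iterate_succ_apply']
    set p := (baseStep d n v)^[j] (0, X)
    have h3 := h1.card_range_sdiff
    obtain ⟨x, hx, hxp, h, hmin⟩ := exists_nearest (d := d) v (show 0 < (Finset.range n \ p.2).card by omega)
    simp only [baseStep, h]
    exact ⟨h1.trans (extends_insert hx hxp), hs j _ _ x (by omega) h1 h2 hx hxp hmin⟩

/-- An invariant rule for the algorithm of higher level. -/
theorem step_induction {d : ℕ → ℕ → ℕ} {n N v k : ℕ} {X : Finset ℕ}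
    {A : ℕ → ℕ → Finset ℕ → ℕ × Finset ℕ} (hN : 0 < N)
    (hA : ∀ k u X, k ≤ (Finset.range n \ X).card → Extends n k X (A k u X).2)
    (hX : k ≤ (Finset.range n \ X).card) (I : ℕ → ℕ → Finset ℕ → Prop) (h0 : I 0 0 X)
    (hs : ∀ j c Y l u, Extends n j X Y → I j c Y → u < N → 0 < l → j + l ≤ k →
      l ≤ (Finset.range n \ Y).card →
      (∀ u' < N, ∀ l', 0 < l' → l' ≤ k - j →
        (d v u + (A l u Y).1) * l' ≤ (d v u' + (A l' u' Y).1) * l) →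
      I (j + l) (c + (d v u + (A l u Y).1)) (A l u Y).2) :
    Extends n k X ((step d N A v)^[k] (0, X, k)).2.1 ∧
      I k ((step d N A v)^[k] (0, X, k)).1 ((step d N A v)^[k] (0, X, k)).2.1 := by
  -- Each round with terminals left covers at least one of them, so `j` rounds cover some `l ≥ j`,
  -- and `k` rounds cover exactly `k`.
  have key : ∀ j ≤ k, ∃ l, j ≤ l ∧ l ≤ k ∧ ((step d N A v)^[j] (0, X, k)).2.2 = k - l ∧
      Extends n l X ((step d N A v)^[j] (0, X, k)).2.1 ∧
      I l ((step d N A v)^[j] (0, X, k)).1 ((step d N A v)^[j] (0, X, k)).2.1 := by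
    intro j
    induction j with
    | zero => exact fun _ => ⟨0, le_rfl, by omega, by simp, Extends.refl n X, h0⟩
    | succ j ih =>
      intro hj
      obtain ⟨l, hjl, hlk, h1, h2, h3⟩ := ih (by omega)
      rw [Function.iterate_succ_apply']
      set p := (step d N A v)^[j] (0, X, k)
      by_cases hp : p.2.2 = 0
      · rw [step, if_pos hp]
        exact ⟨l, by omega, hlk, h1, h2, h3⟩
      · rw [step, if_neg hp]
        obtain ⟨u, hu, q, hq, hqr, h, hmin⟩ := best_candidates (d := d) (A := A) (v := v) p.2.1 hN
          (show 0 < p.2.2 by omega)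
        have h4 := h2.card_range_sdiff
        rw [h]
        refine ⟨l + q, by omega, by omega, ?_, h2.trans (hA q u _ (by omega)), ?_⟩
        · simp only
          omega
        · exact hs l p.1 p.2.1 q u h2 h3 hu hq (by omega) (by omega) (by rwa [← h1])
  obtain ⟨l, hkl, hlk, -, h2, h3⟩ := key k le_rfl
  obtain rfl : l = k := le_antisymm hlk hkl
  exact ⟨h2, h3⟩

theorem extends_cover (d : ℕ → ℕ → ℕ) {n N : ℕ} (hN : 0 < N) (i : ℕ) :
    ∀ k u X, k ≤ (Finset.range n \ X).card → Extends n k X (cover d n N i k u X).2 := by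
  induction i with
  | zero =>
    intro k u X h
    exact (baseStep_induction (d := d) (v := u) h (fun _ _ _ => True) trivial
      (fun _ _ _ _ _ _ _ _ _ _ => trivial) k le_rfl).1
  | succ i ih =>
    intro k u X h
    exact (step_induction (d := d) (v := u) hN ih h (fun _ _ _ => True) trivial
      (fun _ _ _ _ _ _ _ _ _ _ _ _ => trivial)).1

/-- `Cov d N v A c`: there is a tree of weight `c` with root `v` that contains the nodes in `A`. -/
inductive Cov (d : ℕ → ℕ → ℕ) (N : ℕ) : ℕ → Finset ℕ → ℕ → Prop
  | nil (v : ℕ) : Cov d N v ∅ 0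
  | single (v : ℕ) : Cov d N v {v} 0
  | step {v u w c : ℕ} {A : Finset ℕ} : u < N → d v u ≤ w → Cov d N u A c → Cov d N v A (w + c)
  | join {v c c' : ℕ} {A B : Finset ℕ} : Disjoint A B → Cov d N v A c → Cov d N v B c' →
      Cov d N v (A ∪ B) (c + c')

/-- The tree keeps its weight, and only some of its nodes are no longer counted. In this way an
optimal tree can still be used for comparison when some of its terminals are already covered. -/
theorem Cov.mono {d : ℕ → ℕ → ℕ} {N v c : ℕ} {A B : Finset ℕ} (h : Cov d N v A c) (hB : B ⊆ A) :
    Cov d N v B c := by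
  induction h generalizing B with
  | nil v =>
    rw [Finset.subset_empty.mp hB]
    exact .nil v
  | single v =>
    rcases Finset.subset_singleton_iff.mp hB with rfl | rfl
    exacts [.nil v, .single v]
  | step hu hw _ ih => exact .step hu hw (ih hB)
  | @join v c c' A A' hd _ _ ih ih' =>
    have : B = (B ∩ A) ∪ (B ∩ A') := by
      rw [← Finset.inter_union_distrib_left, Finset.inter_eq_left.mpr hB]
    rw [this]
    exact .join (hd.mono Finset.inter_subset_right Finset.inter_subset_right)
      (ih Finset.inter_subset_right) (ih' Finset.inter_subset_right)

/-- A tree can be extended by a new leaf. -/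
theorem Cov.insert {d : ℕ → ℕ → ℕ} {N v c p q w : ℕ} {A : Finset ℕ} (h : Cov d N v A c)
    (hp : p ∈ A) (hqA : q ∉ A) (hq : q < N) (hw : d p q ≤ w) : Cov d N v (insert q A) (c + w) := by
  induction h with
  | nil v => simp at hp
  | single v =>
    rw [Finset.mem_singleton] at hp hqA
    subst hp
    have := Cov.join (by simpa using Ne.symm hqA) (.single p) (.step hq hw (.single q) : Cov d N p {q} _)
    rwa [Finset.union_comm, ← Finset.insert_eq] at this
  | step hu hw' _ ih =>
    rw [add_assoc]
    exact .step hu hw' (ih hp hqA)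
  | @join v c c' A A' hd h h' ih ih' =>
    rw [Finset.mem_union, not_or] at hqA
    rcases Finset.mem_union.mp hp with hp | hp
    · rw [← Finset.insert_union, add_right_comm]
      refine .join ?_ (ih hp hqA.1) h'
      rw [Finset.disjoint_insert_left]
      exact ⟨hqA.2, hd⟩
    · rw [← Finset.union_insert, add_assoc]
      refine .join ?_ h (ih' hp hqA.2)
      rw [Finset.disjoint_insert_right]
      exact ⟨hqA.1, hd⟩

/-- The triangle inequality for distances from a node to itself and to others. -/
structure IsMetric (d : ℕ → ℕ → ℕ) (N : ℕ) : Prop where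
  self : ∀ u < N, d u u = 0
  triangle : ∀ u < N, ∀ v < N, ∀ w < N, d u w ≤ d u v + d v w

theorem Cov.dist_le {d : ℕ → ℕ → ℕ} {N v c a : ℕ} {A : Finset ℕ} (hd : IsMetric d N)
    (h : Cov d N v A c) (hv : v < N) (ha : a ∈ A) : a < N ∧ d v a ≤ c := by
  induction h with
  | nil v => simp at ha
  | single v =>
    rw [Finset.mem_singleton.mp ha]
    exact ⟨hv, (hd.self v hv).le⟩
  | @step v u w c A hu hw _ ih =>
    obtain ⟨h1, h2⟩ := ih hu ha
    exact ⟨h1, (hd.triangle v hv u hu a h1).trans (add_le_add hw h2)⟩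
  | join _ _ _ ih ih' =>
    rcases Finset.mem_union.mp ha with ha | ha
    · exact ⟨(ih hv ha).1, (ih hv ha).2.trans (Nat.le_add_right _ _)⟩
    · exact ⟨(ih' hv ha).1, (ih' hv ha).2.trans (Nat.le_add_left _ _)⟩

/-- If covering few terminals from any node `u`, reached from the root `r`, costs at least `lam` per
terminal, up to the factor `ρ` for the part below `u`, then so does, up to a remainder of less than
`g` terminals and an additional term `D / g` per terminal, covering many terminals. -/
theorem Cov.exists_remainder {d : ℕ → ℕ → ℕ} {N r g : ℕ} {lam ρ D : ℝ} {U : Finset ℕ}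
    (hd : IsMetric d N) (hr : r < N) (hg : 0 < g)
    (H : ∀ u A c, u < N → Cov d N u A c → A ⊆ U → 0 < A.card → A.card < 2 * g →
      lam * A.card ≤ d r u + ρ * c)
    {u c : ℕ} {A : Finset ℕ} (h : Cov d N u A c) (hu : u < N) (hA : A ⊆ U)
    (hD : (d r u + c : ℝ) ≤ D) :
    ∃ A₀ c₀, A₀ ⊆ A ∧ Cov d N u A₀ c₀ ∧ A₀.card < g ∧
      lam * (A.card - A₀.card) ≤ D / g * (A.card - A₀.card) + ρ * (c - c₀) := by
  have hg' : (0 : ℝ) < g := by exact_mod_cast hg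
  induction h with
  | nil v => exact ⟨∅, 0, subset_rfl, .nil v, by simpa using hg, by simp⟩
  | single v =>
    -- For `g = 1` a single node is already a piece of full size and is cut off at once.
    rcases (show g = 1 ∨ 1 < g by omega) with rfl | hg1
    · refine ⟨∅, 0, by simp, .nil v, by simp, ?_⟩
      have := H v {v} 0 hu (.single v) hA (by simp) (by simp)
      simp at this hD ⊢
      linarith
    · exact ⟨{v}, 0, subset_rfl, .single v, by simpa using hg1, by simp⟩
  | @step v u w c A hu' hw h ih =>
    -- By the triangle inequality, descending along an edge does not increase the distance from `r`
    -- plus the weight of the remaining subtree, so `D` remains a bound.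
    obtain ⟨A₀, c₀, h1, h2, h3, h4⟩ := ih hu' hA (by
      have h5 : (d r u : ℝ) ≤ d r v + d v u := by exact_mod_cast hd.triangle r hr v hu u hu'
      have h6 : (d v u : ℝ) ≤ w := by exact_mod_cast hw
      push_cast at hD
      linarith)
    refine ⟨A₀, w + c₀, h1, .step hu' hw h2, h3, ?_⟩
    push_cast
    rwa [add_sub_add_left_eq_sub]
  | @join v c c' A B hAB h h' ih ih' =>
    push_cast at hD
    have hc : (0 : ℝ) ≤ c := by positivity
    have hc' : (0 : ℝ) ≤ c' := by positivity
    obtain ⟨A₀, c₀, h1, h2, h3, h4⟩ := ih hu (Finset.union_subset_left hA) (by linarith)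
    obtain ⟨B₀, c₀', h1', h2', h3', h4'⟩ := ih' hu (Finset.union_subset_right hA) (by linarith)
    have hd₀ : Disjoint A₀ B₀ := hAB.mono h1 h1'
    have e1 : ((A ∪ B).card : ℝ) = A.card + B.card := by
      exact_mod_cast Finset.card_union_of_disjoint hAB
    have e2 : ((A₀ ∪ B₀).card : ℝ) = A₀.card + B₀.card := by
      exact_mod_cast Finset.card_union_of_disjoint hd₀
    have hj := Cov.join hd₀ h2 h2'
    by_cases hlt : (A₀ ∪ B₀).card < g
    · refine ⟨A₀ ∪ B₀, c₀ + c₀', Finset.union_subset_union h1 h1', hj, hlt, ?_⟩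
      rw [e1, e2]
      push_cast
      linarith
    -- The two remainders together have at least `g` and fewer than `2 * g` terminals and are cut
    -- off as one piece, to which `H` applies. Connecting it to `r` costs at most `D`, which is
    -- charged to its at least `g` terminals.
    · refine ⟨∅, 0, by simp, .nil v, by simpa using hg, ?_⟩
      have hcard := Finset.card_union_of_disjoint hd₀
      have h5 := H v _ _ hu hj ((Finset.union_subset_union h1 h1').trans hA) (by omega) (by omega)
      have h6 : D ≤ D / g * ((A₀ ∪ B₀).card : ℝ) := by
        have h7 : (g : ℝ) ≤ ((A₀ ∪ B₀).card : ℝ) := by exact_mod_cast not_lt.mp hlt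
        have h8 : 0 ≤ D := le_trans (by positivity) hD
        rw [div_mul_eq_mul_div, le_div_iff₀ hg']
        gcongr
      rw [e2] at h5 h6
      rw [e1]
      simp only [Finset.card_empty, Nat.cast_zero, sub_zero]
      push_cast at h5 ⊢
      linarith

/-- Here `D` is the weight `c` of the tree. The final remainder sits at the root, where `d r r = 0`,
so `H` accounts for it without any cost of connection. -/
theorem Cov.density_le {d : ℕ → ℕ → ℕ} {N r g : ℕ} {lam ρ : ℝ} {U : Finset ℕ}
    (hd : IsMetric d N) (hr : r < N) (hg : 0 < g)
    (H : ∀ u A c, u < N → Cov d N u A c → A ⊆ U → 0 < A.card → A.card < 2 * g →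
      lam * A.card ≤ d r u + ρ * c)
    {c : ℕ} {A : Finset ℕ} (h : Cov d N r A c) (hA : A ⊆ U) (hρ : 0 ≤ ρ) :
    lam * A.card ≤ c / g * A.card + ρ * c := by
  have hrr : (d r r : ℝ) = 0 := by exact_mod_cast hd.self r hr
  obtain ⟨A₀, c₀, h1, h2, h3, h4⟩ := h.exists_remainder (D := c) hd hr hg H hr hA (by
    rw [hrr, zero_add])
  have h5 : (0 : ℝ) ≤ c / g * A₀.card := by positivity
  rcases Finset.eq_empty_or_nonempty A₀ with rfl | hne
  · simp only [Finset.card_empty, Nat.cast_zero, sub_zero] at h4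
    have h6 : 0 ≤ ρ * c₀ := by positivity
    linarith
  · have h6 := H r A₀ c₀ hr h2 (h1.trans hA) (Finset.card_pos.mpr hne) (by omega)
    rw [hrr] at h6
    linarith

/-- The approximation ratio of the recursive greedy algorithm: up to `2 * b ^ i` terminals are
covered at level `i`, and `h` bounds the harmonic numbers. -/
noncomputable def ratio (b h : ℝ) : ℕ → ℝ
  | 0 => 1
  | i + 1 => (2 * b + ratio b h i) * h

theorem ratio_nonneg {b h : ℝ} (hb : 0 ≤ b) (hh : 0 ≤ h) (i : ℕ) : 0 ≤ ratio b h i := by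
  induction i with
  | zero => exact zero_le_one
  | succ i ih =>
    rw [ratio]
    positivity

theorem ratio_le {b h : ℝ} (hb : 0 ≤ b) (hh : 1 ≤ h) (i : ℕ) :
    ratio b h i ≤ (2 * b + 1) * (2 * h) ^ i := by
  induction i with
  | zero =>
    simp [ratio]
    linarith
  | succ i ih =>
    have h1 : 2 * b ≤ (2 * b + 1) * (2 * h) ^ i := by
      have := one_le_pow₀ (show 1 ≤ 2 * h by linarith) (n := i)
      nlinarith
    calc ratio b h (i + 1) = (2 * b + ratio b h i) * h := rfl
      _ ≤ ((2 * b + 1) * (2 * h) ^ i + (2 * b + 1) * (2 * h) ^ i) * h := by gcongr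
      _ = _ := by ring

/-- The difference consists of the `l` terms from `1 / (j + 1)` to `1 / r`, none of which is less
than `1 / r`. -/
theorem div_le_harmonic_sub {j l r : ℕ} (hr : 0 < r) (h : j + l = r) :
    (l / r : ℝ) ≤ harmonic r - harmonic j := by
  subst h
  have : harmonic (j + l) - harmonic j = ∑ x ∈ Finset.range l, ((↑(j + x + 1) : ℚ))⁻¹ := by
    rw [harmonic, harmonic, Finset.sum_range_add]
    simp
  rw [← Rat.cast_sub, this]
  push_cast
  have h1 : ∀ x ∈ Finset.range l, ((j : ℝ) + l)⁻¹ ≤ ((j : ℝ) + x + 1)⁻¹ := fun x hx => by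
    have h2 : x + 1 ≤ l := Finset.mem_range.mp hx
    have h2' : (x : ℝ) + 1 ≤ l := by exact_mod_cast h2
    apply inv_anti₀ (by positivity)
    linarith
  have := Finset.sum_le_sum h1
  simp only [Finset.sum_const, Finset.card_range, nsmul_eq_mul] at this
  rwa [← div_eq_mul_inv] at this

/-- Suppose `r` terminals are still to be covered. The given tree of weight `c` contains `r`
uncovered ones; cut it into pieces with about `g = b ^ i` terminals. Connecting the pieces to the
root costs at most `c * r / g ≤ 2 * b * c` in all, and level `i` covers each piece within the factor
`ratio b h i`. So the greedy step pays at most `(2 * b + ratio b h i) * c / r` per terminal, and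
these amounts are dominated by differences of harmonic numbers, which telescope. -/
theorem cover_le {d : ℕ → ℕ → ℕ} {n N b : ℕ} {h : ℝ} (hd : IsMetric d N)
    (hb : 0 < b) (hh : ∀ k ≤ n, (harmonic k : ℝ) ≤ h) (i : ℕ) :
    ∀ {k v c : ℕ} {A X : Finset ℕ}, v < N → Cov d N v A c → A ⊆ Finset.range n \ X →
      A.card = k → k < 2 * b ^ i → ((cover d n N i k v X).1 : ℝ) ≤ ratio b h i * c := by
  have hh0 : 0 ≤ h := by simpa using hh 0 (Nat.zero_le n)
  induction i with
  | zero =>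
    intro k v c A X hv hC hA hk hkb
    rw [pow_zero] at hkb
    have hkX : k ≤ (Finset.range n \ X).card := hk ▸ Finset.card_le_card hA
    have := (baseStep_induction (d := d) (v := v) hkX (fun j c' Y => c' ≤ j * c) (by simp) ?_ k
      le_rfl).2
    · have h1 : (cover d n N 0 k v X).1 ≤ c :=
        this.trans ((Nat.mul_le_mul_right c (by omega : k ≤ 1)).trans (one_mul c).le)
      simpa [ratio] using h1
    · intro j c' Y x hj hE hc hx hxY hmin
      have hj0 : j = 0 := by omega
      subst hj0
      have hYX : Y = X := (Finset.eq_of_subset_of_card_le hE.subset hE.card.le).symm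
      obtain ⟨a, ha⟩ := Finset.card_pos.mp (show 0 < A.card by omega)
      have ha' := hA ha
      rw [Finset.mem_sdiff, Finset.mem_range] at ha'
      have h1 := hmin a ha'.1 (hYX ▸ ha'.2)
      have h2 := (hC.dist_le hd hv ha).2
      simp only [zero_mul, zero_add, one_mul] at hc ⊢
      omega
  | succ i ih =>
    intro k v c A X hv hC hA hk hkb
    have hkX : k ≤ (Finset.range n \ X).card := hk ▸ Finset.card_le_card hA
    have hkn : k ≤ n := hkX.trans ((Finset.card_le_card Finset.sdiff_subset).trans
      (Finset.card_range n).le)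
    have hρ : 0 ≤ ratio b h i := ratio_nonneg (by positivity) hh0 i
    have hN : 0 < N := by omega
    have := (step_induction (d := d) (v := v) hN (extends_cover d hN i) hkX
      (fun j c' _ => (c' : ℝ) ≤ (2 * b + ratio b h i) * c * (harmonic k - harmonic (k - j)))
      (by simp) ?_).2
    · refine this.trans ?_
      simp only [Nat.sub_self, harmonic_zero, Rat.cast_zero, sub_zero, ratio]
      rw [mul_assoc, mul_assoc]
      have h1 : (c : ℝ) * harmonic k ≤ h * c := by
        rw [mul_comm]
        gcongr
        exact hh k hkn
      gcongr
    · intro j c' Y l u hE hc hu hl hjl hlY hmin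
      have hr : 0 < k - j := by omega
      -- `A` still contains enough terminals that are not covered
      have hcard : k - j ≤ (A \ Y).card := by
        have h1 : A \ Y = A \ (Y \ X) := by
          ext a
          have h2 : a ∈ A → a ∉ X := fun ha => (Finset.mem_sdiff.mp (hA ha)).2
          simp only [Finset.mem_sdiff]
          tauto
        have h2 := Finset.le_card_sdiff (Y \ X) A
        rw [hE.card_sdiff, hk] at h2
        rwa [h1]
      obtain ⟨A', hA', hA'c⟩ := Finset.exists_subset_card_eq hcard
      have hl' : (0 : ℝ) < l := by exact_mod_cast hl
      have hr' : (0 : ℝ) < ((k - j : ℕ) : ℝ) := by exact_mod_cast hr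
      have hA'Y : A' ⊆ Finset.range n \ Y := fun a ha => by
        have h1 := Finset.mem_sdiff.mp (hA' ha)
        exact Finset.mem_sdiff.mpr ⟨(Finset.mem_sdiff.mp (hA h1.1)).1, h1.2⟩
      set C : ℕ := d v u + (cover d n N i l u Y).1 with hCdef
      -- `C / l` is the density of the chosen candidate. By its minimality, covering any piece `A''`
      -- recursively from its own root is no cheaper per terminal, which is the hypothesis `H`.
      have hdens := Cov.density_le (lam := C / l) (ρ := ratio b h i) (U := A') (g := b ^ i) hd hv
        (by positivity) (fun u' A'' c'' hu' hC'' hA'' hpos hlt => ?_)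
        (hC.mono (hA'.trans Finset.sdiff_subset)) subset_rfl hρ
      · rw [hA'c] at hdens
        have h1 : ((k - j : ℕ) : ℝ) ≤ 2 * b * (b ^ i : ℕ) := by
          have : k - j ≤ 2 * b * b ^ i := by
            rw [pow_succ] at hkb
            calc k - j ≤ k := Nat.sub_le _ _
              _ ≤ 2 * (b ^ i * b) := hkb.le
              _ = _ := by ring
          exact_mod_cast this
        have h2 : (c : ℝ) / (b ^ i : ℕ) * ((k - j : ℕ) : ℝ) ≤ 2 * b * c := by
          rw [div_mul_eq_mul_div, div_le_iff₀ (by exact_mod_cast (by positivity : 0 < b ^ i))]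
          calc (c : ℝ) * ((k - j : ℕ) : ℝ) ≤ c * (2 * b * (b ^ i : ℕ)) := by gcongr
            _ = _ := by ring
        have h3 : (C : ℝ) ≤ (2 * b + ratio b h i) * c * (l / (k - j : ℕ)) := by
          have h4 : (C : ℝ) / l * ((k - j : ℕ) : ℝ) ≤ (2 * b + ratio b h i) * c := by linarith
          rw [← mul_div_assoc, le_div_iff₀ hr']
          rw [div_mul_eq_mul_div, div_le_iff₀ hl'] at h4
          exact h4
        have h4 := div_le_harmonic_sub hr (show k - (j + l) + l = k - j by omega)
        have h5 : (2 * b + ratio b h i) * c * (l / (k - j : ℕ)) ≤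
            (2 * b + ratio b h i) * c * (harmonic (k - j) - harmonic (k - (j + l))) := by gcongr
        push_cast at hc ⊢
        linarith
      · have hq : A''.card ≤ k - j := hA'c ▸ Finset.card_le_card hA''
        have h1 := hmin u' hu' A''.card hpos hq
        have h2 := ih hu' hC'' (hA''.trans hA'Y) rfl hlt
        have h1' : (C : ℝ) * A''.card ≤ (d v u' + (cover d n N i A''.card u' Y).1) * l := by
          exact_mod_cast h1
        rw [div_mul_eq_mul_div, div_le_iff₀ hl']
        refine h1'.trans ?_
        gcongr

end Greedy

/-! ### The recursive greedy algorithm on the random access machine -/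

namespace RAM

set_option linter.unusedSimpArgs false

attribute [simp] wp Expr.eval Program.WritesReg Program.WritesArr Program.writesReg_for
  Program.writesArr_for Program.writesReg_mul Program.writesArr_mul State.reg_setReg
  State.arr_setReg State.reg_setArr State.arr_setArr

/-- The natural number that represents a finite set. -/
def code (X : Finset ℕ) : ℕ := ∑ x ∈ X, 2 ^ x

/-- A set of terminals is held in one register as a bit mask; membership is the parity after `x`
halvings. -/
theorem code_div_mod (X : Finset ℕ) (x : ℕ) : code X / 2 ^ x % 2 = if x ∈ X then 1 else 0 := by
  have h : x ∈ X ↔ code X / 2 ^ x % 2 = 1 := by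
    rw [← decide_eq_true_iff (p := code X / 2 ^ x % 2 = 1), ← Nat.testBit_eq_decide_div_mod_eq,
      ← Nat.mem_bitIndices, ← List.mem_toFinset, code, Finset.toFinset_bitIndices_sum_two_pow]
  split_ifs with hx
  · exact h.mp hx
  · have := mt h.mpr hx
    omega

theorem code_union {X Y : Finset ℕ} (h : Disjoint X Y) : code (X ∪ Y) = code X + code Y :=
  Finset.sum_union h

/-- The memory holds the number `n` of terminals, the number `N` of nodes, and the distances. -/
structure HasDist (n N : ℕ) (d : ℕ → ℕ → ℕ) (s : State) : Prop where
  n_eq : s.reg 2 = n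
  N_eq : s.reg 4 = N
  dist : ∀ p < N, ∀ q < N, s.arr 13 (s.arr 12 p + q) = d p q

theorem HasDist.frame {n N : ℕ} {d : ℕ → ℕ → ℕ} {s s' : State} {P : Program} (h : HasDist n N d s)
    (hf : Frame P s s') (h2 : ¬ P.WritesReg 2) (h4 : ¬ P.WritesReg 4) (h12 : ¬ P.WritesArr 12)
    (h13 : ¬ P.WritesArr 13) : HasDist n N d s' := by
  refine ⟨by rw [hf.reg _ h2, h.n_eq], by rw [hf.reg _ h4, h.N_eq], ?_⟩
  rw [hf.arr _ h12, hf.arr _ h13]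
  exact h.dist

/-- The entry of the distance matrix in the row and the column given by two registers. -/
def distExpr (p q : ℕ) : Expr := .get 13 (.add (.get 12 (.var p)) (.var q))

/-- Find the terminal outside `X` that is nearest to `v`. -/
def nearestProg (b : ℕ) : Program :=
  .assign (b + 105) (.lit 0) ;;
  .assign (b + 106) (.lit 0) ;;
  .assign (b + 107) (.var (b + 102)) ;;
  .assign (b + 108) (.lit 1) ;;
  .for (b + 109) (.var 2)
    (.cond (.sub (.var (b + 107)) (.add (.half (.var (b + 107))) (.half (.var (b + 107)))))
      .skip
      (.cond (.add (.sub (.lit 1) (.var (b + 106)))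
          (.sub (.var (b + 105)) (distExpr (b + 101) (b + 109))))
        (.assign (b + 105) (distExpr (b + 101) (b + 109)) ;;
         .assign (b + 106) (.var (b + 108)))
        .skip) ;;
    .assign (b + 107) (.half (.var (b + 107))) ;;
    .assign (b + 108) (.add (.var (b + 108)) (.var (b + 108))))

open Greedy

theorem wp_nearestProg {L n N v b : ℕ} {d : ℕ → ℕ → ℕ} {X : Finset ℕ} {s : State}
    (hs : HasDist n N d s) (hnN : n ≤ N) (hnL : n ≤ L) (hv : v < N) (hsv : s.reg (b + 101) = v)
    (hX : s.reg (b + 102) = code X) :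
    wp L (nearestProg b) (fun s' => s'.reg (b + 105) = (nearest d v X n).1 ∧
      s'.reg (b + 106) = code (nearest d v X n).2) s := by
  simp only [nearestProg, wp]
  refine wp_for n (fun j s' => s'.reg (b + 105) = (nearest d v X j).1 ∧
      s'.reg (b + 106) = code (nearest d v X j).2 ∧ s'.reg (b + 107) = code X / 2 ^ j ∧
      s'.reg (b + 108) = 2 ^ j) hnL (by simp) ?_ ?_ ?_ ?_
  · intro s' hf
    simpa [hs.n_eq] using hf.reg 2 (by simp)
  · simp [nearest, code, hX]
  · rintro j hj s' hf hsj ⟨h1, h2, h3, h4⟩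
    have hd : s'.arr 13 (s'.arr 12 v + j) = d v j := by
      have h12 := hf.arr 12 (by simp)
      have h13 := hf.arr 13 (by simp)
      simp only [State.arr_setReg] at h12 h13
      rw [h12, h13]
      exact hs.dist v hv j (by omega)
    have hv' : s'.reg (b + 101) = v := by
      have := hf.reg (b + 101) (by simp)
      simpa [hsv] using this
    have hodd := code_div_mod X j
    have hdiv : code X / 2 ^ j / 2 = code X / 2 ^ (j + 1) := by
      rw [Nat.div_div_eq_div_mul, pow_succ]
    have hpow : 2 ^ j + 2 ^ j = 2 ^ (j + 1) := by ring
    -- Nonempty sets have positive codes, so the truncated difference `1 - code` tests for the empty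
    -- set.
    have hcode : (1 - code (nearest d v X j).2 = 0) ↔ ¬ (nearest d v X j).2 = ∅ := by
      rw [← ne_eq, ← Finset.nonempty_iff_ne_empty]
      constructor
      · intro h
        by_contra hne
        rw [Finset.not_nonempty_iff_eq_empty.mp hne] at h
        simp [code] at h
      · rintro ⟨x, hx⟩
        have : 2 ^ x ≤ code (nearest d v X j).2 :=
          Finset.single_le_sum (f := fun x => 2 ^ x) (fun _ _ => Nat.zero_le _) hx
        have := Nat.one_le_two_pow (n := x)
        omega
    have hsub : code X / 2 ^ j - (code X / 2 ^ j / 2 + code X / 2 ^ j / 2) = 0 ↔ j ∉ X := by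
      split_ifs at hodd with h <;> simp only [h, not_true, not_false_iff, iff_true, iff_false] <;>
        omega
    simp only [wp, Expr.eval, distExpr, hv', hsj, hd, h1, h2, h3, h4, State.reg_setReg,
      State.arr_setReg, hsub, ne_eq, not_not, Nat.add_eq_zero_iff, hcode]
    refine ⟨fun hjX => ?_, fun hjX => ⟨fun h => ?_, fun h => ?_⟩⟩
    · simp [nearest, hjX, h1, h2, hdiv, hpow]
    · have hn : nearest d v X (j + 1) = (d v j, {j}) := by
        rw [nearest, if_neg hjX, if_pos]
        rwa [Nat.sub_eq_zero_iff_le, not_and_or, not_not, not_le] at h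
      have hc : code {j} = 2 ^ j := by simp [code]
      simp [hn, hdiv, hpow, hc]
    · have hn : nearest d v X (j + 1) = nearest d v X j := by
        rw [nearest, if_neg hjX, if_neg]
        rwa [not_or, not_lt, ← Nat.sub_eq_zero_iff_le]
      simp [hn, hdiv, hpow, h1, h2]
  · rintro s' - - ⟨h1, h2, -, -⟩
    exact ⟨h1, h2⟩

/-- Compute a candidate for one step of the greedy algorithm, where `P` is the program of the level
below, and compare it with the best candidate so far. -/
def candidateProg (b : ℕ) (P : Program) : Program :=
  .assign (b + 120) (.add (.var (b + 109)) (.lit 1)) ;;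
  .assign (b + 121) (.var (b + 108)) ;;
  .assign (b + 122) (.var (b + 102)) ;;
  P ;;
  .assign (b + 111) (.add (distExpr (b + 101) (b + 108)) (.var (b + 123))) ;;
  .assign (b + 114) (.var (b + 111)) ;;
  .assign (b + 115) (.var (b + 106)) ;;
  .mul (b + 112) (b + 114) (b + 115) ;;
  .assign (b + 114) (.var (b + 105)) ;;
  .assign (b + 115) (.add (.var (b + 109)) (.lit 1)) ;;
  .mul (b + 113) (b + 114) (b + 115) ;;
  .cond (.sub (.var (b + 113)) (.var (b + 112)))
    (.assign (b + 105) (.var (b + 111)) ;;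
    .assign (b + 106) (.add (.var (b + 109)) (.lit 1)) ;;
    .assign (b + 107) (.var (b + 122)))
    .skip

/-- The algorithm of level `i`, with the registers from `b + 100` on: the registers `b + 100`,
`b + 101`, `b + 102` hold the number of terminals to be covered, the root, and the covered
terminals, which are updated; the cost is returned in the register `b + 103`. -/
def coverProg : ℕ → ℕ → Program
  | 0, b =>
    .assign (b + 103) (.lit 0) ;;
    .for (b + 104) (.var (b + 100))
      (nearestProg b ;;
      .assign (b + 103) (.add (.var (b + 103)) (.var (b + 105))) ;;
      .assign (b + 102) (.add (.var (b + 102)) (.var (b + 106))))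
  | i + 1, b =>
    .assign (b + 103) (.lit 0) ;;
    .assign (b + 110) (.var (b + 100)) ;;
    .for (b + 104) (.var (b + 100))
      (.cond (.var (b + 110))
        (.assign (b + 105) (.lit 1) ;;
        .assign (b + 106) (.lit 0) ;;
        .assign (b + 107) (.var (b + 102)) ;;
        .for (b + 108) (.var 4)
          (.for (b + 109) (.var (b + 110))
            (candidateProg b (coverProg i (b + 20)))) ;;
        .assign (b + 103) (.add (.var (b + 103)) (.var (b + 105))) ;;
        .assign (b + 102) (.var (b + 107)) ;;
        .assign (b + 110) (.sub (.var (b + 110)) (.var (b + 106))))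
        .skip)

/-- The windows of registers of consecutive levels are shifted by 20. A call writes nothing below `b
+ 102`, in particular neither of its first two parameters, so the caller's own variables, which lie
below `b + 120`, survive the call based at `b + 20`. -/
theorem not_writesReg_coverProg (i : ℕ) : ∀ b y, y < b + 102 → ¬ (coverProg i b).WritesReg y := by
  induction i with
  | zero =>
    intro b y hy
    simp only [coverProg, nearestProg, Program.WritesReg, Program.writesReg_for, or_false, false_or]
    omega
  | succ i ih =>
    intro b y hy
    have := ih (b + 20) y (by omega)
    simp only [coverProg, Program.WritesReg, Program.writesReg_for, Program.writesReg_mul, this, or_false,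
      false_or, candidateProg]
    omega

theorem not_writesArr_coverProg (i : ℕ) : ∀ b a, ¬ (coverProg i b).WritesArr a := by
  induction i with
  | zero => simp [coverProg, nearestProg]
  | succ i ih => simp [coverProg, candidateProg, ih]

theorem disjoint_nearest (d : ℕ → ℕ → ℕ) (v : ℕ) (X : Finset ℕ) (l : ℕ) :
    Disjoint X (nearest d v X l).2 := by
  rcases nearest_spec d v X l with ⟨h, -⟩ | ⟨x, -, hx, h, -⟩
  · rw [h]
    exact Finset.disjoint_empty_right X
  · rw [h]
    simpa using hx

theorem wp_coverProg_zero {L n N v k b : ℕ} {d : ℕ → ℕ → ℕ} {X : Finset ℕ} {s : State}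
    (hs : HasDist n N d s) (hnN : n ≤ N) (hnL : n ≤ L) (hv : v < N) (hk : k ≤ L)
    (hsk : s.reg (b + 100) = k) (hsv : s.reg (b + 101) = v) (hX : s.reg (b + 102) = code X) :
    wp L (coverProg 0 b) (fun s' => s'.reg (b + 103) = (cover d n N 0 k v X).1 ∧
      s'.reg (b + 102) = code (cover d n N 0 k v X).2) s := by
  simp only [coverProg, wp]
  refine wp_for k (fun j s' => s'.reg (b + 103) = ((baseStep d n v)^[j] (0, X)).1 ∧
      s'.reg (b + 102) = code ((baseStep d n v)^[j] (0, X)).2) hk (by simp [nearestProg]) ?_ ?_ ?_ ?_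
  · intro s' hf
    simpa [hsk] using hf.reg (b + 100) (by simp [nearestProg])
  · simp [hX]
  · rintro j hj s' hf hsj ⟨h1, h2⟩
    set p := (baseStep d n v)^[j] (0, X) with hp
    have hv' : s'.reg (b + 101) = v := by
      simpa [hsv] using hf.reg (b + 101) (by simp [nearestProg])
    have hs' : HasDist n N d s' := by
      refine HasDist.frame ?_ hf ?_ ?_ ?_ ?_
      · exact ⟨by simp [hs.n_eq], by simp [hs.N_eq], hs.dist⟩
      all_goals simp [nearestProg]
    simp only [wp]
    refine wp_call (wp_nearestProg hs' hnN hnL hv hv' h2) fun s'' h'' hf'' => ?_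
    have h3 : s''.reg (b + 103) = p.1 := by
      rw [hf''.reg _ (by simp [nearestProg]), h1]
    have h4 : s''.reg (b + 102) = code p.2 := by
      rw [hf''.reg _ (by simp [nearestProg]), h2]
    rw [Function.iterate_succ_apply', ← hp]
    simp [h'', h3, h4, baseStep, code_union (disjoint_nearest _ _ _ _)]
  · rintro s' - - ⟨h1, h2⟩
    exact ⟨h1, h2⟩

theorem best_append (X : Finset ℕ) (l : List (ℕ × ℕ × Finset ℕ)) (e : ℕ × ℕ × Finset ℕ) :
    best X (l ++ [e]) = better (best X l) e := by
  simp [best]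

theorem best_le {X : Finset ℕ} {l : List (ℕ × ℕ × Finset ℕ)} {r : ℕ} (h : ∀ e ∈ l, e.2.1 ≤ r) :
    (best X l).2.1 ≤ r := by
  induction l using List.reverseRecOn with
  | nil => simp [best]
  | append_singleton l e ih =>
    rw [best_append, better]
    split_ifs
    exacts [h e (by simp), ih fun f hf => h f (by simp [hf])]

/-- The level below enters only through the specification `hP` and the registers it leaves alone, so
that induction on the level can supply it. -/
theorem wp_candidateProg {L n N u v q b : ℕ} {d : ℕ → ℕ → ℕ} {Y : Finset ℕ} {s : State}
    {P : Program} {A : ℕ → ℕ → Finset ℕ → ℕ × Finset ℕ} {acc : ℕ × ℕ × Finset ℕ}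
    (hP : ∀ s, HasDist n N d s → s.reg (b + 120) = q + 1 → s.reg (b + 121) = u →
      s.reg (b + 122) = code Y → wp L P (fun s' => s'.reg (b + 123) = (A (q + 1) u Y).1 ∧
        s'.reg (b + 122) = code (A (q + 1) u Y).2) s)
    (hPr : ∀ y < b + 122, ¬ P.WritesReg y) (hPa : ∀ a, ¬ P.WritesArr a)
    (hs : HasDist n N d s) (hu : u < N) (hv : v < N) (hq : q < L) (hacc : acc.2.1 ≤ L)
    (hsv : s.reg (b + 101) = v) (hsY : s.reg (b + 102) = code Y) (hsu : s.reg (b + 108) = u)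
    (hsq : s.reg (b + 109) = q) (h1 : s.reg (b + 105) = acc.1) (h2 : s.reg (b + 106) = acc.2.1)
    (h3 : s.reg (b + 107) = code acc.2.2) :
    wp L (candidateProg b P) (fun s' =>
      s'.reg (b + 105) = (better acc (d v u + (A (q + 1) u Y).1, q + 1, (A (q + 1) u Y).2)).1 ∧
      s'.reg (b + 106) = (better acc (d v u + (A (q + 1) u Y).1, q + 1, (A (q + 1) u Y).2)).2.1 ∧
      s'.reg (b + 107) =
        code (better acc (d v u + (A (q + 1) u Y).1, q + 1, (A (q + 1) u Y).2)).2.2) s := by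
  have hsize : ∀ x ≤ L, x.size ≤ L := fun x hx =>
    (Nat.size_le.mpr Nat.lt_two_pow_self).trans hx
  simp only [candidateProg, wp]
  refine wp_call (hP _ ⟨by simp [hs.n_eq], by simp [hs.N_eq], hs.dist⟩ (by simp [hsq])
    (by simp [hsu]) (by simp [hsY])) ?_
  rintro s1 ⟨hc, hX⟩ hf
  have r : ∀ y < b + 120, s1.reg y = s.reg y := fun y hy => by
    rw [hf.reg y (hPr y (by omega))]
    simp [show y ≠ b + 120 by omega, show y ≠ b + 121 by omega, show y ≠ b + 122 by omega]
  have hd : s1.arr 13 (s1.arr 12 v + u) = d v u := by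
    have h12 := hf.arr 12 (hPa _)
    have h13 := hf.arr 13 (hPa _)
    simp only [State.arr_setReg] at h12 h13
    rw [h12, h13]
    exact hs.dist v hv u hu
  -- Multiplication overwrites its factors, hence the copies in `b + 114` and `b + 115`. The costs
  -- may be huge, but the factor that determines the number of rounds is a number of terminals, at
  -- most `L`.
  refine wp_mul (by simp) (by simp) (by simp) ?_ ?_
  · simpa [r, h2] using hsize _ hacc
  intro s2 hf2 hp2
  have r2 : ∀ y, y ≠ b + 111 → y ≠ b + 112 → y ≠ b + 114 → y ≠ b + 115 → s2.reg y = s1.reg y := by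
    intro y h1 h2 h3 h4
    rw [hf2.reg y (by simp [h2, h3, h4])]
    simp [h1, h3, h4]
  have h111 : s2.reg (b + 111) = d v u + (A (q + 1) u Y).1 := by
    rw [hf2.reg _ (by simp)]
    simp [distExpr, r, hsv, hsu, hd, hc]
  have hp2' : s2.reg (b + 112) = (d v u + (A (q + 1) u Y).1) * acc.2.1 := by
    rw [hp2]
    simp [distExpr, r, hsv, hsu, hd, hc, h2]
  refine wp_mul (by simp) (by simp) (by simp) ?_ ?_
  · simpa [r, r2, hsq] using hsize _ hq
  intro s3 hf3 hp3
  have r3 : ∀ y, y ≠ b + 113 → y ≠ b + 114 → y ≠ b + 115 → s3.reg y = s2.reg y := by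
    intro y h1 h2 h3
    rw [hf3.reg y (by simp [h1, h2, h3])]
    simp [h2, h3]
  have hp3' : s3.reg (b + 113) = acc.1 * (q + 1) := by
    rw [hp3]
    simp [r, r2, h1, hsq]
  simp only [wp, Expr.eval, State.reg_setReg, hp3', r3, r2, r, hp2', h111, hX, hsq, h1, h2, h3, ne_eq,
    Nat.sub_eq_zero_iff_le, not_le, better, Nat.reduceEqDiff, not_false_eq_true,
    add_right_inj, Nat.add_lt_add_iff_left, Nat.reduceLT]
  refine ⟨fun h => ?_, fun h => ?_⟩
  · rw [if_pos h]
    simp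
  · rw [if_neg (not_lt.mpr h)]
    simp

theorem wp_coverProg {L n N : ℕ} {d : ℕ → ℕ → ℕ} (hnN : n ≤ N) (hNL : N ≤ L) (i : ℕ) :
    ∀ {k v b : ℕ} {X : Finset ℕ} {s : State}, HasDist n N d s → v < N → k ≤ L →
      s.reg (b + 100) = k → s.reg (b + 101) = v → s.reg (b + 102) = code X →
      wp L (coverProg i b) (fun s' => s'.reg (b + 103) = (cover d n N i k v X).1 ∧
        s'.reg (b + 102) = code (cover d n N i k v X).2) s := by
  induction i with
  | zero => exact fun hs hv hk hsk hsv hX =>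
      wp_coverProg_zero hs hnN (hnN.trans hNL) hv hk hsk hsv hX
  | succ i ih =>
    intro k v b X s hs hv hk hsk hsv hX
    have hP := not_writesReg_coverProg i (b + 20)
    have hPr : ∀ y < b + 105, ¬ (candidateProg b (coverProg i (b + 20))).WritesReg y := by
      intro y hy
      have := hP y (by omega)
      simp only [candidateProg, Program.WritesReg, Program.writesReg_mul, this, or_false, false_or]
      omega
    have hPr' : ∀ y, 108 ≤ y → y ≤ 110 →
        ¬ (candidateProg b (coverProg i (b + 20))).WritesReg (b + y) := by
      intro y hy hy'
      have := hP (b + y) (by omega)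
      simp only [candidateProg, Program.WritesReg, Program.writesReg_mul, this, or_false, false_or]
      omega
    have hPa : ∀ a, ¬ (candidateProg b (coverProg i (b + 20))).WritesArr a := by
      simp [candidateProg, not_writesArr_coverProg]
    set P := candidateProg b (coverProg i (b + 20)) with hPdef
    simp only [coverProg, wp, ← hPdef]
    refine wp_for k (fun j s' =>
      s'.reg (b + 103) = ((step d N (cover d n N i) v)^[j] (0, X, k)).1 ∧
      s'.reg (b + 102) = code ((step d N (cover d n N i) v)^[j] (0, X, k)).2.1 ∧
      s'.reg (b + 110) = ((step d N (cover d n N i) v)^[j] (0, X, k)).2.2 ∧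
      ((step d N (cover d n N i) v)^[j] (0, X, k)).2.2 ≤ k) hk ?_ ?_ ?_ ?_ ?_
    · simp [hPr]
    · intro s' hf
      simpa [hsk] using hf.reg (b + 100) (by simp [hPr])
    · simp [hX, hsk]
    · rintro j hj s' hf hsj ⟨h1, h2, h3, h4⟩
      rw [Function.iterate_succ_apply']
      set p := (step d N (cover d n N i) v)^[j] (0, X, k) with hp
      have hv' : s'.reg (b + 101) = v := by
        simpa [hsv] using hf.reg (b + 101) (by simp [hPr])
      have hs' : HasDist n N d s' := by
        refine HasDist.frame ?_ hf ?_ ?_ ?_ ?_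
        · exact ⟨by simp [hs.n_eq], by simp [hs.N_eq], hs.dist⟩
        · simp [hPr 2 (by omega)]
        · simp [hPr 4 (by omega)]
        · simp [hPa]
        · simp [hPa]
      clear hf
      refine ⟨fun h0 => ?_, fun h0 => ?_⟩
      swap
      · have h0' : p.2.2 = 0 := by rw [← h3]; exact h0
        simp [wp, step, h0', h1, h2, h3]
      have h0' : p.2.2 ≠ 0 := by rw [← h3]; exact h0
      simp only [wp]
      -- The best candidate among those rooted at the first `u` nodes. Only the enumeration is cut
      -- off at `u`; the level below still works with all `N` nodes.
      set acc : ℕ → ℕ × ℕ × Finset ℕ := fun u => best p.2.1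
        (candidates d u (cover d n N i) v p.2.2 p.2.1) with hacc
      have hcand : ∀ u q, (candidates d u (cover d n N i) v p.2.2 p.2.1 ++
          (List.range (q + 1)).map fun q => (d v u + (cover d n N i (q + 1) u p.2.1).1, q + 1,
            (cover d n N i (q + 1) u p.2.1).2)) =
          (candidates d u (cover d n N i) v p.2.2 p.2.1 ++
          (List.range q).map fun q => (d v u + (cover d n N i (q + 1) u p.2.1).1, q + 1,
            (cover d n N i (q + 1) u p.2.1).2)) ++ [(d v u + (cover d n N i (q + 1) u p.2.1).1,
              q + 1, (cover d n N i (q + 1) u p.2.1).2)] := by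
        intro u q
        simp [List.range_succ]
      have haccs : ∀ u, acc (u + 1) = best p.2.1 (candidates d u (cover d n N i) v p.2.2 p.2.1 ++
          (List.range p.2.2).map fun q => (d v u + (cover d n N i (q + 1) u p.2.1).1, q + 1,
            (cover d n N i (q + 1) u p.2.1).2)) := by
        intro u
        simp [hacc, candidates, List.range_succ, List.flatMap_append]
      refine wp_for N (fun u s' => s'.reg (b + 105) = (acc u).1 ∧ s'.reg (b + 106) = (acc u).2.1 ∧
        s'.reg (b + 107) = code (acc u).2.2) hNL ?_ ?_ ?_ ?_ ?_
      · simp [hPr']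
      · intro s1 hf
        simpa [hs'.N_eq] using hf.reg 4 (by simp [hPr 4 (by omega)])
      · simp [hacc, candidates, best, h2]
      · rintro u hu s1 hf hsu ⟨g1, g2, g3⟩
        have hs1 : HasDist n N d s1 := by
          refine HasDist.frame ?_ hf ?_ ?_ ?_ ?_
          · exact ⟨by simp [hs'.n_eq], by simp [hs'.N_eq], hs'.dist⟩
          · simp [hPr 2 (by omega)]
          · simp [hPr 4 (by omega)]
          · simp [hPa]
          · simp [hPa]
        have hv1 : s1.reg (b + 101) = v := by
          simpa [hv'] using hf.reg (b + 101) (by simp [hPr])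
        have hY1 : s1.reg (b + 102) = code p.2.1 := by
          simpa [h2] using hf.reg (b + 102) (by simp [hPr])
        have hr1 : s1.reg (b + 110) = p.2.2 := by
          simpa [h3] using hf.reg (b + 110) (by simp [hPr'])
        clear hf
        refine wp_for p.2.2 (fun q s' =>
          s'.reg (b + 105) = (best p.2.1 (candidates d u (cover d n N i) v p.2.2 p.2.1 ++
            (List.range q).map fun q => (d v u + (cover d n N i (q + 1) u p.2.1).1, q + 1,
              (cover d n N i (q + 1) u p.2.1).2))).1 ∧
          s'.reg (b + 106) = (best p.2.1 (candidates d u (cover d n N i) v p.2.2 p.2.1 ++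
            (List.range q).map fun q => (d v u + (cover d n N i (q + 1) u p.2.1).1, q + 1,
              (cover d n N i (q + 1) u p.2.1).2))).2.1 ∧
          s'.reg (b + 107) = code (best p.2.1 (candidates d u (cover d n N i) v p.2.2 p.2.1 ++
            (List.range q).map fun q => (d v u + (cover d n N i (q + 1) u p.2.1).1, q + 1,
              (cover d n N i (q + 1) u p.2.1).2))).2.2) (h4.trans hk) (hPr' _ (by omega) (by omega))
              ?_ ?_ ?_ ?_
        · intro s2 hf
          simpa [hr1] using hf.reg (b + 110) (by simp [hPr'])
        · simp [g1, g2, g3, hacc]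
        · rintro q hq s2 hf hsq ⟨e1, e2, e3⟩
          have hs2 : HasDist n N d s2 := by
            refine HasDist.frame hs1 hf ?_ ?_ ?_ ?_
            · simp [hPr 2 (by omega)]
            · simp [hPr 4 (by omega)]
            · simp [hPa]
            · simp [hPa]
          have hv2 : s2.reg (b + 101) = v := by
            simpa [hv1] using hf.reg (b + 101) (by simp [hPr])
          have hY2 : s2.reg (b + 102) = code p.2.1 := by
            simpa [hY1] using hf.reg (b + 102) (by simp [hPr])
          have hu2 : s2.reg (b + 108) = u := by
            simpa [hsu] using hf.reg (b + 108) (by simp [hPr'])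
          rw [hcand, best_append]
          refine wp_mono (wp_candidateProg (A := cover d n N i) (fun s0 k0 k1 k2 k3 => ?_)
            (fun y hy => hP y (by omega)) (not_writesArr_coverProg i _) hs2 hu hv (by omega) ?_
            hv2 hY2 hu2 hsq e1 e2 e3) fun s3 h => ?_
          · exact ih k0 hu (by omega) k1 k2 k3
          · refine (best_le fun e he => ?_).trans (h4.trans hk)
            rcases List.mem_append.mp he with he | he
            · obtain ⟨_, _, _, _, h, rfl⟩ := mem_candidates.mp he
              exact h
            · obtain ⟨q', hq', rfl⟩ := List.mem_map.mp he
              have := List.mem_range.mp hq'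
              simp only
              omega
          · simpa using h
        · rintro s2 - - h
          simp only [haccs]
          simpa using h
      · rintro s1 hf - ⟨g1, g2, g3⟩
        have hc1 : s1.reg (b + 103) = p.1 := by
          simpa [h1] using hf.reg (b + 103) (by simp [hPr])
        have hr1 : s1.reg (b + 110) = p.2.2 := by
          simpa [h3] using hf.reg (b + 110) (by simp [hPr'])
        rw [hacc] at g1 g2 g3
        simp only [step, if_neg h0']
        simp [g1, g2, g3, hc1, hr1, h4]
        omega
    · rintro s' - - ⟨h1, h2, -⟩
      exact ⟨h1, h2⟩

end RAM

/-! ### Shortest paths and the edges that realize a cost -/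

/-- A directed graph whose nodes are the natural numbers; one can pass from one node to another if
the head of the former is the tail of the latter and time does not run backwards. -/
structure NodeGraph where
  tail : ℕ → ℕ
  head : ℕ → ℕ
  time : ℕ → ℕ
  wt : ℕ → ℕ

namespace NodeGraph

/-- One can pass from `p` to `q`. -/
def Arc (G : NodeGraph) (p q : ℕ) : Prop := G.head p = G.tail q ∧ G.time p ≤ G.time q

instance (G : NodeGraph) (p q : ℕ) : Decidable (G.Arc p q) :=
  inferInstanceAs (Decidable (_ ∧ _))

/-- There is a walk from `p` to `q` that visits, after `p`, only nodes in `M`. -/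
def Conn (G : NodeGraph) (M : Multiset ℕ) : ℕ → ℕ → Prop :=
  Relation.ReflTransGen fun p q => G.Arc p q ∧ q ∈ M

theorem Conn.mono {G : NodeGraph} {M M' : Multiset ℕ} {p q : ℕ} (h : G.Conn M p q) (hM : M ≤ M') :
    G.Conn M' p q :=
  Relation.ReflTransGen.mono (fun _ _ h => ⟨h.1, Multiset.mem_of_le hM h.2⟩) _ _ h

/-- The cost of passing from `p` to `q` directly, where `inf` stands for infinity. -/
def direct (G : NodeGraph) (inf p q : ℕ) : ℕ :=
  if p = q then 0 else if G.Arc p q then G.wt q else inf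

/-- The distance from `p` to `q` with intermediate nodes below `k`. -/
def dist (G : NodeGraph) (inf : ℕ) : ℕ → ℕ → ℕ → ℕ
  | 0, p, q => G.direct inf p q
  | k + 1, p, q => min (G.dist inf k p q) (G.dist inf k p k + G.dist inf k k q)

theorem dist_self (G : NodeGraph) (inf k p : ℕ) : G.dist inf k p p = 0 := by
  induction k with
  | zero => simp [dist, direct]
  | succ k ih => simp [dist, ih]

/-- Column `k` does not change in round `k`, because the distance from `k` to itself is zero. With
the same fact for row `k`, this permits updating the matrix in place. -/
theorem dist_succ_left (G : NodeGraph) (inf k p : ℕ) :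
    G.dist inf (k + 1) p k = G.dist inf k p k := by
  simp [dist, dist_self]

theorem dist_succ_right (G : NodeGraph) (inf k q : ℕ) :
    G.dist inf (k + 1) k q = G.dist inf k k q := by
  simp [dist, dist_self]

/-- If `u` is the intermediate node admitted last, the right-hand side is one of the two terms of
the minimum. Otherwise the inequality is inherited from the previous round. The value `inf` is an
ordinary number and needs no special treatment. -/
theorem dist_triangle (G : NodeGraph) (inf k : ℕ) {u : ℕ} (hu : u < k) (p q : ℕ) :
    G.dist inf k p q ≤ G.dist inf k p u + G.dist inf k u q := by
  induction k generalizing p q with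
  | zero => omega
  | succ k ih =>
    rcases Nat.lt_succ_iff_lt_or_eq.mp hu with h | rfl
    · have h1 := ih h p q
      have h2 := ih h p k
      have h3 := ih h k q
      simp only [dist]
      omega
    · rw [dist_succ_left, dist_succ_right]
      simp only [dist]
      omega

theorem dist_le_direct (G : NodeGraph) (inf k p q : ℕ) : G.dist inf k p q ≤ G.direct inf p q := by
  induction k with
  | zero => exact le_rfl
  | succ k ih => exact (min_le_left _ _).trans ih

theorem dist_le_wt (G : NodeGraph) (inf k : ℕ) {p q : ℕ} (h : G.Arc p q) :
    G.dist inf k p q ≤ G.wt q := by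
  refine (G.dist_le_direct inf k p q).trans ?_
  simp only [direct, if_pos h]
  split_ifs <;> simp

theorem isMetric_dist (G : NodeGraph) (inf N : ℕ) : Greedy.IsMetric (G.dist inf N) N :=
  ⟨fun u _ => G.dist_self inf N u, fun u _ _ hv w _ => G.dist_triangle inf N hv u w⟩

/-- `M` is a multiset of at most `K` nodes below `N` of total weight `c`. -/
structure IsBill (G : NodeGraph) (N K c : ℕ) (M : Multiset ℕ) : Prop where
  lt : ∀ x ∈ M, x < N
  card_le : M.card ≤ K
  sum_eq : (M.map G.wt).sum = c

theorem IsBill.add {G : NodeGraph} {N K K' c c' : ℕ} {M M' : Multiset ℕ} (h : G.IsBill N K c M)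
    (h' : G.IsBill N K' c' M') : G.IsBill N (K + K') (c + c') (M + M') := by
  refine ⟨fun x hx => ?_, ?_, ?_⟩
  · rcases Multiset.mem_add.mp hx with hx | hx
    exacts [h.lt x hx, h'.lt x hx]
  · rw [Multiset.card_add]
    exact add_le_add h.card_le h'.card_le
  · rw [Multiset.map_add, Multiset.sum_add, h.sum_eq, h'.sum_eq]

theorem IsBill.mono {G : NodeGraph} {N K K' c : ℕ} {M : Multiset ℕ} (h : G.IsBill N K c M)
    (hK : K ≤ K') : G.IsBill N K' c M :=
  ⟨h.lt, h.card_le.trans hK, h.sum_eq⟩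

theorem isBill_zero (G : NodeGraph) (N K : ℕ) : G.IsBill N K 0 0 :=
  ⟨by simp, by simp, by simp⟩

/-- Finite distances are realized by walks. -/
theorem exists_bill_dist (G : NodeGraph) {inf N : ℕ} (k : ℕ) (hk : k ≤ N) {p q : ℕ} (hp : p < N)
    (hq : q < N) (h : G.dist inf k p q < inf) :
    ∃ M, G.IsBill N (2 ^ k) (G.dist inf k p q) M ∧ G.Conn M p q := by
  induction k generalizing p q with
  | zero =>
    simp only [dist, direct] at h ⊢
    by_cases hpq : p = q
    · subst hpq
      rw [if_pos rfl]
      exact ⟨0, G.isBill_zero N _, Relation.ReflTransGen.refl⟩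
    · rw [if_neg hpq] at h ⊢
      by_cases ha : G.Arc p q
      · rw [if_pos ha]
        exact ⟨{q}, ⟨by simpa using hq, by simp, by simp⟩,
          Relation.ReflTransGen.single ⟨ha, by simp⟩⟩
      · rw [if_neg ha] at h
        omega
  | succ k ih =>
    simp only [dist] at h ⊢
    rcases le_total (G.dist inf k p q) (G.dist inf k p k + G.dist inf k k q) with hle | hle
    · rw [min_eq_left hle] at h ⊢
      obtain ⟨M, hM, hc⟩ := ih (by omega) hp hq h
      exact ⟨M, hM.mono (by rw [pow_succ]; omega), hc⟩
    -- Both halves are finite because their sum is below `inf`. Each may use `2 ^ k` nodes, with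
    -- repetitions, so the bound doubles; this is harmless, as `bits` grows linearly with the number
    -- of nodes.
    · rw [min_eq_right hle] at h ⊢
      obtain ⟨M, hM, hc⟩ := ih (by omega) hp (show k < N by omega) (by omega)
      obtain ⟨M', hM', hc'⟩ := ih (by omega) (show k < N by omega) hq (by omega)
      refine ⟨M + M', (hM.add hM').mono (by rw [pow_succ]; omega), ?_⟩
      exact (hc.mono (Multiset.le_add_right M M')).trans (hc'.mono (Multiset.le_add_left M' M))

open Greedy in
/-- A finite cost of the greedy algorithm is realized by walks to all new terminals. -/
theorem exists_bill_cover (G : NodeGraph) {inf n N : ℕ} (hn : n ≤ N) (i : ℕ) :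
    ∀ {k v : ℕ} {X : Finset ℕ}, v < N → k ≤ (Finset.range n \ X).card →
      (cover (G.dist inf N) n N i k v X).1 < inf →
      ∃ M, G.IsBill N ((i + 1) * k * 2 ^ N) (cover (G.dist inf N) n N i k v X).1 M ∧
        ∀ x ∈ (cover (G.dist inf N) n N i k v X).2, x ∉ X → G.Conn M v x := by
  induction i with
  | zero =>
    intro k v X hv hX
    refine (baseStep_induction (d := G.dist inf N) (v := v) hX (fun j c Y => c < inf →
      ∃ M, G.IsBill N ((0 + 1) * j * 2 ^ N) c M ∧ ∀ x ∈ Y, x ∉ X → G.Conn M v x) ?_ ?_ k le_rfl).2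
    · exact fun _ => ⟨0, G.isBill_zero N _, fun x hx hx' => absurd hx hx'⟩
    · intro j c Y x _ _ hI hx _ _ hlt
      obtain ⟨M, hM, hc⟩ := hI (by omega)
      obtain ⟨M', hM', hc'⟩ := G.exists_bill_dist (inf := inf) N le_rfl hv (show x < N by omega) (by omega)
      refine ⟨M + M', (hM.add hM').mono (le_of_eq (by ring)), fun y hy hyX => ?_⟩
      rcases Finset.mem_union.mp hy with hy | hy
      · exact (hc y hy hyX).mono (Multiset.le_add_right _ _)
      · rw [Finset.mem_singleton.mp hy]
        exact hc'.mono (Multiset.le_add_left _ _)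
  | succ i ih =>
    intro k v X hv hX
    refine (step_induction (d := G.dist inf N) (v := v) (by omega) (extends_cover _ (by omega) i) hX
      (fun j c Y => c < inf →
      ∃ M, G.IsBill N ((i + 1 + 1) * j * 2 ^ N) c M ∧ ∀ x ∈ Y, x ∉ X → G.Conn M v x) ?_ ?_).2
    · exact fun _ => ⟨0, G.isBill_zero N _, fun x hx hx' => absurd hx hx'⟩
    -- Finiteness passes to every summand of the cost. The walk to `u` adds up to `2 ^ N` nodes, at
    -- most `l * 2 ^ N` because `l` is positive; so each level contributes one more multiple of `k *
    -- 2 ^ N`.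
    · intro j c Y l u _ hI hu hl _ hlY _ hlt
      obtain ⟨M, hM, hc⟩ := hI (by omega)
      obtain ⟨M', hM', hc'⟩ := G.exists_bill_dist (inf := inf) N le_rfl hv hu (by omega)
      obtain ⟨M'', hM'', hc''⟩ := ih hu hlY (by omega)
      refine ⟨M + (M' + M''), (hM.add (hM'.add hM'')).mono ?_, fun y hy hyX => ?_⟩
      · have : 2 ^ N ≤ l * 2 ^ N := Nat.le_mul_of_pos_left _ hl
        calc (i + 1 + 1) * j * 2 ^ N + (2 ^ N + (i + 1) * l * 2 ^ N)
            ≤ (i + 1 + 1) * j * 2 ^ N + (l * 2 ^ N + (i + 1) * l * 2 ^ N) := by gcongr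
          _ = _ := by ring
      · by_cases hyY : y ∈ Y
        · exact (hc y hyY hyX).mono (Multiset.le_add_right _ _)
        · refine Relation.ReflTransGen.trans (b := u) (hc'.mono ?_) ((hc'' y hy hyY).mono ?_)
          · exact (Multiset.le_add_right M' M'').trans (Multiset.le_add_left _ _)
          · exact (Multiset.le_add_left M'' M').trans (Multiset.le_add_left _ _)

end NodeGraph

/-! ### Shortest paths on the random access machine -/

namespace RAM

set_option linter.unusedSimpArgs false

/-- The memory holds the matrix `D` with `N` rows and columns, and the offsets of its rows. -/
structure HasMatrix (N : ℕ) (D : ℕ → ℕ → ℕ) (s : State) : Prop where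
  N_eq : s.reg 4 = N
  offset : ∀ p < N, s.arr 12 p = p * N
  entry : ∀ p < N, ∀ q < N, s.arr 13 (p * N + q) = D p q

theorem HasMatrix.hasDist {n N : ℕ} {D : ℕ → ℕ → ℕ} {s : State} (h : HasMatrix N D s)
    (hn : s.reg 2 = n) : HasDist n N D s :=
  ⟨hn, h.N_eq, fun p hp q hq => by rw [h.offset p hp, h.entry p hp q hq]⟩

theorem index_inj {N p q p' q' : ℕ} (hq : q < N) (hq' : q' < N) (h : p * N + q = p' * N + q') :
    p = p' ∧ q = q' := by
  have hN : 0 < N := by omega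
  have h1 : (p * N + q) / N = p := by
    rw [mul_comm, Nat.mul_add_div hN, Nat.div_eq_of_lt hq, add_zero]
  have h2 : (p' * N + q') / N = p' := by
    rw [mul_comm, Nat.mul_add_div hN, Nat.div_eq_of_lt hq', add_zero]
  have h3 : p = p' := by rw [← h1, h, h2]
  subst h3
  exact ⟨rfl, by omega⟩

/-- The matrix that has the entries of `E` up to the entry `(p, q)` and those of `D` from then on. -/
def mixed (D E : ℕ → ℕ → ℕ) (p q : ℕ) (p' q' : ℕ) : ℕ :=
  if p' < p ∨ p' = p ∧ q' < q then E p' q' else D p' q'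

/-- Replace the entries of a matrix one by one. -/
theorem wp_matrix {L N x y : ℕ} {P : Program} {D E : ℕ → ℕ → ℕ} {s : State} {Q : State → Prop}
    (hNL : N ≤ L) (hxy : x ≠ y) (hx : ¬ P.WritesReg x) (hy : ¬ P.WritesReg y)
    (h4 : ¬ P.WritesReg 4) (h4x : 4 ≠ x) (h4y : 4 ≠ y) (h12 : ¬ P.WritesArr 12)
    (hs : HasMatrix N D s)
    (hP : ∀ p < N, ∀ q < N, ∀ s', Frame (.for x (.var 4) (.for y (.var 4) P)) s s' →
      s'.reg x = p → s'.reg y = q → HasMatrix N (mixed D E p q) s' →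
      wp L P (fun s'' => ∀ i, s''.arr 13 i = if i = p * N + q then E p q else s'.arr 13 i) s')
    (hQ : ∀ s', Frame (.for x (.var 4) (.for y (.var 4) P)) s s' → HasMatrix N E s' → Q s') :
    wp L (.for x (.var 4) (.for y (.var 4) P)) Q s := by
  refine wp_for N (fun p s' => ∀ p' < N, ∀ q' < N, s'.arr 13 (p' * N + q') = mixed D E p 0 p' q')
    hNL ?_ ?_ ?_ ?_ ?_
  · simp [hxy, hx]
  · intro s' hf
    simpa [hs.N_eq] using hf.reg 4 (by simp [*])
  · intro p' hp' q' hq'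
    simp [mixed, hs.entry p' hp' q' hq']
  · intro p hp s1 hf hs1 h1
    have hN1 : s1.reg 4 = N := by
      simpa [hs.N_eq] using hf.reg 4 (by simp [*])
    refine wp_for N (fun q s' => ∀ p' < N, ∀ q' < N,
      s'.arr 13 (p' * N + q') = mixed D E p q p' q') hNL hy ?_ ?_ ?_ ?_
    · intro s' hf'
      simpa [hN1] using hf'.reg 4 (by simp [*])
    · exact h1
    · intro q hq s2 hf2 hs2 h2
      have hxs2 : s2.reg x = p := by
        rw [hf2.reg x (by simp [*]), hs1]
      have hf3 := hf.trans (hf2.mono (P' := .for x (.var 4) (.for y (.var 4) P)) (by simp; tauto)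
        (by simp))
      refine wp_mono (hP p hp q hq s2 hf3 hxs2 hs2 ⟨?_, ?_, h2⟩) fun s3 h3 p' hp' q' hq' => ?_
      · rw [hf2.reg 4 (by simp [*]), hN1]
      · intro r hr
        rw [hf3.arr 12 (by simp [*])]
        exact hs.offset r hr
      · rw [State.arr_setReg, h3, h2 p' hp' q' hq']
        by_cases he : p' = p ∧ q' = q
        · rw [he.1, he.2, if_pos rfl, mixed, if_pos (by omega)]
        · rw [if_neg fun h => he (index_inj hq' hq h), mixed, mixed]
          congr 1
          apply propext
          omega
    · intro s2 hf2 _ h2 p' hp' q' hq'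
      rw [State.arr_setReg, h2 p' hp' q' hq', mixed, mixed]
      congr 1
      apply propext
      omega
  · intro s' hf hsx h'
    refine hQ s' hf ⟨?_, ?_, fun p hp q hq => ?_⟩
    · rw [hf.reg 4 (by simp [*]), hs.N_eq]
    · intro p hp
      rw [hf.arr 12 (by simp [*]), hs.offset p hp]
    · rw [h' p hp q hq, mixed, if_pos (.inl hp)]

/-- The Floyd-Warshall algorithm on the graph whose nodes are described by the arrays `8`, `9`, `10`
and `11`; the number of nodes is in register `4`, infinity is in register `7`. -/
def distProg : Program :=
  .assign 10 (.lit 0) ;;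
  .for 11 (.var 4)
    (.store 12 (.var 11) (.var 10) ;;
    .assign 10 (.add (.var 10) (.var 4))) ;;
  .for 11 (.var 4)
    (.for 12 (.var 4)
      (.cond (.add (.sub (.var 11) (.var 12)) (.sub (.var 12) (.var 11)))
        (.cond (.add (.sub (.get 10 (.var 11)) (.get 10 (.var 12)))
            (.add (.sub (.get 9 (.var 11)) (.get 8 (.var 12)))
              (.sub (.get 8 (.var 12)) (.get 9 (.var 11)))))
          (.store 13 (.add (.get 12 (.var 11)) (.var 12)) (.var 7))
          (.store 13 (.add (.get 12 (.var 11)) (.var 12)) (.get 11 (.var 12))))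
        (.store 13 (.add (.get 12 (.var 11)) (.var 12)) (.lit 0)))) ;;
  .for 13 (.var 4)
    (.for 11 (.var 4)
      (.for 12 (.var 4)
        (.cond (.sub (distExpr 11 12) (.add (distExpr 11 13) (distExpr 13 12)))
          (.store 13 (.add (.get 12 (.var 11)) (.var 12))
            (.add (distExpr 11 13) (distExpr 13 12)))
          .skip)))

/-- The memory holds the data of the first `N` nodes of the graph `G`. -/
structure HasNodes (N : ℕ) (G : NodeGraph) (s : State) : Prop where
  tail : ∀ p < N, s.arr 8 p = G.tail p
  head : ∀ p < N, s.arr 9 p = G.head p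
  time : ∀ p < N, s.arr 10 p = G.time p
  wt : ∀ p < N, s.arr 11 p = G.wt p

theorem HasNodes.frame {N : ℕ} {G : NodeGraph} {s s' : State} {P : Program} (h : HasNodes N G s)
    (hf : Frame P s s') (h8 : ¬ P.WritesArr 8) (h9 : ¬ P.WritesArr 9) (h10 : ¬ P.WritesArr 10)
    (h11 : ¬ P.WritesArr 11) : HasNodes N G s' := by
  refine ⟨?_, ?_, ?_, ?_⟩
  · rw [hf.arr _ h8]
    exact h.tail
  · rw [hf.arr _ h9]
    exact h.head
  · rw [hf.arr _ h10]
    exact h.time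
  · rw [hf.arr _ h11]
    exact h.wt

theorem wp_distProg {L N inf : ℕ} {G : NodeGraph} {s : State} (hNL : N ≤ L) (hN : s.reg 4 = N)
    (hinf : s.reg 7 = inf) (hG : HasNodes N G s) :
    wp L distProg (HasMatrix N (G.dist inf N)) s := by
  simp only [distProg, wp]
  refine wp_for N (fun j s' => s'.reg 10 = j * N ∧ ∀ p < j, s'.arr 12 p = p * N) hNL (by simp)
    ?_ ?_ ?_ ?_
  · intro s' hf
    simpa [hN] using hf.reg 4 (by simp)
  · simp
  · rintro j hj s1 hf hsj ⟨h1, h2⟩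
    have hN1 : s1.reg 4 = N := by simpa [hN] using hf.reg 4 (by simp)
    simp only [wp, Expr.eval, State.reg_setReg, State.reg_setArr, State.arr_setReg,
      State.arr_setArr, hN1, h1, hsj, if_true]
    refine ⟨by simp [add_mul], fun p hp => ?_⟩
    split_ifs with h
    · rw [h]
    · exact h2 p (by omega)
  rintro s1 hf1 - ⟨-, h12⟩
  have hN1 : s1.reg 4 = N := by simpa [hN] using hf1.reg 4 (by simp)
  have hinf1 : s1.reg 7 = inf := by simpa [hinf] using hf1.reg 7 (by simp)
  have hG1 : HasNodes N G s1 := by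
    refine HasNodes.frame ?_ hf1 (by simp) (by simp) (by simp) (by simp)
    exact ⟨hG.tail, hG.head, hG.time, hG.wt⟩
  -- Before the initialization the matrix is arbitrary, so `D` is whatever the memory holds.
  refine wp_matrix (D := fun p q => s1.arr 13 (p * N + q)) (E := G.dist inf 0) hNL (by simp)
    (by simp) (by simp) (by simp) (by simp) (by simp) (by simp)
    ⟨hN1, h12, fun p _ q _ => rfl⟩ ?_ ?_
  · intro p hp q hq s2 hf2 hx hy hM
    have hG2 := hG1.frame hf2 (by simp) (by simp) (by simp) (by simp)
    have hinf2 : s2.reg 7 = inf := by simpa [hinf1] using hf2.reg 7 (by simp)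
    simp only [wp, Expr.eval, hx, hy, hM.offset p hp, hG2.tail q hq, hG2.head p hp, hG2.time p hp,
      hG2.time q hq, hG2.wt q hq, hinf2, State.arr_setArr, if_true]
    refine ⟨fun h => ⟨fun h' i => ?_, fun h' i => ?_⟩, fun h i => ?_⟩
    · have : G.dist inf 0 p q = inf := by
        rw [NodeGraph.dist, NodeGraph.direct, if_neg (by omega), if_neg]
        rintro ⟨h3, h4⟩
        omega
      rw [this]
    · have : G.dist inf 0 p q = G.wt q := by
        rw [NodeGraph.dist, NodeGraph.direct, if_neg (by omega), if_pos]
        exact ⟨by omega, by omega⟩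
      rw [this]
    · obtain rfl : p = q := by omega
      rw [NodeGraph.dist_self]
  intro s2 hf2 hM2
  refine wp_for N (fun k s' => HasMatrix N (G.dist inf k) s') hNL (by simp) ?_ ?_ ?_ ?_
  · intro s' hf
    simpa [hM2.N_eq] using hf.reg 4 (by simp)
  · exact ⟨by simp [hM2.N_eq], hM2.offset, hM2.entry⟩
  · intro k hk s3 hf3 hk3 hM3
    refine wp_matrix (E := G.dist inf (k + 1)) hNL (by simp)
      (by simp) (by simp) (by simp) (by simp) (by simp) (by simp) hM3 ?_ ?_
    · intro p hp q hq s4 hf4 hx hy hM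
      have hk4 : s4.reg 13 = k := by simpa [hk3] using hf4.reg 13 (by simp)
      have e1 : s4.arr 13 (p * N + q) = G.dist inf k p q := by
        rw [hM.entry p hp q hq, mixed, if_neg (by omega)]
      -- It does not matter whether this entry has already been replaced in round `k`, since both
      -- values agree; likewise for `e3`.
      have e2 : s4.arr 13 (p * N + k) = G.dist inf k p k := by
        rw [hM.entry p hp k hk, mixed, G.dist_succ_left, ite_self]
      have e3 : s4.arr 13 (k * N + q) = G.dist inf k k q := by
        rw [hM.entry k hk q hq, mixed, G.dist_succ_right, ite_self]
      simp only [wp, Expr.eval, distExpr, hx, hy, hk4, hM.offset p hp, hM.offset k hk, e1, e2, e3,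
        State.arr_setArr, if_true, NodeGraph.dist]
      refine ⟨fun h i => ?_, fun h i => ?_⟩
      · rw [min_eq_right (by omega)]
      · rw [min_eq_left (by omega)]
        split_ifs with hi
        · rw [hi, e1]
        · rfl
    · intro s' hf h
      exact ⟨by simp [h.N_eq], h.offset, h.entry⟩
  · intro s' _ _ h
    exact h

end RAM

/-! ### The approximation algorithm on the random access machine -/

/-- The input of the algorithm: the number `n` of vertices, the lifetime, the number `m` of temporal
edges, and for each of them its end points, label, and the numerator and denominator of its
weight. -/
structure TCInput where
  n : ℕ
  life : ℕ
  m : ℕ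
  fst : ℕ → ℕ
  snd : ℕ → ℕ
  label : ℕ → ℕ
  num : ℕ → ℕ
  den : ℕ → ℕ

namespace TCInput

variable (T : TCInput)

/-- The number of nodes: a sink and a source for each vertex, and each temporal edge in both
directions. -/
def nodes : ℕ := T.m + T.m + (T.n + T.n)

/-- The number of bits reserved for the number of uses of a temporal edge. -/
def bits (i : ℕ) : ℕ := (i + 3) * (T.nodes + 2)

/-- The integral weight: the weight multiplied by the product of all denominators. -/
def intWeight (j : ℕ) : ℕ := T.num j * ∏ l ∈ Finset.range T.m, if l = j then 1 else T.den l

/-- The perturbed weight, from the multiples of which the temporal edges can be read off. -/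
def pertWeight (i j : ℕ) : ℕ :=
  T.intWeight j * 2 ^ (T.bits i * (T.m + 1)) + 2 ^ (T.bits i * j)

/-- A number that is larger than any cost that occurs. -/
def inf (i : ℕ) : ℕ := (∑ j ∈ Finset.range T.m, T.pertWeight i j + 1) * 2 ^ T.bits i

/-- The graph in which shortest paths are computed. -/
def graph (i : ℕ) : NodeGraph where
  tail p := if p < T.n then p else if p < T.n + T.n then T.n + 1 else
    if p < T.n + T.n + T.m then T.fst (p - (T.n + T.n)) else T.snd (p - (T.n + T.n + T.m))
  head p := if p < T.n then T.n else if p < T.n + T.n then p - T.n else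
    if p < T.n + T.n + T.m then T.snd (p - (T.n + T.n)) else T.fst (p - (T.n + T.n + T.m))
  time p := if p < T.n then T.life else if p < T.n + T.n then 0 else
    if p < T.n + T.n + T.m then T.label (p - (T.n + T.n)) else T.label (p - (T.n + T.n + T.m))
  wt p := if p < T.n + T.n then 0 else
    if p < T.n + T.n + T.m then T.pertWeight i (p - (T.n + T.n))
    else T.pertWeight i (p - (T.n + T.n + T.m))

/-- The distances between the nodes. -/
def dist (i : ℕ) : ℕ → ℕ → ℕ := (T.graph i).dist (T.inf i) T.nodes

/-- The cost of the tree that is computed for the root `r`. -/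
def rootCost (i r : ℕ) : ℕ := (Greedy.cover (T.dist i) T.n T.nodes i T.n (T.n + r) ∅).1

/-- The total cost of the trees for all roots. -/
def totalCost (i : ℕ) : ℕ := ∑ r ∈ Finset.range T.n, T.rootCost i r

/-- The temporal edge `j` is used in one of the trees. -/
def Used (i j : ℕ) : Prop := T.totalCost i / 2 ^ (T.bits i * j) % 2 ^ T.bits i ≠ 0

instance (i : ℕ) : DecidablePred (T.Used i) := fun _ => inferInstanceAs (Decidable (_ ≠ _))

/-- The output of the algorithm. -/
def result (i : ℕ) : List ℕ :=
  ((List.range T.m).filter (T.Used i ·)).flatMap fun j => [T.fst j, T.snd j, T.label j]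

end TCInput

namespace RAM

set_option linter.unusedSimpArgs false

/-- The memory holds the input `T` in the form in which it is used by the algorithm. -/
structure HasInput (T : TCInput) (i : ℕ) (s : State) : Prop where
  n_eq : s.reg 2 = T.n
  m_eq : s.reg 3 = T.m
  nodes_eq : s.reg 4 = T.nodes
  life_eq : s.reg 5 = T.life
  bits_eq : s.reg 6 = T.bits i
  fst : ∀ j < T.m, s.arr 2 j = T.fst j
  snd : ∀ j < T.m, s.arr 3 j = T.snd j
  label : ∀ j < T.m, s.arr 4 j = T.label j
  num : ∀ j < T.m, s.arr 5 j = T.num j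
  den : ∀ j < T.m, s.arr 6 j = T.den j

theorem HasInput.frame {T : TCInput} {i : ℕ} {s s' : State} {P : Program} (h : HasInput T i s)
    (hf : Frame P s s') (hr : ∀ y, 2 ≤ y → y ≤ 6 → ¬ P.WritesReg y)
    (ha : ∀ a, 2 ≤ a → a ≤ 6 → ¬ P.WritesArr a) : HasInput T i s' := by
  refine ⟨?_, ?_, ?_, ?_, ?_, ?_, ?_, ?_, ?_, ?_⟩
  · rw [hf.reg _ (hr _ (by omega) (by omega)), h.n_eq]
  · rw [hf.reg _ (hr _ (by omega) (by omega)), h.m_eq]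
  · rw [hf.reg _ (hr _ (by omega) (by omega)), h.nodes_eq]
  · rw [hf.reg _ (hr _ (by omega) (by omega)), h.life_eq]
  · rw [hf.reg _ (hr _ (by omega) (by omega)), h.bits_eq]
  · rw [hf.arr _ (ha _ (by omega) (by omega))]
    exact h.fst
  · rw [hf.arr _ (ha _ (by omega) (by omega))]
    exact h.snd
  · rw [hf.arr _ (ha _ (by omega) (by omega))]
    exact h.label
  · rw [hf.arr _ (ha _ (by omega) (by omega))]
    exact h.num
  · rw [hf.arr _ (ha _ (by omega) (by omega))]
    exact h.den

theorem HasInput.congr {T : TCInput} {i : ℕ} {s s' : State} (h : HasInput T i s)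
    (hr : ∀ y, 2 ≤ y → y ≤ 6 → s'.reg y = s.reg y) (ha : s'.arr = s.arr) : HasInput T i s' := by
  refine ⟨?_, ?_, ?_, ?_, ?_, by rw [ha]; exact h.fst, by rw [ha]; exact h.snd,
    by rw [ha]; exact h.label, by rw [ha]; exact h.num, by rw [ha]; exact h.den⟩
  · rw [hr _ (by omega) (by omega), h.n_eq]
  · rw [hr _ (by omega) (by omega), h.m_eq]
  · rw [hr _ (by omega) (by omega), h.nodes_eq]
  · rw [hr _ (by omega) (by omega), h.life_eq]
  · rw [hr _ (by omega) (by omega), h.bits_eq]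

/-- Read the temporal edges and compute the number of nodes and the number of bits. -/
def readProg (i : ℕ) : Program :=
  .assign 10 (.lit 3) ;;
  .for 11 (.var 3)
    (.store 2 (.var 11) (.get 0 (.var 10)) ;;
    .store 3 (.var 11) (.get 0 (.add (.var 10) (.lit 1))) ;;
    .store 4 (.var 11) (.get 0 (.add (.var 10) (.lit 2))) ;;
    .store 5 (.var 11) (.get 0 (.add (.var 10) (.lit 3))) ;;
    .store 6 (.var 11) (.get 0 (.add (.var 10) (.lit 4))) ;;
    .assign 10 (.add (.var 10) (.lit 5))) ;;
  .assign 4 (.add (.add (.var 3) (.var 3)) (.add (.var 2) (.var 2))) ;;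
  .assign 6 (.lit 0) ;;
  .for 11 (.lit (i + 3)) (.assign 6 (.add (.var 6) (.add (.var 4) (.lit 2))))

theorem wp_readProg {L i : ℕ} {T : TCInput} {s : State} (hm : T.m ≤ L) (hi : i + 3 ≤ L)
    (h2 : s.reg 2 = T.n) (h3 : s.reg 3 = T.m) (h5 : s.reg 5 = T.life)
    (hU : ∀ j < T.m, s.arr 0 (3 + 5 * j) = T.fst j)
    (hV : ∀ j < T.m, s.arr 0 (3 + 5 * j + 1) = T.snd j)
    (hT : ∀ j < T.m, s.arr 0 (3 + 5 * j + 2) = T.label j)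
    (hn : ∀ j < T.m, s.arr 0 (3 + 5 * j + 3) = T.num j)
    (hd : ∀ j < T.m, s.arr 0 (3 + 5 * j + 4) = T.den j) :
    wp L (readProg i) (HasInput T i) s := by
  simp only [readProg, wp]
  refine wp_for T.m (fun j s' => s'.reg 10 = 3 + 5 * j ∧ ∀ l < j, s'.arr 2 l = T.fst l ∧
    s'.arr 3 l = T.snd l ∧ s'.arr 4 l = T.label l ∧ s'.arr 5 l = T.num l ∧ s'.arr 6 l = T.den l)
    hm (by simp) ?_ ?_ ?_ ?_
  · intro s' hf
    simpa [h3] using hf.reg 3 (by simp)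
  · simp
  · rintro j hj s1 hf hsj ⟨h10, hl⟩
    have h0 : s1.arr 0 = s.arr 0 := by simpa using hf.arr 0 (by simp)
    simp only [wp, Expr.eval, State.reg_setReg, State.reg_setArr, State.arr_setReg,
      State.arr_setArr, h10, hsj, h0, hU j hj, hV j hj, hT j hj, hn j hj, hd j hj, if_true,
      Nat.reduceEqDiff, if_false]
    refine ⟨by ring, fun l hl' => ?_⟩
    by_cases h : l = j
    · simp [h]
    · simpa [h] using hl l (by omega)
  rintro s1 hf - ⟨-, hl⟩
  have h2' : s1.reg 2 = T.n := by simpa [h2] using hf.reg 2 (by simp)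
  have h3' : s1.reg 3 = T.m := by simpa [h3] using hf.reg 3 (by simp)
  have h5' : s1.reg 5 = T.life := by simpa [h5] using hf.reg 5 (by simp)
  refine wp_for (i + 3) (fun j s' => s'.reg 6 = j * (T.nodes + 2)) hi (by simp) ?_ ?_ ?_ ?_
  · simp
  · simp
  · intro j _ s' hf' _ h
    have h4 : s'.reg 4 = T.nodes := by
      simpa [h2', h3', TCInput.nodes] using hf'.reg 4 (by simp)
    simp [h, h4]
    ring
  · intro s' hf' _ h
    refine ⟨?_, ?_, ?_, ?_, h, ?_, ?_, ?_, ?_, ?_⟩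
    · simpa [h2'] using hf'.reg 2 (by simp)
    · simpa [h3'] using hf'.reg 3 (by simp)
    · simpa [h2', h3', TCInput.nodes] using hf'.reg 4 (by simp)
    · simpa [h5'] using hf'.reg 5 (by simp)
    all_goals
      intro j hj
      rw [hf'.arr _ (by simp)]
      simp [hl j hj]

/-- Compute the perturbed weights and infinity. -/
def weightProg : Program :=
  .assign 14 (.lit 1) ;;
  .assign 15 (.lit 0) ;;
  .for 11 (.var 3)
    (.assign 12 (.get 5 (.var 11)) ;;
    .for 13 (.var 3)
      (.cond (.add (.sub (.var 13) (.var 11)) (.sub (.var 11) (.var 13)))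
        (.assign 16 (.var 12) ;;
        .assign 17 (.get 6 (.var 13)) ;;
        .mul 12 16 17)
        .skip) ;;
    .for 13 (.add (.var 3) (.lit 1)) (.shift 16 12 (.var 6)) ;;
    .assign 12 (.add (.var 12) (.var 14)) ;;
    .store 7 (.var 11) (.var 12) ;;
    .assign 15 (.add (.var 15) (.var 12)) ;;
    .shift 16 14 (.var 6)) ;;
  .assign 7 (.add (.var 15) (.lit 1)) ;;
  .shift 16 7 (.var 6)

theorem Program.writesReg_shift {x z y : ℕ} {e : Expr} :
    (Program.shift x z e).WritesReg y ↔ y = x ∨ y = z := by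
  simp [Program.shift]

theorem Program.writesArr_shift {x z y : ℕ} {e : Expr} : ¬ (Program.shift x z e).WritesArr y := by
  simp [Program.shift]

attribute [simp] Program.writesReg_shift Program.writesArr_shift

/-- Omitting the denominator of `j` from the product avoids division. In each multiplication a
single denominator, short by `hden`, determines the number of rounds; the powers of two come from
repeated doubling. -/
theorem wp_weightProg {L i : ℕ} {T : TCInput} {s : State} (hm : T.m + 1 ≤ L) (hb : T.bits i ≤ L)
    (hden : ∀ j < T.m, (T.den j).size ≤ L) (hs : HasInput T i s) :
    wp L weightProg (fun s' => s'.reg 7 = T.inf i ∧ ∀ j < T.m, s'.arr 7 j = T.pertWeight i j) s := by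
  simp only [weightProg, wp]
  refine wp_for T.m (fun j s' => s'.reg 14 = 2 ^ (T.bits i * j) ∧
    s'.reg 15 = ∑ l ∈ Finset.range j, T.pertWeight i l ∧
    ∀ l < j, s'.arr 7 l = T.pertWeight i l) (by omega) (by simp) ?_ ?_ ?_ ?_
  · intro s' hf
    simpa [hs.m_eq] using hf.reg 3 (by simp)
  · simp
  · rintro j hj s1 hf hsj ⟨h14, h15, h7⟩
    have hs1 : HasInput T i s1 := by
      refine HasInput.frame ?_ hf ?_ ?_
      · refine hs.congr (fun y _ _ => ?_) rfl
        simp [show y ≠ 14 by omega, show y ≠ 15 by omega]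
      · intro y h1 h2
        simp
        omega
      · intro y h1 h2
        simp
        omega
    simp only [wp]
    refine wp_for T.m (fun l s' => s'.reg 12 =
      T.num j * ∏ x ∈ Finset.range l, if x = j then 1 else T.den x) (by omega) (by simp) ?_ ?_ ?_ ?_
    · intro s' hf'
      simpa [hs1.m_eq] using hf'.reg 3 (by simp)
    · simp [hsj, hs1.num j hj]
    · intro l hl s2 hf2 hsl h12
      have hj2 : s2.reg 11 = j := by simpa [hsj] using hf2.reg 11 (by simp)
      have hd2 : s2.arr 6 l = T.den l := by
        rw [hf2.arr 6 (by simp)]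
        exact hs1.den l hl
      simp only [wp, Expr.eval, hsl, hj2]
      refine ⟨fun h => ?_, fun h => ?_⟩
      · refine wp_mul (by simp) (by simp) (by simp) ?_ fun s3 hf3 h3 => ?_
        · simpa [hsl, hd2] using hden l hl
        · rw [Finset.prod_range_succ, if_neg (by omega), State.reg_setReg, if_neg (by simp), h3]
          simp [h12, hsl, hd2]
          ring
      · rw [Finset.prod_range_succ, if_pos (by omega)]
        simp [h12]
    intro s2 hf2 _ h12
    have hj2 : s2.reg 11 = j := by simpa [hsj] using hf2.reg 11 (by simp)
    have hs2 : HasInput T i s2 := by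
      refine HasInput.frame ?_ hf2 ?_ ?_
      · refine hs1.congr (fun y _ _ => ?_) rfl
        simp [show y ≠ 12 by omega]
      · intro y h1 h2
        simp
        omega
      · simp
    -- The exponent `bits * (m + 1)` is reached by `m + 1` shifts of `bits` doublings each, so that
    -- no single loop exceeds `L` rounds.
    refine wp_for (T.m + 1) (fun l s' => s'.reg 12 = T.intWeight j * 2 ^ (T.bits i * l)) hm
      (by simp) ?_ ?_ ?_ ?_
    · intro s' hf'
      simpa [hs2.m_eq] using hf'.reg 3 (by simp)
    · simp [h12, TCInput.intWeight]
    · intro l hl s3 hf3 hsl h3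
      refine wp_shift (T.bits i) (by simp) hb ?_ ?_
      · intro s' hf'
        have h6 : s3.reg 6 = T.bits i := by simpa [hs2.bits_eq] using hf3.reg 6 (by simp)
        simpa [h6] using hf'.reg 6 (by simp)
      · intro s' hf' h'
        simp [h', h3]
        ring
    intro s3 hf3 _ h12'
    have hj3 : s3.reg 11 = j := by simpa [hj2] using hf3.reg 11 (by simp)
    have h14' : s3.reg 14 = 2 ^ (T.bits i * j) := by
      rw [hf3.reg 14 (by simp), hf2.reg 14 (by simp)]
      simpa using h14
    have h15' : s3.reg 15 = ∑ l ∈ Finset.range j, T.pertWeight i l := by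
      rw [hf3.reg 15 (by simp), hf2.reg 15 (by simp)]
      simpa using h15
    have h7' : s3.arr 7 = s1.arr 7 := by
      rw [hf3.arr 7 (by simp), hf2.arr 7 (by simp)]
      simp
    have h6 : s3.reg 6 = T.bits i := by simpa [hs2.bits_eq] using hf3.reg 6 (by simp)
    refine wp_shift (T.bits i) (by simp) hb ?_ ?_
    · intro s' hf'
      simpa [h6] using hf'.reg 6 (by simp)
    · intro s' hf' h'
      have e14 : s'.reg 14 = 2 ^ (T.bits i * (j + 1)) := by
        rw [h']
        simp [h14']
        ring
      have e15 : s'.reg 15 = ∑ l ∈ Finset.range (j + 1), T.pertWeight i l := by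
        rw [hf'.reg 15 (by simp), Finset.sum_range_succ]
        simp [h15', h12', h14', TCInput.pertWeight]
      have e7 : ∀ l < j + 1, s'.arr 7 l = T.pertWeight i l := by
        intro l hl
        rw [hf'.arr 7 (by simp)]
        by_cases h : l = j
        · simp [h, hj3, h12', h14', TCInput.pertWeight]
        · simp [h, hj3, h7', h7 l (by omega)]
      simpa [e14, e15] using e7
  rintro s1 hf - ⟨-, h15, h7⟩
  have h6 : s1.reg 6 = T.bits i := by simpa [hs.bits_eq] using hf.reg 6 (by simp)
  refine wp_shift (T.bits i) (by simp) hb ?_ ?_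
  · intro s' hf'
    simpa [h6] using hf'.reg 6 (by simp)
  · intro s' hf' h'
    refine ⟨?_, fun j hj => ?_⟩
    · rw [h']
      simp [h15, TCInput.inf]
    · rw [hf'.arr 7 (by simp)]
      simpa using h7 j hj

/-- Write down the nodes of the graph. -/
def nodeProg : Program :=
  .for 11 (.var 2)
    (.store 8 (.var 11) (.var 11) ;;
    .store 9 (.var 11) (.var 2) ;;
    .store 10 (.var 11) (.var 5) ;;
    .store 11 (.var 11) (.lit 0) ;;
    .store 8 (.add (.var 2) (.var 11)) (.add (.var 2) (.lit 1)) ;;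
    .store 9 (.add (.var 2) (.var 11)) (.var 11) ;;
    .store 10 (.add (.var 2) (.var 11)) (.lit 0) ;;
    .store 11 (.add (.var 2) (.var 11)) (.lit 0)) ;;
  .for 11 (.var 3)
    (.assign 12 (.add (.add (.var 2) (.var 2)) (.var 11)) ;;
    .assign 13 (.add (.var 12) (.var 3)) ;;
    .store 8 (.var 12) (.get 2 (.var 11)) ;;
    .store 9 (.var 12) (.get 3 (.var 11)) ;;
    .store 10 (.var 12) (.get 4 (.var 11)) ;;
    .store 11 (.var 12) (.get 7 (.var 11)) ;;
    .store 8 (.var 13) (.get 3 (.var 11)) ;;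
    .store 9 (.var 13) (.get 2 (.var 11)) ;;
    .store 10 (.var 13) (.get 4 (.var 11)) ;;
    .store 11 (.var 13) (.get 7 (.var 11)))

/-- The memory holds the data of the node `p` of the graph `G`. -/
structure HasNode (G : NodeGraph) (p : ℕ) (s : State) : Prop where
  tail : s.arr 8 p = G.tail p
  head : s.arr 9 p = G.head p
  time : s.arr 10 p = G.time p
  wt : s.arr 11 p = G.wt p

theorem wp_nodeProg {L i : ℕ} {T : TCInput} {s : State} (hm : T.m ≤ L) (hn : T.n ≤ L)
    (hs : HasInput T i s) (hw : ∀ j < T.m, s.arr 7 j = T.pertWeight i j) :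
    wp L nodeProg (HasNodes T.nodes (T.graph i)) s := by
  simp only [nodeProg, wp]
  refine wp_for T.n (fun j s' => ∀ x < j, HasNode (T.graph i) x s' ∧
    HasNode (T.graph i) (T.n + x) s') hn (by simp) ?_ ?_ ?_ ?_
  · intro s' hf
    simpa [hs.n_eq] using hf.reg 2 (by simp)
  · simp
  · intro j hj s1 hf hsj h1 x hx
    have hs1 : HasInput T i s1 := by
      refine HasInput.frame hs hf ?_ ?_
      · intro y h1 h2
        simp
        omega
      · intro y h1 h2
        simp
        omega
    by_cases hxj : x = j
    · subst hxj
      have h0 : T.n ≠ 0 := by omega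
      have h0' : x < T.n + T.n := by omega
      constructor <;> constructor <;>
        simp [hsj, hs1.n_eq, hs1.life_eq, TCInput.graph, hj, h0, h0']
    · have hne : T.n + x ≠ j := by omega
      have hne' : x ≠ T.n + j := by omega
      obtain ⟨⟨a1, a2, a3, a4⟩, b1, b2, b3, b4⟩ := h1 x (by omega)
      constructor <;> constructor <;> simp [hsj, hs1.n_eq, hxj, hne, hne', *]
  intro s1 hf1 _ h1
  have hs1 : HasInput T i s1 := by
    refine HasInput.frame hs hf1 ?_ ?_
    · intro y h1 h2
      simp
      omega
    · intro y h1 h2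
      simp
      omega
  have hw1 : ∀ j < T.m, s1.arr 7 j = T.pertWeight i j := by
    rw [hf1.arr 7 (by simp)]
    exact hw
  refine wp_for T.m (fun j s' => (∀ x < T.n + T.n, HasNode (T.graph i) x s') ∧
    ∀ x < j, HasNode (T.graph i) (T.n + T.n + x) s' ∧
      HasNode (T.graph i) (T.n + T.n + x + T.m) s') hm (by simp) ?_ ?_ ?_ ?_
  · intro s' hf
    simpa [hs1.m_eq] using hf.reg 3 (by simp)
  · refine ⟨fun x hx => ?_, by simp⟩
    rcases lt_or_ge x T.n with h | h
    · obtain ⟨a1, a2, a3, a4⟩ := (h1 x h).1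
      exact ⟨a1, a2, a3, a4⟩
    · obtain ⟨a1, a2, a3, a4⟩ := (h1 (x - T.n) (by omega)).2
      rw [Nat.add_sub_cancel' h] at a1 a2 a3 a4
      exact ⟨a1, a2, a3, a4⟩
  · intro j hj s2 hf2 hsj h2
    have hs2 : HasInput T i s2 := by
      refine HasInput.frame hs1 hf2 ?_ ?_
      · intro y h1 h2
        simp
        omega
      · intro y h1 h2
        simp
        omega
    have hw2 : s2.arr 7 j = T.pertWeight i j := by
      rw [hf2.arr 7 (by simp)]
      exact hw1 j hj
    refine ⟨fun x hx => ?_, fun x hx => ?_⟩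
    · have hne : x ≠ T.n + T.n + j := by omega
      have hne' : x ≠ T.n + T.n + j + T.m := by omega
      obtain ⟨a1, a2, a3, a4⟩ := h2.1 x hx
      constructor <;> simp [hsj, hs2.n_eq, hs2.m_eq, hne, hne', *]
    by_cases hxj : x = j
    · subst hxj
      have h0 : T.m ≠ 0 := by omega
      have e1 : ¬ T.n + T.n + x < T.n := by omega
      have e2 : ¬ T.n + T.n + x + T.m < T.n := by omega
      have e3 : ¬ T.n + T.n + x + T.m < T.n + T.n := by omega
      have e4 : ¬ T.n + T.n + x + T.m < T.n + T.n + T.m := by omega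
      have e5 : T.n + T.n + x + T.m - (T.n + T.n + T.m) = x := by omega
      constructor <;> constructor <;>
        simp [hsj, hs2.n_eq, hs2.m_eq, hs2.fst x hj, hs2.snd x hj, hs2.label x hj, hw2,
          TCInput.graph, hj, h0, e1, e2, e3, e4, e5]
    · have hne1 : T.n + T.n + x ≠ T.n + T.n + j + T.m := by omega
      have hne2 : T.n + T.n + x + T.m ≠ T.n + T.n + j := by omega
      obtain ⟨⟨a1, a2, a3, a4⟩, b1, b2, b3, b4⟩ := h2.2 x (by omega)
      constructor <;> constructor <;> simp [hsj, hs2.n_eq, hs2.m_eq, hxj, hne1, hne2, *]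
  · rintro s2 - - ⟨h2, h2'⟩
    have key : ∀ p < T.nodes, HasNode (T.graph i) p s2 := by
      intro p hp
      rw [TCInput.nodes] at hp
      rcases lt_or_ge p (T.n + T.n) with h | h
      · exact h2 p h
      rcases lt_or_ge p (T.n + T.n + T.m) with h' | h'
      · have := (h2' (p - (T.n + T.n)) (by omega)).1
        rwa [Nat.add_sub_cancel' h] at this
      · have := (h2' (p - (T.n + T.n + T.m)) (by omega)).2
        rwa [show T.n + T.n + (p - (T.n + T.n + T.m)) + T.m = p by omega] at this
    exact ⟨fun p hp => (key p hp).tail, fun p hp => (key p hp).head, fun p hp => (key p hp).time,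
      fun p hp => (key p hp).wt⟩

/-- Add up the costs of the trees for all roots. -/
def sumProg (i : ℕ) : Program :=
  .assign 20 (.lit 0) ;;
  .for 21 (.var 2)
    (.assign 100 (.var 2) ;;
    .assign 101 (.add (.var 2) (.var 21)) ;;
    .assign 102 (.lit 0) ;;
    coverProg i 0 ;;
    .assign 20 (.add (.var 20) (.var 103)))

theorem wp_sumProg {L i : ℕ} {T : TCInput} {s : State} (hN : T.nodes ≤ L)
    (hn : s.reg 2 = T.n) (hs : HasMatrix T.nodes (T.dist i) s) :
    wp L (sumProg i) (fun s' => s'.reg 20 = T.totalCost i) s := by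
  have hnN : T.n + T.n ≤ T.nodes := by
    rw [TCInput.nodes]
    omega
  have hr := not_writesReg_coverProg i 0
  have ha := not_writesArr_coverProg i 0
  simp only [sumProg, wp]
  refine wp_for T.n (fun r s' => s'.reg 20 = ∑ x ∈ Finset.range r, T.rootCost i x) (by omega)
    ?_ ?_ ?_ ?_ ?_
  · simp [hr]
  · intro s' hf
    simpa [hn] using hf.reg 2 (by simp [hr])
  · simp
  · intro r hr' s1 hf hs1 h1
    have hn1 : s1.reg 2 = T.n := by simpa [hn] using hf.reg 2 (by simp [hr])
    have hd1 : HasDist T.n T.nodes (T.dist i) s1 := by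
      refine HasDist.frame ?_ hf (by simp [hr]) (by simp [hr]) (by simp [ha]) (by simp [ha])
      have := hs.hasDist hn
      exact ⟨by simp [hn], by simp [hs.N_eq], this.dist⟩
    simp only [wp]
    refine wp_call (wp_coverProg (n := T.n) (by omega) hN i (k := T.n) (v := T.n + r) (X := ∅)
      ⟨by simp [hn1], by simp [hd1.N_eq], hd1.dist⟩ (by omega) (by omega) (by simp [hn1])
      (by simp [hn1, hs1]) (by simp [code])) ?_
    rintro s2 ⟨h2, -⟩ hf2
    have h20 : s2.reg 20 = s1.reg 20 := by
      rw [hf2.reg 20 (hr 20 (by omega))]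
      simp
    rw [Finset.sum_range_succ]
    rw [Nat.zero_add] at h2
    simp [h2, h20, h1, TCInput.rootCost]
  · exact fun s' _ _ h => h

/-- Read off the temporal edges that are used, and write them to the output. -/
def writeProg : Program :=
  .assign 1 (.lit 0) ;;
  .for 11 (.var 3)
    (.assign 13 (.var 20) ;;
    .for 14 (.var 6) (.assign 13 (.half (.var 13))) ;;
    .assign 15 (.var 13) ;;
    .shift 14 15 (.var 6) ;;
    .cond (.sub (.var 20) (.var 15))
      (.store 1 (.var 1) (.get 2 (.var 11)) ;;
      .store 1 (.add (.var 1) (.lit 1)) (.get 3 (.var 11)) ;;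
      .store 1 (.add (.var 1) (.lit 2)) (.get 4 (.var 11)) ;;
      .assign 1 (.add (.var 1) (.lit 3)))
      .skip ;;
    .assign 20 (.var 13))

theorem output_congr {s s' : State} (h : s'.reg 1 = s.reg 1) (ha : s'.arr 1 = s.arr 1) :
    s'.output = s.output := by
  rw [State.output, State.output, h, ha]

theorem output_append {s s' : State} {a b c : ℕ} (h : s'.reg 1 = s.reg 1 + 3)
    (hlt : ∀ x < s.reg 1, s'.arr 1 x = s.arr 1 x) (h0 : s'.arr 1 (s.reg 1) = a)
    (h1 : s'.arr 1 (s.reg 1 + 1) = b) (h2 : s'.arr 1 (s.reg 1 + 2) = c) :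
    s'.output = s.output ++ [a, b, c] := by
  have : List.range (s.reg 1 + 3) =
      List.range (s.reg 1) ++ [s.reg 1, s.reg 1 + 1, s.reg 1 + 2] := by
    simp [List.range_succ]
  rw [State.output, State.output, h, this, List.map_append]
  congr 1
  · exact List.map_congr_left fun x hx => hlt x (List.mem_range.mp hx)
  · simp [h0, h1, h2]

/-- Before round `j`, register 20 holds the total cost without its lowest `j` digits in base `2 ^
bits`. Shifting one digit out and zeros back in changes the number exactly when that digit is
nonzero. -/
theorem wp_writeProg {L i : ℕ} {T : TCInput} {s : State} (hm : T.m ≤ L) (hb : T.bits i ≤ L)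
    (hs : HasInput T i s) (h20 : s.reg 20 = T.totalCost i) :
    wp L writeProg (fun s' => s'.output = T.result i) s := by
  simp only [writeProg, wp]
  refine wp_for T.m (fun j s' => s'.reg 20 = T.totalCost i / 2 ^ (T.bits i * j) ∧
    s'.output = ((List.range j).filter (T.Used i ·)).flatMap fun j =>
      [T.fst j, T.snd j, T.label j]) hm (by simp) ?_ ?_ ?_ ?_
  · intro s' hf
    simpa [hs.m_eq] using hf.reg 3 (by simp)
  · simp [h20, State.output]
  · rintro j hj s1 hf hsj ⟨h1, h1o⟩
    have hs1 : HasInput T i s1 := by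
      refine HasInput.frame ?_ hf ?_ ?_
      · refine hs.congr (fun y _ _ => ?_) rfl
        simp [show y ≠ 1 by omega]
      · intro y h1 h2
        simp
        omega
      · intro y h1 h2
        simp
        omega
    clear hf
    simp only [wp]
    refine wp_for (T.bits i) (fun l s' => s'.reg 13 = s1.reg 20 / 2 ^ l) hb (by simp) ?_ ?_ ?_ ?_
    · intro s' hf'
      simpa [hs1.bits_eq] using hf'.reg 6 (by simp)
    · simp
    · intro l _ s2 _ _ h2
      simp [h2, Nat.div_div_eq_div_mul, pow_succ]
    intro s2 hf2 _ h13
    have h6 : s2.reg 6 = T.bits i := by simpa [hs1.bits_eq] using hf2.reg 6 (by simp)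
    have e20 : s2.reg 20 = s1.reg 20 := by simpa using hf2.reg 20 (by simp)
    have e11 : s2.reg 11 = j := by simpa [hsj] using hf2.reg 11 (by simp)
    have e1 : s2.reg 1 = s1.reg 1 := by simpa using hf2.reg 1 (by simp)
    have ea : s2.arr = s1.arr := by
      funext a
      rw [hf2.arr a (by simp)]
      simp
    refine wp_shift (T.bits i) (by simp) hb ?_ ?_
    · intro s' hf'
      simpa [h6] using hf'.reg 6 (by simp)
    intro s3 hf3 h15
    have h13' : s3.reg 13 = s1.reg 20 / 2 ^ T.bits i := by
      simpa [h13] using hf3.reg 13 (by simp)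
    have e20' : s3.reg 20 = s1.reg 20 := by simpa [e20] using hf3.reg 20 (by simp)
    have e11' : s3.reg 11 = j := by simpa [e11] using hf3.reg 11 (by simp)
    have e1' : s3.reg 1 = s1.reg 1 := by simpa [e1] using hf3.reg 1 (by simp)
    have ea' : s3.arr = s1.arr := by
      funext a
      rw [hf3.arr a (by simp)]
      simp [ea]
    have h15' : s3.reg 15 = s1.reg 20 / 2 ^ T.bits i * 2 ^ T.bits i := by
      rw [h15]
      simp [h13]
    have hused : s1.reg 20 - s1.reg 20 / 2 ^ T.bits i * 2 ^ T.bits i ≠ 0 ↔ T.Used i j := by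
      rw [TCInput.Used, ← h1]
      have := Nat.div_add_mod' (s1.reg 20) (2 ^ T.bits i)
      omega
    have hnext : s1.reg 20 / 2 ^ T.bits i = T.totalCost i / 2 ^ (T.bits i * (j + 1)) := by
      rw [h1, Nat.div_div_eq_div_mul, ← pow_add, mul_add, mul_one]
    have hfil : (List.range (j + 1)).filter (T.Used i ·) =
        (List.range j).filter (T.Used i ·) ++ if T.Used i j then [j] else [] := by
      rw [List.range_succ, List.filter_append]
      split_ifs with h <;> simp [h]
    simp only [wp, Expr.eval, e20', h15', e11', e1', ea', hs1.fst j hj, hs1.snd j hj,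
      hs1.label j hj]
    rw [hfil, List.flatMap_append, ← h1o]
    refine ⟨fun h => ⟨?_, ?_⟩, fun h => ⟨?_, ?_⟩⟩
    · simp [h13', hnext]
    · rw [if_pos (hused.mp h)]
      refine output_append ?_ (fun x hx => ?_) ?_ ?_ ?_
      · simp [e1']
      · simp [ea', e1', show x ≠ s1.reg 1 by omega, show x ≠ s1.reg 1 + 1 by omega,
          show x ≠ s1.reg 1 + 2 by omega]
      · simp [ea', e1', e11', hs1.fst j hj, hs1.snd j hj, hs1.label j hj]
      · simp [ea', e1', e11', hs1.fst j hj, hs1.snd j hj, hs1.label j hj]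
      · simp [ea', e1', e11', hs1.fst j hj, hs1.snd j hj, hs1.label j hj]
    · simp [h13', hnext]
    · rw [if_neg (mt hused.mpr (not_not.mpr h)), List.flatMap_nil, List.append_nil]
      refine output_congr ?_ ?_
      · simp [e1']
      · simp [ea']
  · rintro s' - - ⟨-, h⟩
    exact h

/-- The approximation algorithm with recursion depth `i`. It gives up if there are too few temporal
edges for a connected graph. -/
def tcProg (i : ℕ) : Program :=
  .assign 2 (.get 0 (.lit 0)) ;;
  .assign 5 (.get 0 (.lit 1)) ;;
  .assign 3 (.get 0 (.lit 2)) ;;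
  .cond (.sub (.var 2) (.add (.add (.var 3) (.var 3)) (.lit 1)))
    .skip
    (readProg i ;; weightProg ;; nodeProg ;; distProg ;; sumProg i ;; writeProg)

/-- The bounds `hL` are available only if `n ≤ 2 * m + 1`. Otherwise the program halts at once and
nothing is claimed about its output; this takes care of inputs whose binary `n` is too large to be
looped over. -/
theorem wp_tcProg {L i : ℕ} {T : TCInput} {s : State} (h0 : s.arr 0 0 = T.n)
    (h1 : s.arr 0 1 = T.life) (h2 : s.arr 0 2 = T.m)
    (hU : ∀ j < T.m, s.arr 0 (3 + 5 * j) = T.fst j)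
    (hV : ∀ j < T.m, s.arr 0 (3 + 5 * j + 1) = T.snd j)
    (hT : ∀ j < T.m, s.arr 0 (3 + 5 * j + 2) = T.label j)
    (hn : ∀ j < T.m, s.arr 0 (3 + 5 * j + 3) = T.num j)
    (hd : ∀ j < T.m, s.arr 0 (3 + 5 * j + 4) = T.den j)
    (hL : T.n ≤ T.m + T.m + 1 → T.m + 1 ≤ L ∧ T.n ≤ L ∧ T.nodes ≤ L ∧ i + 3 ≤ L ∧ T.bits i ≤ L)
    (hden : ∀ j < T.m, (T.den j).size ≤ L) :
    wp L (tcProg i) (fun s' => T.n ≤ T.m + T.m + 1 → s'.output = T.result i) s := by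
  simp only [tcProg, wp]
  refine ⟨fun h hn => ?_, fun h => ?_⟩
  · simp [h0, h2] at h
    omega
  have hnm : T.n ≤ T.m + T.m + 1 := by
    simp [h0, h2] at h
    omega
  obtain ⟨hm, hn', hN, hi, hb⟩ := hL hnm
  refine wp_mono (wp_readProg (T := T) (by omega) hi (by simp [h0]) (by simp [h2]) (by simp [h1])
    hU hV hT hn hd) fun s1 hs1 => ?_
  refine wp_call (wp_weightProg hm hb hden hs1) fun s2 h2 hf2 => ?_
  have hs2 : HasInput T i s2 := by
    refine hs1.frame hf2 ?_ ?_
    · intro y h1 h2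
      simp [weightProg]
      omega
    · intro y h1 h2
      simp [weightProg]
      omega
  refine wp_call (wp_nodeProg (by omega) hn' hs2 h2.2) fun s3 h3 hf3 => ?_
  have hs3 : HasInput T i s3 := by
    refine hs2.frame hf3 ?_ ?_
    · intro y h1 h2
      simp [nodeProg]
      omega
    · intro y h1 h2
      simp [nodeProg]
      omega
  have hinf : s3.reg 7 = T.inf i := by
    rw [hf3.reg 7 (by simp [nodeProg]), h2.1]
  refine wp_call (wp_distProg hN hs3.nodes_eq hinf h3) fun s4 h4 hf4 => ?_
  have hs4 : HasInput T i s4 := by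
    refine hs3.frame hf4 ?_ ?_
    · intro y h1 h2
      simp [distProg]
      omega
    · intro y h1 h2
      simp [distProg]
      omega
  refine wp_call (wp_sumProg hN hs4.n_eq h4) fun s5 h5 hf5 => ?_
  have hs5 : HasInput T i s5 := by
    refine hs4.frame hf5 ?_ ?_
    · intro y h1 h2
      have := not_writesReg_coverProg i 0 y (by omega)
      simp [sumProg, this]
      omega
    · intro y h1 h2
      simp [sumProg, not_writesArr_coverProg]
  exact wp_mono (wp_writeProg (by omega) hb hs5 h5) fun s' h' _ => h'

end RAM

/-! ### The approximation guarantee -/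

/-- Starting from `r` alone, add leaves from `F` as long as some arc leads from the tree to a new
node of `F`. The tree stays inside the finite set `insert r F`, so this ends, and then its node set
is closed. Each leaf is charged its node weight, whence the bound on `c`. -/
theorem NodeGraph.exists_closed_cov (G : NodeGraph) {d : ℕ → ℕ → ℕ} {N r : ℕ} {F : Finset ℕ}
    (hd : ∀ p q, G.Arc p q → d p q ≤ G.wt q) (hF : ∀ q ∈ F, q < N) :
    ∃ A c, r ∈ A ∧ Greedy.Cov d N r A c ∧ A ⊆ insert r F ∧ c ≤ ∑ q ∈ A.erase r, G.wt q ∧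
      ∀ p ∈ A, ∀ q ∈ F, G.Arc p q → q ∈ A := by
  by_contra! hno
  have key : ∀ k : ℕ, ∃ A c, r ∈ A ∧ Greedy.Cov d N r A c ∧ A ⊆ insert r F ∧
      c ≤ ∑ q ∈ A.erase r, G.wt q ∧ k ≤ A.card := by
    intro k
    induction k with
    | zero => exact ⟨{r}, 0, by simp, .single r, by simp, by simp, by simp⟩
    | succ k ih =>
      obtain ⟨A, c, hr, hC, hA, hc, hk⟩ := ih
      obtain ⟨p, hp, q, hq, hpq, hqA⟩ := hno A c hr hC hA hc
      refine ⟨insert q A, c + G.wt q, Finset.mem_insert_of_mem hr,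
        hC.insert hp hqA (hF q hq) (hd p q hpq), ?_, ?_, ?_⟩
      · exact Finset.insert_subset (Finset.mem_insert_of_mem hq) hA
      · have hqr : q ≠ r := fun h => hqA (h ▸ hr)
        rw [Finset.erase_insert_of_ne hqr, Finset.sum_insert (by simp [hqA])]
        omega
      · rw [Finset.card_insert_of_notMem hqA]
        omega
  obtain ⟨A, c, -, -, hA, -, hk⟩ := key ((insert r F).card + 1)
  have := Finset.card_le_card hA
  omega

theorem harmonic_le_self (k : ℕ) : harmonic k ≤ k := by
  have h : ∀ x ∈ Finset.range k, ((↑(x + 1) : ℚ))⁻¹ ≤ 1 := fun x _ =>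
    inv_le_one_of_one_le₀ (by push_cast; linarith [(Nat.cast_nonneg x : (0 : ℚ) ≤ x)])
  simpa [harmonic] using Finset.sum_le_sum h

theorem sum_mul_pow_lt {B m : ℕ} {c : ℕ → ℕ} (hc : ∀ l < m, c l < B) :
    ∑ l ∈ Finset.range m, c l * B ^ l < B ^ m := by
  induction m with
  | zero => simp
  | succ m ih =>
    have h1 := ih fun l hl => hc l (by omega)
    have h2 := Nat.mul_le_mul_right (B ^ m) (hc m (by omega))
    rw [Finset.sum_range_succ, pow_succ']
    rw [Nat.succ_mul] at h2
    omega

/-- A digit of a number in base `B`. -/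
theorem sum_mul_pow_div_mod {B m j R : ℕ} {c : ℕ → ℕ} (hc : ∀ l < m, c l < B) (hj : j < m) :
    (R * B ^ (m + 1) + ∑ l ∈ Finset.range m, c l * B ^ l) / B ^ j % B = c j := by
  have hB : 0 < B := (Nat.zero_le _).trans_lt (hc j hj)
  have h1 : B ^ (j + 1) ∣ ∑ l ∈ Finset.Ico (j + 1) m, c l * B ^ l :=
    Finset.dvd_sum fun l hl => Dvd.dvd.mul_left (pow_dvd_pow B (Finset.mem_Ico.mp hl).1) _
  have h2 : B ^ (j + 1) ∣ R * B ^ (m + 1) := Dvd.dvd.mul_left (pow_dvd_pow B (by omega)) _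
  obtain ⟨a, ha⟩ := h1
  obtain ⟨b, hb⟩ := h2
  have h3 := Finset.sum_range_add_sum_Ico (fun l => c l * B ^ l) (show j + 1 ≤ m by omega)
  rw [Finset.sum_range_succ] at h3
  have h4 := sum_mul_pow_lt (B := B) (m := j) (c := c) fun l hl => hc l (by omega)
  -- What precedes digit `j` is less than `B ^ j`, and what follows it is a multiple of `B ^ (j +
  -- 1)`.
  have h5 : R * B ^ (m + 1) + ∑ l ∈ Finset.range m, c l * B ^ l =
      ∑ l ∈ Finset.range j, c l * B ^ l + B ^ j * (c j + B * (a + b)) := by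
    rw [← h3, ha, hb]
    ring
  rw [h5, Nat.add_mul_div_left _ _ (pow_pos hB j), Nat.div_eq_of_lt h4, Nat.zero_add,
    Nat.add_mul_mod_self_left, Nat.mod_eq_of_lt (hc j hj)]

namespace TCInput

variable (T : TCInput)

/-- The temporal edges satisfying `E` connect every source to every sink. -/
def Spans (i : ℕ) (E : ℕ → Prop) : Prop :=
  ∀ r < T.n, ∀ x < T.n, Relation.ReflTransGen (fun p q => (T.graph i).Arc p q ∧ q < T.nodes ∧
    ∀ j < T.m, q = T.n + T.n + j ∨ q = T.n + T.n + T.m + j → E j) (T.n + r) x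

variable {T}

theorem wt_sink {i x : ℕ} (hx : x < T.n + T.n) : (T.graph i).wt x = 0 := by
  simp [graph, hx]

theorem wt_forward {i j : ℕ} (hj : j < T.m) :
    (T.graph i).wt (T.n + T.n + j) = T.pertWeight i j := by
  simp [graph, hj]

theorem wt_backward {i j : ℕ} :
    (T.graph i).wt (T.n + T.n + T.m + j) = T.pertWeight i j := by
  simp only [graph]
  rw [if_neg (by omega), if_neg (by omega), Nat.add_sub_cancel_left]

/-- Grow a closed tree inside the free sources and sinks and both orientations of the temporal edges
in `J`. Being closed, it contains every walk provided by `Spans`, hence all sinks. Every node is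
paid for at most once, so every temporal edge at most twice. -/
theorem exists_cov {i r : ℕ} {J : Finset ℕ} (hJ : J ⊆ Finset.range T.m)
    (h : T.Spans i (· ∈ J)) (hr : r < T.n) :
    ∃ c, Greedy.Cov (T.dist i) T.nodes (T.n + r) (Finset.range T.n) c ∧
      c ≤ 2 * ∑ j ∈ J, T.pertWeight i j := by
  set F : Finset ℕ := Finset.range (T.n + T.n) ∪ (J.map (addLeftEmbedding (T.n + T.n)) ∪
    J.map (addLeftEmbedding (T.n + T.n + T.m))) with hFdef
  have hJ' : ∀ j ∈ J, j < T.m := fun j hj => Finset.mem_range.mp (hJ hj)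
  have hF : ∀ q ∈ F, q < T.nodes := by
    intro q hq
    simp only [hFdef, Finset.mem_union, Finset.mem_range, Finset.mem_map,
      addLeftEmbedding_apply] at hq
    rw [nodes]
    rcases hq with hq | ⟨j, hj, rfl⟩ | ⟨j, hj, rfl⟩
    · omega
    · have := hJ' j hj
      omega
    · have := hJ' j hj
      omega
  obtain ⟨A, c, hrA, hC, hA, hc, hcl⟩ := (T.graph i).exists_closed_cov (r := T.n + r)
    (fun p q hpq => (T.graph i).dist_le_wt (T.inf i) T.nodes hpq) hF
  refine ⟨c, hC.mono fun x hx => ?_, hc.trans ?_⟩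
  · have hx' := h r hr x (Finset.mem_range.mp hx)
    clear hx
    induction hx' with
    | refl => exact hrA
    | @tail p q _ hpq ih =>
      refine hcl p ih q ?_ hpq.1
      have h1 := hpq.2.1
      have h2 := hpq.2.2
      rw [nodes] at h1
      simp only [hFdef, Finset.mem_union, Finset.mem_range, Finset.mem_map,
        addLeftEmbedding_apply]
      rcases lt_or_ge q (T.n + T.n) with hq | hq
      · exact .inl hq
      rcases lt_or_ge q (T.n + T.n + T.m) with hq' | hq'
      · exact .inr (.inl ⟨q - (T.n + T.n), h2 _ (by omega) (.inl (by omega)), by omega⟩)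
      · exact .inr (.inr ⟨q - (T.n + T.n + T.m), h2 _ (by omega) (.inr (by omega)), by omega⟩)
  · have h1 : ∑ q ∈ A.erase (T.n + r), (T.graph i).wt q ≤ ∑ q ∈ F, (T.graph i).wt q := by
      refine Finset.sum_le_sum_of_subset fun q hq => ?_
      rw [Finset.mem_erase] at hq
      exact (Finset.mem_insert.mp (hA hq.2)).resolve_left hq.1
    have h2 := Finset.sum_union_inter (s₁ := Finset.range (T.n + T.n))
      (s₂ := J.map (addLeftEmbedding (T.n + T.n)) ∪ J.map (addLeftEmbedding (T.n + T.n + T.m)))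
      (f := (T.graph i).wt)
    have h3 := Finset.sum_union_inter (s₁ := J.map (addLeftEmbedding (T.n + T.n)))
      (s₂ := J.map (addLeftEmbedding (T.n + T.n + T.m))) (f := (T.graph i).wt)
    have h4 : ∑ q ∈ Finset.range (T.n + T.n), (T.graph i).wt q = 0 :=
      Finset.sum_eq_zero fun q hq => wt_sink (Finset.mem_range.mp hq)
    have h5 : ∑ q ∈ J.map (addLeftEmbedding (T.n + T.n)), (T.graph i).wt q =
        ∑ j ∈ J, T.pertWeight i j := by
      rw [Finset.sum_map]
      exact Finset.sum_congr rfl fun j hj => wt_forward (hJ' j hj)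
    have h6 : ∑ q ∈ J.map (addLeftEmbedding (T.n + T.n + T.m)), (T.graph i).wt q =
        ∑ j ∈ J, T.pertWeight i j := by
      rw [Finset.sum_map]
      exact Finset.sum_congr rfl fun j hj => wt_backward
    rw [← hFdef] at h2
    omega

theorem rootCost_le {i r b : ℕ} {h : ℝ} {J : Finset ℕ} (hJ : J ⊆ Finset.range T.m)
    (hS : T.Spans i (· ∈ J)) (hr : r < T.n) (hb : 0 < b) (hh : ∀ k ≤ T.n, (harmonic k : ℝ) ≤ h)
    (hn : T.n < 2 * b ^ i) :
    (T.rootCost i r : ℝ) ≤ 2 * Greedy.ratio b h i * (∑ j ∈ J, T.pertWeight i j : ℕ) := by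
  obtain ⟨c, hC, hc⟩ := exists_cov hJ hS hr
  have hh0 : 0 ≤ h := by simpa using hh 0 (Nat.zero_le _)
  have hρ : 0 ≤ Greedy.ratio b h i := Greedy.ratio_nonneg (by positivity) hh0 i
  refine (Greedy.cover_le ((T.graph i).isMetric_dist (T.inf i) T.nodes) hb hh i (by
    rw [nodes]
    omega) hC (by simp) (Finset.card_range _) hn).trans ?_
  have : (c : ℝ) ≤ 2 * (∑ j ∈ J, T.pertWeight i j : ℕ) := by exact_mod_cast hc
  calc Greedy.ratio b h i * c ≤ Greedy.ratio b h i * (2 * (∑ j ∈ J, T.pertWeight i j : ℕ)) := by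
        gcongr
    _ = _ := by ring

/-- The same set `J` is compared with the tree of every root, which is where the factor `n` of the
approximation ratio arises. -/
theorem totalCost_le {i b : ℕ} {h : ℝ} {J : Finset ℕ} (hJ : J ⊆ Finset.range T.m)
    (hS : T.Spans i (· ∈ J)) (hb : 0 < b) (hh : ∀ k ≤ T.n, (harmonic k : ℝ) ≤ h)
    (hn : T.n < 2 * b ^ i) :
    (T.totalCost i : ℝ) ≤
      2 * T.n * Greedy.ratio b h i * (∑ j ∈ J, T.pertWeight i j : ℕ) := by
  rw [totalCost, Nat.cast_sum]
  refine (Finset.sum_le_sum fun r hr =>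
    rootCost_le hJ hS (Finset.mem_range.mp hr) hb hh hn).trans (le_of_eq ?_)
  rw [Finset.sum_const, Finset.card_range, nsmul_eq_mul]
  ring

/-- The parameters `b = h = n + 1` are admissible, though far from optimal. They serve where any
bound below `2 ^ bits` will do: for finiteness of the costs and for optima of weight zero. -/
theorem harmonic_le {k : ℕ} (hk : k ≤ T.n) : (harmonic k : ℝ) ≤ (T.n + 1 : ℕ) := by
  have h1 : (harmonic k : ℝ) ≤ (k : ℚ) := by exact_mod_cast harmonic_le_self k
  have h2 : (k : ℝ) ≤ T.n := by exact_mod_cast hk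
  push_cast at h1 ⊢
  linarith

theorem lt_two_mul_pow {i : ℕ} (hi : 0 < i) : T.n < 2 * (T.n + 1) ^ i := by
  have := Nat.pow_le_pow_right (show 0 < T.n + 1 by omega) (show 1 ≤ i from hi)
  rw [pow_one] at this
  omega

/-- A crude bound on the approximation ratio. -/
theorem crude_ratio_le (i : ℕ) :
    2 * T.n * Greedy.ratio (T.n + 1 : ℕ) (T.n + 1 : ℕ) i ≤ (2 ^ T.bits i : ℕ) := by
  have h1 := Greedy.ratio_le (b := ((T.n + 1 : ℕ) : ℝ)) (h := ((T.n + 1 : ℕ) : ℝ)) (by positivity)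
    (by push_cast; linarith [(Nat.cast_nonneg T.n : (0 : ℝ) ≤ T.n)]) i
  have h2 : 2 * T.n * ((2 * (T.n + 1) + 1) * (2 * (T.n + 1)) ^ i) ≤ 2 ^ T.bits i := by
    have h3 : T.n + 1 ≤ 2 ^ T.n := Nat.lt_two_pow_self
    have h4 : 2 * (T.n + 1) ≤ 2 ^ (T.n + 1) := by
      rw [pow_succ]
      omega
    calc 2 * T.n * ((2 * (T.n + 1) + 1) * (2 * (T.n + 1)) ^ i)
        ≤ 2 ^ (T.n + 1) * (2 ^ (T.n + 2) * (2 ^ (T.n + 1)) ^ i) := by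
          gcongr
          · omega
          · rw [pow_succ]
            omega
      _ = 2 ^ (T.n + 1 + (T.n + 2 + (T.n + 1) * i)) := by rw [← pow_mul, ← pow_add, ← pow_add]
      _ ≤ 2 ^ T.bits i := by
          refine Nat.pow_le_pow_right (by norm_num) ?_
          simp only [bits, nodes]
          nlinarith [Nat.zero_le (i * T.m), Nat.zero_le (i * T.n)]
  have h3 : (2 * T.n * ((2 * (T.n + 1 : ℕ) + 1) * (2 * (T.n + 1 : ℕ)) ^ i) : ℝ) ≤
      (2 ^ T.bits i : ℕ) := by exact_mod_cast h2
  refine le_trans ?_ h3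
  gcongr

/-- The approximation guarantee bounds the cost by `2 ^ bits` times the total perturbed weight, and
`inf` exceeds this. Hence no infinite distance is ever paid for. -/
theorem rootCost_lt_inf {i r : ℕ} {J : Finset ℕ} (hi : 0 < i) (hJ : J ⊆ Finset.range T.m)
    (hS : T.Spans i (· ∈ J)) (hr : r < T.n) : T.rootCost i r < T.inf i := by
  have h1 := rootCost_le hJ hS hr (Nat.succ_pos T.n) (fun k hk => harmonic_le hk)
    (lt_two_mul_pow hi)
  have h2 := T.crude_ratio_le i
  have hρ : 0 ≤ Greedy.ratio (T.n + 1 : ℕ) (T.n + 1 : ℕ) i :=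
    Greedy.ratio_nonneg (by positivity) (by positivity) i
  have hn : (1 : ℝ) ≤ T.n := by exact_mod_cast (show 1 ≤ T.n by omega)
  have h3 : 2 * Greedy.ratio (T.n + 1 : ℕ) (T.n + 1 : ℕ) i ≤ (2 ^ T.bits i : ℕ) := by
    nlinarith
  have h4 : (∑ j ∈ J, T.pertWeight i j : ℕ) ≤ ∑ j ∈ Finset.range T.m, T.pertWeight i j :=
    Finset.sum_le_sum_of_subset hJ
  have h5 : (T.rootCost i r : ℝ) ≤
      (2 ^ T.bits i : ℕ) * (∑ j ∈ Finset.range T.m, T.pertWeight i j : ℕ) := by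
    refine h1.trans ?_
    have h4' : ((∑ j ∈ J, T.pertWeight i j : ℕ) : ℝ) ≤
      (∑ j ∈ Finset.range T.m, T.pertWeight i j : ℕ) := by exact_mod_cast h4
    gcongr
  have h6 : T.rootCost i r ≤ 2 ^ T.bits i * ∑ j ∈ Finset.range T.m, T.pertWeight i j := by
    exact_mod_cast h5
  rw [inf, add_mul, one_mul, mul_comm]
  have : 0 < 2 ^ T.bits i := by positivity
  omega

/-- The number of uses of the temporal edge `j` in `M`. -/
def uses (T : TCInput) (M : Multiset ℕ) (j : ℕ) : ℕ :=
  M.count (T.n + T.n + j) + M.count (T.n + T.n + T.m + j)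

/-- Sources and sinks are free, and the two orientations of a temporal edge have the same weight, so
only the numbers of uses matter. -/
theorem sum_wt_eq {i : ℕ} {M : Multiset ℕ} (hM : ∀ q ∈ M, q < T.nodes) :
    (M.map (T.graph i).wt).sum = ∑ j ∈ Finset.range T.m, T.uses M j * T.pertWeight i j := by
  induction M using Multiset.induction_on with
  | empty => simp [uses]
  | cons q M ih =>
    rw [Multiset.map_cons, Multiset.sum_cons, ih fun x hx => hM x (Multiset.mem_cons_of_mem hx)]
    -- The last summand can be nonzero only for `m = 0`, when both orientations of `j` would have
    -- the same index.
    have h1 : ∀ j, T.uses (q ::ₘ M) j = (if T.n + T.n + j = q ∨ T.n + T.n + T.m + j = q then 1 else 0)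
        + T.uses M j + if T.n + T.n + j = q ∧ T.n + T.n + T.m + j = q then 1 else 0 := by
      intro j
      simp only [uses, Multiset.count_cons]
      split_ifs <;> omega
    have hq := hM q (Multiset.mem_cons_self q M)
    rw [nodes] at hq
    rcases lt_or_ge q (T.n + T.n) with h | h
    · rw [wt_sink h, Nat.zero_add]
      refine Finset.sum_congr rfl fun j hj => ?_
      rw [h1, if_neg (by omega), if_neg (by omega)]
      simp
    obtain ⟨l, hl, hql, hw⟩ : ∃ l < T.m, (∀ j < T.m, (T.n + T.n + j = q ∨
        T.n + T.n + T.m + j = q) ↔ j = l) ∧ (T.graph i).wt q = T.pertWeight i l := by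
      rcases lt_or_ge q (T.n + T.n + T.m) with h' | h'
      · obtain ⟨l, rfl⟩ := Nat.exists_eq_add_of_le h
        exact ⟨l, by omega, fun j hj => by omega, wt_forward (by omega)⟩
      · obtain ⟨l, rfl⟩ := Nat.exists_eq_add_of_le h'
        exact ⟨l, by omega, fun j hj => by omega, wt_backward⟩
    have h2 : ∀ j ∈ Finset.range T.m, T.uses (q ::ₘ M) j * T.pertWeight i j =
        (if j = l then T.pertWeight i j else 0) + T.uses M j * T.pertWeight i j := by
      intro j hj
      have hj' := Finset.mem_range.mp hj
      rw [h1]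
      have h3 : ¬ (T.n + T.n + j = q ∧ T.n + T.n + T.m + j = q) := by omega
      simp only [hql j hj', if_neg h3]
      split_ifs <;> ring
    rw [Finset.sum_congr rfl h2, Finset.sum_add_distrib, Finset.sum_ite_eq' , if_pos (by simpa using hl), hw]

theorem exists_bill {i : ℕ} {J : Finset ℕ} (hi : 0 < i) (hJ : J ⊆ Finset.range T.m)
    (hS : T.Spans i (· ∈ J)) (R : ℕ) (hR : R ≤ T.n) :
    ∃ M, (T.graph i).IsBill T.nodes (R * ((i + 1) * T.n * 2 ^ T.nodes))
      (∑ r ∈ Finset.range R, T.rootCost i r) M ∧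
      ∀ r < R, ∀ x < T.n, (T.graph i).Conn M (T.n + r) x := by
  induction R with
  | zero => exact ⟨0, (T.graph i).isBill_zero _ _, fun r hr => absurd hr (by omega)⟩
  | succ R ih =>
    obtain ⟨M, hM, hc⟩ := ih (by omega)
    have hnN : T.n + T.n ≤ T.nodes := by
      rw [nodes]
      omega
    have hcard : T.n ≤ (Finset.range T.n \ ∅).card := by simp
    obtain ⟨M', hM', hc'⟩ := (T.graph i).exists_bill_cover (inf := T.inf i) (n := T.n)
      (N := T.nodes) (by omega) i (k := T.n) (v := T.n + R) (X := ∅) (by omega) hcard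
      (rootCost_lt_inf hi hJ hS (by omega))
    refine ⟨M + M', ?_, fun r hr x hx => ?_⟩
    · rw [Finset.sum_range_succ]
      exact (hM.add hM').mono (le_of_eq (by ring))
    · rcases Nat.lt_succ_iff_lt_or_eq.mp hr with h | rfl
      · exact (hc r h x hx).mono (Multiset.le_add_right _ _)
      · refine (hc' x ?_ (by simp)).mono (Multiset.le_add_left _ _)
        have hE := Greedy.extends_cover ((T.graph i).dist (T.inf i) T.nodes) (n := T.n)
          (N := T.nodes) (by omega) i T.n (T.n + r) ∅ hcard
        -- Covering `n` new terminals out of `n` means covering all of them.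
        have hsub : (Greedy.cover ((T.graph i).dist (T.inf i) T.nodes) T.n T.nodes i T.n
            (T.n + r) ∅).2 = Finset.range T.n := by
          refine Finset.eq_of_subset_of_card_le (fun y hy => ?_) ?_
          · exact Finset.mem_range.mpr (hE.new y hy (by simp))
          · rw [hE.card]
            simp
        rw [hsub]
        exact Finset.mem_range.mpr hx

/-- The left-hand side bounds the number of nodes, with repetitions, in the bill for all roots,
hence the number of uses of any temporal edge. So the digits of the total cost do not overflow. -/
theorem bits_bound (i : ℕ) : T.n * ((i + 1) * T.n * 2 ^ T.nodes) < 2 ^ T.bits i := by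
  have h1 : T.n ≤ 2 ^ T.n := Nat.lt_two_pow_self.le
  have h2 : i + 1 ≤ 2 ^ i := Nat.lt_two_pow_self
  calc T.n * ((i + 1) * T.n * 2 ^ T.nodes) ≤ 2 ^ T.n * (2 ^ i * 2 ^ T.n * 2 ^ T.nodes) := by gcongr
    _ = 2 ^ (T.n + (i + T.n + T.nodes)) := by rw [← pow_add, ← pow_add, ← pow_add]
    _ < 2 ^ T.bits i := by
      refine Nat.pow_lt_pow_right (by norm_num) ?_
      simp only [bits, nodes]
      nlinarith [Nat.zero_le (i * T.m), Nat.zero_le (i * T.n)]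

/-- The output of the algorithm is feasible and has small weight. -/
theorem used_spec {i b : ℕ} {h : ℝ} {J : Finset ℕ} (hi : 0 < i) (hJ : J ⊆ Finset.range T.m)
    (hS : T.Spans i (· ∈ J)) (hb : 0 < b) (hh : ∀ k ≤ T.n, (harmonic k : ℝ) ≤ h)
    (hn : T.n < 2 * b ^ i) :
    T.Spans i (T.Used i) ∧
      ((∑ j ∈ (Finset.range T.m).filter (T.Used i), T.intWeight j : ℕ) : ℝ) ≤
        4 * T.n * Greedy.ratio b h i * (∑ j ∈ J, T.intWeight j : ℕ) := by
  obtain ⟨M, hM, hc⟩ := exists_bill hi hJ hS T.n le_rfl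
  have hsum : T.totalCost i = ∑ j ∈ Finset.range T.m, T.uses M j * T.pertWeight i j := by
    rw [← sum_wt_eq hM.lt, hM.sum_eq, totalCost]
  have huses : ∀ j < T.m, T.uses M j < 2 ^ T.bits i := by
    intro j hj
    refine lt_of_le_of_lt ?_ (T.bits_bound i)
    refine le_trans ?_ hM.card_le
    have h1 := Multiset.card_le_card (Multiset.filter_le (fun x => x = T.n + T.n + j ∨
      x = T.n + T.n + T.m + j) M)
    refine le_trans (le_of_eq ?_) h1
    have h2 := Multiset.filter_add_filter (fun x => x = T.n + T.n + j)
      (fun x => x = T.n + T.n + T.m + j) M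
    have h3 : M.filter (fun x => x = T.n + T.n + j ∧ x = T.n + T.n + T.m + j) = 0 := by
      rw [Multiset.filter_eq_nil]
      intro x _
      omega
    rw [h3, add_zero] at h2
    rw [← h2, Multiset.card_add, Multiset.filter_eq', Multiset.filter_eq']
    simp [uses]
  set Q := 2 ^ (T.bits i * (T.m + 1)) with hQ
  -- In base `2 ^ bits` the digits below position `m` are the numbers of uses, and the unperturbed
  -- cost starts at position `m + 1`.
  have hsum' : T.totalCost i = (∑ j ∈ Finset.range T.m, T.uses M j * T.intWeight j) *
      (2 ^ T.bits i) ^ (T.m + 1) + ∑ j ∈ Finset.range T.m, T.uses M j * (2 ^ T.bits i) ^ j := by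
    rw [hsum, Finset.sum_mul, ← Finset.sum_add_distrib]
    refine Finset.sum_congr rfl fun j _ => ?_
    rw [pertWeight, pow_mul, pow_mul]
    ring
  have hused : ∀ j < T.m, (T.Used i j ↔ T.uses M j ≠ 0) := by
    intro j hj
    rw [Used, hsum', pow_mul, sum_mul_pow_div_mod huses hj]
  refine ⟨fun r hr x hx => ?_, ?_⟩
  · refine Relation.ReflTransGen.mono (fun p q hpq => ?_) _ _ (hc r hr x hx)
    refine ⟨hpq.1, hM.lt q hpq.2, fun j hj hq => ?_⟩
    rw [hused j hj, uses]
    have := Multiset.count_pos.mpr hpq.2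
    rcases hq with rfl | rfl <;> omega
  · have h1 : (∑ j ∈ (Finset.range T.m).filter (T.Used i), T.intWeight j) * Q ≤ T.totalCost i := by
      rw [hsum', ← pow_mul, ← hQ]
      refine le_trans (Nat.mul_le_mul_right Q ?_) (Nat.le_add_right _ _)
      rw [Finset.sum_filter]
      refine Finset.sum_le_sum fun j hj => ?_
      have hj' := hused j (Finset.mem_range.mp hj)
      split_ifs with h2
      · exact Nat.le_mul_of_pos_left _ (Nat.pos_of_ne_zero (hj'.mp h2))
      · exact Nat.zero_le _
    have hB : 1 < 2 ^ T.bits i := by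
      refine Nat.one_lt_two_pow ?_
      simp [bits]
    have h2 : ∑ j ∈ J, T.pertWeight i j = (∑ j ∈ J, T.intWeight j) * Q +
        ∑ j ∈ J, (2 ^ T.bits i) ^ j := by
      rw [Finset.sum_mul, ← Finset.sum_add_distrib]
      refine Finset.sum_congr rfl fun j _ => ?_
      rw [pertWeight, hQ, pow_mul 2 (T.bits i) j]
    have h3 : ∑ j ∈ J, (2 ^ T.bits i) ^ j < (2 ^ T.bits i) ^ T.m := by
      refine lt_of_le_of_lt (Finset.sum_le_sum_of_subset hJ) ?_
      simpa using sum_mul_pow_lt (B := 2 ^ T.bits i) (m := T.m) (c := fun _ => 1) fun _ _ => hB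
    have hQ' : Q = 2 ^ T.bits i * (2 ^ T.bits i) ^ T.m := by rw [hQ, pow_mul, pow_succ']
    have hQ0 : (0 : ℝ) < Q := by
      rw [hQ]
      positivity
    -- If `J` weighs nothing, the used edges must weigh nothing either. The crude ratio keeps the
    -- total cost below `Q`, whereas a used edge of positive integral weight would contribute at
    -- least `Q`.
    rcases Nat.eq_zero_or_pos (∑ j ∈ J, T.intWeight j) with h0 | h0
    · have h4 := totalCost_le hJ hS (Nat.succ_pos T.n) (fun k hk => harmonic_le hk)
        (lt_two_mul_pow hi)
      have h5 : T.totalCost i < Q := by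
        have h6 : (T.totalCost i : ℝ) ≤ (2 ^ T.bits i : ℕ) * (∑ j ∈ J, T.pertWeight i j : ℕ) := by
          refine h4.trans ?_
          gcongr
          exact T.crude_ratio_le i
        have h7 : T.totalCost i ≤ 2 ^ T.bits i * ∑ j ∈ J, T.pertWeight i j := by exact_mod_cast h6
        refine h7.trans_lt ?_
        rw [h2, h0, Nat.zero_mul, Nat.zero_add, hQ']
        exact Nat.mul_lt_mul_of_pos_left h3 (by omega)
      have h6 : ∑ j ∈ (Finset.range T.m).filter (T.Used i), T.intWeight j = 0 := by
        by_contra hne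
        have := Nat.le_mul_of_pos_left Q (Nat.pos_of_ne_zero hne)
        omega
      rw [h6, h0]
      simp
    · have hh0 : 0 ≤ h := by simpa using hh 0 (Nat.zero_le _)
      have hρ : 0 ≤ Greedy.ratio b h i := Greedy.ratio_nonneg (by positivity) hh0 i
      have h4 := totalCost_le hJ hS hb hh hn
      -- All perturbations in `J` together are less than `Q`, so they at most double a positive
      -- integral weight. This turns the factor `2 * n` into `4 * n`.
      have h5 : ∑ j ∈ J, T.pertWeight i j ≤ 2 * (∑ j ∈ J, T.intWeight j) * Q := by
        have h6 : (2 ^ T.bits i) ^ T.m ≤ Q := by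
          rw [hQ']
          exact Nat.le_mul_of_pos_left _ (by omega)
        have h7 := Nat.le_mul_of_pos_left Q h0
        rw [h2, mul_assoc]
        omega
      have h6 : ((∑ j ∈ J, T.pertWeight i j : ℕ) : ℝ) ≤
          2 * (∑ j ∈ J, T.intWeight j : ℕ) * Q := by exact_mod_cast h5
      have h7 : ((∑ j ∈ (Finset.range T.m).filter (T.Used i), T.intWeight j : ℕ) : ℝ) * Q ≤
          T.totalCost i := by exact_mod_cast h1
      refine le_of_mul_le_mul_right (h7.trans (h4.trans ?_)) hQ0
      calc 2 * T.n * Greedy.ratio b h i * (∑ j ∈ J, T.pertWeight i j : ℕ)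
          ≤ 2 * T.n * Greedy.ratio b h i * (2 * (∑ j ∈ J, T.intWeight j : ℕ) * Q) := by gcongr
        _ = _ := by ring

end TCInput

/-! ### Temporal connectivity in the graph of nodes -/

namespace TemporalGraph

variable {V : Type*}

/-- There is a temporal path from `x` to `y` in `S` all labels of which are at most `τ`. -/
def ReachBy (S : Finset (Sym2 V × ℕ)) (x y : V) (τ : ℕ) : Prop :=
  ∃ (k : ℕ) (v : Fin (k + 1) → V) (t : Fin k → ℕ),
    v 0 = x ∧ v (Fin.last k) = y ∧ Monotone t ∧
      (∀ i : Fin k, (s(v i.castSucc, v i.succ), t i) ∈ S) ∧ ∀ i, t i ≤ τ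

theorem ReachBy.temporalReach {S : Finset (Sym2 V × ℕ)} {x y : V} {τ : ℕ} (h : ReachBy S x y τ) :
    TemporalReach S x y := by
  obtain ⟨k, v, t, h1, h2, h3, h4, -⟩ := h
  exact ⟨k, v, t, h1, h2, h3, h4⟩

theorem ReachBy.refl (S : Finset (Sym2 V × ℕ)) (x : V) (τ : ℕ) : ReachBy S x x τ :=
  ⟨0, fun _ => x, Fin.elim0, rfl, rfl, fun i => i.elim0, fun i => i.elim0, fun i => i.elim0⟩

theorem ReachBy.step {S : Finset (Sym2 V × ℕ)} {x y z : V} {τ τ' : ℕ} (h : ReachBy S x y τ)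
    (he : (s(y, z), τ') ∈ S) (hτ : τ ≤ τ') : ReachBy S x z τ' := by
  obtain ⟨k, v, t, h1, h2, h3, h4, h5⟩ := h
  refine ⟨k + 1, Fin.snoc (α := fun _ => V) v z, Fin.snoc (α := fun _ => ℕ) t τ', ?_, ?_, ?_, ?_, ?_⟩
  · rw [← Fin.castSucc_zero, Fin.snoc_castSucc, h1]
  · rw [Fin.snoc_last]
  · intro i j hij
    induction j using Fin.lastCases with
    | last =>
      rw [Fin.snoc_last]
      induction i using Fin.lastCases with
      | last => rw [Fin.snoc_last]
      | cast i =>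
        rw [Fin.snoc_castSucc]
        exact (h5 i).trans hτ
    | cast j =>
      induction i using Fin.lastCases with
      | last => exact absurd hij (not_le.mpr (Fin.castSucc_lt_last j))
      | cast i =>
        rw [Fin.snoc_castSucc, Fin.snoc_castSucc]
        exact h3 (Fin.castSucc_le_castSucc_iff.mp hij)
  · intro i
    induction i using Fin.lastCases with
    | last =>
      rw [Fin.snoc_last, Fin.snoc_castSucc, Fin.succ_last, Fin.snoc_last, h2]
      exact he
    | cast i =>
      rw [Fin.snoc_castSucc, Fin.snoc_castSucc, Fin.succ_castSucc, Fin.snoc_castSucc]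
      exact h4 i
  · intro i
    induction i using Fin.lastCases with
    | last => rw [Fin.snoc_last]
    | cast i =>
      rw [Fin.snoc_castSucc]
      exact (h5 i).trans hτ

variable {n : ℕ}

/-- The temporal edge described by a triple. -/
def edge (x : Fin n × Fin n × ℕ) : Sym2 (Fin n) × ℕ := (s(x.1, x.2.1), x.2.2)

/-- The input of the algorithm that describes the temporal graph `G`. -/
def toInput (G : TemporalGraph (Fin n)) (xs : List (Fin n × Fin n × ℕ)) : TCInput where
  n := n
  life := G.lifetime
  m := xs.length
  fst j := (xs[j]?.map fun x => x.1.val).getD 0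
  snd j := (xs[j]?.map fun x => x.2.1.val).getD 0
  label j := (xs[j]?.map fun x => x.2.2).getD 0
  num j := (xs[j]?.map fun x => (G.weight (edge x)).num).getD 0
  den j := (xs[j]?.map fun x => (G.weight (edge x)).den).getD 1

variable {G : TemporalGraph (Fin n)} {xs : List (Fin n × Fin n × ℕ)}

theorem toInput_fst_lt (hn : 0 < n) (j : ℕ) : (toInput G xs).fst j < n := by
  simp only [toInput]
  cases xs[j]? <;> simp [hn]

theorem toInput_snd_lt (hn : 0 < n) (j : ℕ) : (toInput G xs).snd j < n := by
  simp only [toInput]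
  cases xs[j]? <;> simp [hn]

/-- No node has the head `n + 1`, which is the tail of the sources, so sources cannot be entered.
Similarly, by `tail_ne`, no arc leaves a sink, whose head is `n`. -/
theorem head_le (hn : 0 < n) (i p : ℕ) : ((toInput G xs).graph i).head p ≤ n := by
  have h1 := toInput_fst_lt (G := G) (xs := xs) hn
  have h2 := toInput_snd_lt (G := G) (xs := xs) hn
  have h3 : (toInput G xs).n = n := rfl
  simp only [TCInput.graph, h3]
  split_ifs
  · exact le_rfl
  · omega
  · exact (h2 _).le
  · exact (h1 _).le

theorem tail_ne (hn : 0 < n) (i p : ℕ) : ((toInput G xs).graph i).tail p ≠ n := by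
  have h1 := toInput_fst_lt (G := G) (xs := xs) hn
  have h2 := toInput_snd_lt (G := G) (xs := xs) hn
  have h3 : (toInput G xs).n = n := rfl
  simp only [TCInput.graph, h3]
  split_ifs
  · omega
  · omega
  · exact (h1 _).ne
  · exact (h2 _).ne

/-- Walks in the graph of nodes are temporal paths. -/
theorem temporallyConnected_of_spans {i : ℕ} {E : ℕ → Prop} {S : Finset (Sym2 (Fin n) × ℕ)}
    (h : (toInput G xs).Spans i E) (hS : ∀ j (hj : j < xs.length), E j → edge xs[j] ∈ S) :
    TemporallyConnected S := by
  intro r x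
  have hn : 0 < n := r.pos
  set T := toInput G xs with hT
  have hTn : T.n = n := rfl
  have hTm : T.m = xs.length := rfl
  -- A walk that has not yet ended in a sink stands at the head of its last node, reached by a
  -- temporal path whose labels do not exceed the time of that node.
  have key : ∀ p, Relation.ReflTransGen (fun p q => (T.graph i).Arc p q ∧ q < T.nodes ∧
      ∀ j < T.m, q = T.n + T.n + j ∨ q = T.n + T.n + T.m + j → E j) (T.n + r) p →
      if h : p < n then TemporalReach S r ⟨p, h⟩ else
        ∀ y : Fin n, (T.graph i).head p = y → ReachBy S r y ((T.graph i).time p) := by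
    intro p hp
    induction hp with
    | refl =>
      rw [dif_neg (by omega)]
      intro y hy
      have hr := r.isLt
      have : y = r := by
        apply Fin.ext
        rw [← hy]
        simp [TCInput.graph, hTn]
      rw [this]
      exact ReachBy.refl S r _
    | @tail p q _ hpq ih =>
      obtain ⟨⟨ha, ht⟩, hq, hE⟩ := hpq
      by_cases hp : p < n
      · exfalso
        refine tail_ne (G := G) (xs := xs) hn i q ?_
        rw [← hT, ← ha]
        simp [TCInput.graph, hTn, hp]
      rw [dif_neg hp] at ih
      rw [TCInput.nodes, hTn, hTm] at hq
      rw [hTm, hTn] at hE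
      rcases lt_or_ge q n with h1 | h1
      · rw [dif_pos h1]
        refine (ih ⟨q, h1⟩ ?_).temporalReach
        rw [ha]
        simp [TCInput.graph, hTn, h1]
      rw [dif_neg (by omega)]
      rcases lt_or_ge q (n + n) with h2 | h2
      · exfalso
        have := head_le (G := G) (xs := xs) hn i p
        rw [← hT, ha] at this
        simp [TCInput.graph, hTn, h2, not_lt.mpr h1] at this
      intro y hy
      rcases lt_or_ge q (n + n + xs.length) with h3 | h3
      · obtain ⟨j, rfl⟩ := Nat.exists_eq_add_of_le h2
        have hj : j < xs.length := by omega
        have e0 : ¬ n + n + j < n := by omega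
        have e1 : (T.graph i).tail (n + n + j) = xs[j].1 := by
          simp [TCInput.graph, e0, hj, hT, toInput]
        have e2 : (T.graph i).head (n + n + j) = xs[j].2.1 := by
          simp [TCInput.graph, e0, hj, hT, toInput]
        have e3 : (T.graph i).time (n + n + j) = xs[j].2.2 := by
          simp [TCInput.graph, e0, hj, hT, toInput]
        rw [e1] at ha
        rw [e3] at ht ⊢
        rw [e2] at hy
        obtain rfl := Fin.ext hy
        exact (ih _ ha).step (hS j hj (hE j hj (.inl rfl))) ht
      · obtain ⟨j, rfl⟩ := Nat.exists_eq_add_of_le h3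
        have hj : j < xs.length := by omega
        have e0 : ¬ n + n + xs.length + j < n := by omega
        have e0' : ¬ n + n + xs.length + j < n + n := by omega
        have e0'' : ¬ n + n + xs.length + j < n + n + xs.length := by omega
        have e1 : (T.graph i).tail (n + n + xs.length + j) = xs[j].2.1 := by
          simp [TCInput.graph, e0, e0', e0'', hj, hT, toInput]
        have e2 : (T.graph i).head (n + n + xs.length + j) = xs[j].1 := by
          simp [TCInput.graph, e0, e0', e0'', hj, hT, toInput]
        have e3 : (T.graph i).time (n + n + xs.length + j) = xs[j].2.2 := by
          simp [TCInput.graph, e0, e0', e0'', hj, hT, toInput]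
        rw [e1] at ha
        rw [e3] at ht ⊢
        rw [e2] at hy
        obtain rfl := Fin.ext hy
        refine (ih _ ha).step ?_ ht
        rw [Sym2.eq_swap]
        exact hS j hj (hE j hj (.inr rfl))
  have := key x (h r r.isLt x x.isLt)
  rwa [dif_pos x.isLt] at this

/-- Temporal paths are walks in the graph of nodes. -/
theorem spans_of_temporallyConnected {i : ℕ} {E : ℕ → Prop} {S : Finset (Sym2 (Fin n) × ℕ)}
    (h : TemporallyConnected S)
    (hS : ∀ e ∈ S, e.2 ≤ G.lifetime ∧ ∃ j, ∃ hj : j < xs.length, E j ∧ edge xs[j] = e) :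
    (toInput G xs).Spans i E := by
  intro r hr x hx
  set T := toInput G xs with hT
  have hTn : T.n = n := rfl
  have hTm : T.m = xs.length := rfl
  rw [hTn] at hr hx
  obtain ⟨k, v, t, hv0, hvk, ht, hvS⟩ := h ⟨r, hr⟩ ⟨x, hx⟩
  -- Follow the first `l` edges of the path. The time reached must not exceed the later labels, so
  -- that the next edge can be appended, nor the lifetime, so that the sink can be entered.
  have key : ∀ l (hl : l < k + 1), ∃ p, Relation.ReflTransGen (fun p q => (T.graph i).Arc p q ∧
      q < T.nodes ∧ ∀ j < T.m, q = T.n + T.n + j ∨ q = T.n + T.n + T.m + j → E j) (T.n + r) p ∧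
      (T.graph i).head p = v ⟨l, hl⟩ ∧ (T.graph i).time p ≤ G.lifetime ∧
      ∀ l' : Fin k, l ≤ l' → (T.graph i).time p ≤ t l' := by
    intro l
    induction l with
    | zero =>
      intro hl
      have e0 : (T.graph i).time (T.n + r) = 0 := by simp [TCInput.graph, hTn, hr]
      refine ⟨_, .refl, ?_, by simp [e0], by simp [e0]⟩
      rw [show (⟨0, hl⟩ : Fin (k + 1)) = 0 from rfl, hv0]
      simp [TCInput.graph, hTn, hr]
    | succ l ih =>
      intro hl
      obtain ⟨p, hp, hhead, -, htime⟩ := ih (by omega)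
      have he := hvS ⟨l, by omega⟩
      obtain ⟨hlife, j, hj, hEj, hje⟩ := hS _ he
      have hsym : s(xs[j].1, xs[j].2.1) = s(v ⟨l, by omega⟩, v ⟨l + 1, hl⟩) := congrArg Prod.fst hje
      have hlab : xs[j].2.2 = t ⟨l, by omega⟩ := congrArg Prod.snd hje
      have htl := htime ⟨l, by omega⟩ le_rfl
      have hmono : ∀ l' : Fin k, l + 1 ≤ l' → t ⟨l, by omega⟩ ≤ t l' := fun l' hl' =>
        ht (Fin.le_def.mpr (by simp only; omega))
      rcases Sym2.eq_iff.mp hsym with ⟨h1, h2⟩ | ⟨h1, h2⟩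
      · have e0 : ¬ n + n + j < n := by omega
        have e1 : (T.graph i).tail (n + n + j) = xs[j].1 := by
          simp [TCInput.graph, e0, hj, hT, toInput]
        have e2 : (T.graph i).head (n + n + j) = xs[j].2.1 := by
          simp [TCInput.graph, e0, hj, hT, toInput]
        have e3 : (T.graph i).time (n + n + j) = xs[j].2.2 := by
          simp [TCInput.graph, e0, hj, hT, toInput]
        refine ⟨n + n + j, hp.tail ⟨⟨?_, ?_⟩, ?_, ?_⟩, ?_, ?_, ?_⟩
        · rw [hhead, e1, h1]
        · rw [e3, hlab]
          exact htl
        · rw [TCInput.nodes, hTn, hTm]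
          omega
        · intro j' hj' hq
          obtain rfl : j' = j := by omega
          exact hEj
        · rw [e2, h2]
        · rw [e3, hlab]
          exact hlife
        · rw [e3, hlab]
          exact hmono
      · have e0 : ¬ n + n + xs.length + j < n := by omega
        have e0' : ¬ n + n + xs.length + j < n + n := by omega
        have e0'' : ¬ n + n + xs.length + j < n + n + xs.length := by omega
        have e1 : (T.graph i).tail (n + n + xs.length + j) = xs[j].2.1 := by
          simp [TCInput.graph, e0, e0', e0'', hj, hT, toInput]
        have e2 : (T.graph i).head (n + n + xs.length + j) = xs[j].1 := by
          simp [TCInput.graph, e0, e0', e0'', hj, hT, toInput]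
        have e3 : (T.graph i).time (n + n + xs.length + j) = xs[j].2.2 := by
          simp [TCInput.graph, e0, e0', e0'', hj, hT, toInput]
        refine ⟨n + n + xs.length + j, hp.tail ⟨⟨?_, ?_⟩, ?_, ?_⟩, ?_, ?_, ?_⟩
        · rw [hhead, e1, h2]
        · rw [e3, hlab]
          exact htl
        · rw [TCInput.nodes, hTn, hTm]
          omega
        · intro j' hj' hq
          obtain rfl : j' = j := by omega
          exact hEj
        · rw [e2, h1]
        · rw [e3, hlab]
          exact hlife
        · rw [e3, hlab]
          exact hmono
  obtain ⟨p, hp, hhead, hlife, -⟩ := key k (by omega)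
  refine hp.tail ⟨⟨?_, ?_⟩, ?_, ?_⟩
  · rw [hhead]
    have : v ⟨k, by omega⟩ = ⟨x, hx⟩ := hvk
    rw [this]
    simp [TCInput.graph, hTn, hx]
  · have : (T.graph i).time x = G.lifetime := by
      simp [TCInput.graph, hx, hT, toInput]
    rw [this]
    exact hlife
  · rw [TCInput.nodes, hTn]
    omega
  · intro j _ hq
    omega

/-- A connected temporal graph has at least half as many temporal edges as vertices. -/
theorem card_le_of_temporallyConnected (hxs : IsListing xs G.tedges)
    (h : TemporallyConnected G.tedges) : n ≤ xs.length + xs.length + 1 := by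
  rcases Nat.lt_or_ge n 2 with hn | hn
  · omega
  -- With at least two vertices, each vertex has a temporal path to another one and is therefore an
  -- endpoint of the first edge of that path.
  have hsub : (Finset.univ : Finset (Fin n)) ⊆
      (xs.map (fun x => x.1) ++ xs.map (fun x => x.2.1)).toFinset := by
    intro x _
    have : Nontrivial (Fin n) := Fin.nontrivial_iff_two_le.mpr hn
    obtain ⟨y, hy⟩ := exists_ne x
    obtain ⟨k, v, t, hv0, hvk, -, hvS⟩ := h x y
    rcases Nat.eq_zero_or_pos k with rfl | hk
    · exact absurd (hvk.symm.trans hv0) hy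
    have he := (hxs.2 _).mp (hvS ⟨0, hk⟩)
    obtain ⟨e, he, hee⟩ := List.mem_map.mp he
    have h1 : s(e.1, e.2.1) = s(v (Fin.castSucc ⟨0, hk⟩), v (Fin.succ ⟨0, hk⟩)) :=
      congrArg Prod.fst hee
    have h2 : v (Fin.castSucc ⟨0, hk⟩) = x := hv0
    rw [h2] at h1
    rw [List.mem_toFinset, List.mem_append, List.mem_map, List.mem_map]
    rcases Sym2.eq_iff.mp h1 with ⟨h3, -⟩ | ⟨-, h3⟩
    exacts [.inl ⟨e, he, h3⟩, .inr ⟨e, he, h3⟩]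
  have h1 := (Finset.card_le_card hsub).trans (List.toFinset_card_le _)
  simp only [Finset.card_univ, Fintype.card_fin, List.length_append, List.length_map] at h1
  omega

end TemporalGraph

/-! ### The main theorem -/

namespace TemporalGraph

/-! ### Reading the encoded input -/

theorem length_flatMap_eq {α : Type*} {f : α → List ℕ} {w : ℕ} (hf : ∀ x, (f x).length = w)
    (xs : List α) : (xs.flatMap f).length = w * xs.length := by
  induction xs with
  | nil => simp
  | cons x xs ih =>
    rw [List.flatMap_cons, List.length_append, hf, ih, List.length_cons]
    ring

theorem getD_flatMap {α : Type*} {f : α → List ℕ} {w : ℕ} (hf : ∀ x, (f x).length = w)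
    (xs : List α) {j c : ℕ} (hj : j < xs.length) (hc : c < w) :
    (xs.flatMap f).getD (w * j + c) 0 = (f xs[j]).getD c 0 := by
  induction xs generalizing j with
  | nil => simp at hj
  | cons x xs ih =>
    rw [List.flatMap_cons]
    cases j with
    | zero =>
      rw [List.getD_append _ _ _ _ (by rw [hf]; omega)]
      simp
    | succ j =>
      have h1 : w * (j + 1) + c = w * j + c + w := by ring
      rw [List.getD_append_right _ _ _ _ (by rw [hf]; omega), hf, h1, Nat.add_sub_cancel,
        ih (by simpa using hj)]
      simp

theorem size_le_bitLength {l : List ℕ} {c : ℕ} (hc : c ∈ l) : c.size ≤ RAM.bitLength l :=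
  (Nat.le_succ _).trans (List.le_sum_of_mem (List.mem_map_of_mem hc))

theorem length_le_bitLength (l : List ℕ) : l.length ≤ RAM.bitLength l := by
  induction l with
  | nil => simp
  | cons x l ih =>
    simp only [RAM.bitLength, List.length_cons, List.map_cons, List.sum_cons] at ih ⊢
    omega

variable {n : ℕ}

theorem length_encodeInput (G : TemporalGraph (Fin n)) (xs : List (Fin n × Fin n × ℕ)) :
    (encodeInput G xs).length = 3 + 5 * xs.length := by
  rw [encodeInput, List.length_append, length_flatMap_eq (w := 5) (fun _ => rfl)]
  rfl

theorem getD_encodeInput (G : TemporalGraph (Fin n)) (xs : List (Fin n × Fin n × ℕ)) {j c : ℕ}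
    (hj : j < xs.length) (hc : c < 5) :
    (encodeInput G xs).getD (3 + 5 * j + c) 0 = [xs[j].1.val, xs[j].2.1.val, xs[j].2.2,
      (G.weight (edge xs[j])).num, (G.weight (edge xs[j])).den].getD c 0 := by
  rw [encodeInput, List.getD_append_right _ _ _ _ (by
    simp only [List.length_cons, List.length_nil]
    omega)]
  have : 3 + 5 * j + c - [n, G.lifetime, xs.length].length = 5 * j + c := by
    simp only [List.length_cons, List.length_nil]
    omega
  rw [this, getD_flatMap (w := 5) (fun _ => rfl) xs hj hc]
  rfl

/-- The algorithm halts in polynomial time, with the output that was computed above. -/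
theorem exists_exec_tcProg (i : ℕ) : ∃ p : Polynomial ℕ, ∀ (n : ℕ) (G : TemporalGraph (Fin n))
    (xs : List (Fin n × Fin n × ℕ)), ∃ k s,
      RAM.Exec (RAM.tcProg i) (RAM.start (encodeInput G xs)) k s ∧
      k ≤ p.eval (RAM.bitLength (encodeInput G xs)) ∧
      (n ≤ xs.length + xs.length + 1 → s.output = (toInput G xs).result i) := by
  obtain ⟨p, hp⟩ := (RAM.tcProg i).exists_polynomial_time
  -- Loops run at most `bits = (i + 3) * (nodes + 2)` times, or as often as a denominator has bits.
  -- If `n ≤ 2 * m + 1`, then `nodes + 2 ≤ 6 * m + 4`, which is at most twice the length `3 + 5 * m`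
  -- of the input list.
  refine ⟨p.comp (Polynomial.C (2 * (i + 3)) * Polynomial.X), fun n G xs => ?_⟩
  set l := encodeInput G xs with hl
  have hlen : 3 + 5 * xs.length ≤ RAM.bitLength l := by
    rw [← length_encodeInput G xs]
    exact length_le_bitLength _
  have harr : ∀ x, (RAM.start l).arr 0 x = l.getD x 0 := fun x => rfl
  have hget : ∀ j (hj : j < xs.length), ∀ c < 5, (RAM.start l).arr 0 (3 + 5 * j + c) =
      [xs[j].1.val, xs[j].2.1.val, xs[j].2.2,
        (G.weight (edge xs[j])).num, (G.weight (edge xs[j])).den].getD c 0 :=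
    fun j hj c hc => (harr _).trans (getD_encodeInput G xs hj hc)
  have hmul : RAM.bitLength l ≤ 2 * (i + 3) * RAM.bitLength l :=
    Nat.le_mul_of_pos_left _ (by omega)
  have hw := RAM.wp_tcProg (L := 2 * (i + 3) * RAM.bitLength l) (i := i) (T := toInput G xs)
    (s := RAM.start l) rfl rfl rfl ?_ ?_ ?_ ?_ ?_ ?_ ?_
  · obtain ⟨k, s, hk, hkt, hs⟩ := RAM.exists_exec_of_wp hw
    refine ⟨k, s, hk, hkt.trans (le_of_eq ?_), hs⟩
    rw [hp, Polynomial.eval_comp, Polynomial.eval_mul, Polynomial.eval_C, Polynomial.eval_X]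
  · intro j hj
    have hj' : j < xs.length := hj
    exact (hget j hj 0 (by norm_num)).trans (by
      simp [toInput, hj']
      rfl)
  · intro j hj
    have hj' : j < xs.length := hj
    exact (hget j hj 1 (by norm_num)).trans (by
      simp [toInput, hj']
      rfl)
  · intro j hj
    have hj' : j < xs.length := hj
    exact (hget j hj 2 (by norm_num)).trans (by
      simp [toInput, hj']
      rfl)
  · intro j hj
    have hj' : j < xs.length := hj
    exact (hget j hj 3 (by norm_num)).trans (by
      simp [toInput, hj']
      rfl)
  · intro j hj
    have hj' : j < xs.length := hj
    exact (hget j hj 4 (by norm_num)).trans (by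
      simp [toInput, hj']
      rfl)
  · intro hn
    have hn' : n ≤ xs.length + xs.length + 1 := hn
    have e1 : (toInput G xs).m = xs.length := rfl
    have e2 : (toInput G xs).n = n := rfl
    have e3 : (toInput G xs).nodes + 2 ≤ 2 * RAM.bitLength l := by
      rw [TCInput.nodes, e1, e2]
      omega
    have e4 : (i + 3) * ((toInput G xs).nodes + 2) ≤ 2 * (i + 3) * RAM.bitLength l := by
      calc (i + 3) * ((toInput G xs).nodes + 2) ≤ (i + 3) * (2 * RAM.bitLength l) := by gcongr
        _ = _ := by ring
    have e5 : (toInput G xs).nodes + 2 ≤ 2 * (i + 3) * RAM.bitLength l :=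
      (Nat.le_mul_of_pos_left _ (by omega)).trans e4
    have e6 : i + 3 ≤ (i + 3) * ((toInput G xs).nodes + 2) := Nat.le_mul_of_pos_right _ (by omega)
    rw [TCInput.bits, e1, e2]
    exact ⟨by omega, by omega, by omega, by omega, e4⟩
  · intro j hj
    have hj' : j < xs.length := hj
    refine (size_le_bitLength ?_).trans hmul
    have : (toInput G xs).den j = (G.weight (edge xs[j])).den := by simp [toInput, hj']
    rw [this, hl, encodeInput]
    refine List.mem_append_right _ (List.mem_flatMap.mpr ⟨xs[j], List.getElem_mem hj', ?_⟩)
    simp [edge]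

theorem edge_injective {G : TemporalGraph (Fin n)} {xs : List (Fin n × Fin n × ℕ)}
    (hxs : IsListing xs G.tedges) : Function.Injective fun j : Fin xs.length => edge xs[j] := by
  intro j j' h
  have := List.nodup_iff_injective_get.mp hxs.1
  have h1 := @this (Fin.cast (by simp) j) (Fin.cast (by simp) j') (by simpa [edge] using h)
  simpa using h1

/-- The denominators' product turns weights into integral weights. -/
theorem intWeight_eq (G : TemporalGraph (Fin n)) (xs : List (Fin n × Fin n × ℕ)) {j : ℕ}
    (hj : j < xs.length) : ((toInput G xs).intWeight j : ℚ≥0) =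
      G.weight (edge xs[j]) * ∏ l ∈ Finset.range xs.length, ((toInput G xs).den l : ℚ≥0) := by
  have h1 : (∏ l ∈ Finset.range xs.length, ((toInput G xs).den l : ℚ≥0)) =
      (toInput G xs).den j * ∏ l ∈ Finset.range xs.length,
        if l = j then 1 else ((toInput G xs).den l : ℚ≥0) := by
    have : ∀ l ∈ Finset.range xs.length, ((toInput G xs).den l : ℚ≥0) =
        (if l = j then ((toInput G xs).den l : ℚ≥0) else 1) *
          if l = j then 1 else ((toInput G xs).den l : ℚ≥0) := by
      intro l _
      split_ifs <;> simp
    rw [Finset.prod_congr rfl this, Finset.prod_mul_distrib, Finset.prod_ite_eq',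
      if_pos (Finset.mem_range.mpr hj)]
  have h2 : (toInput G xs).num j = (G.weight (edge xs[j])).num := by simp [toInput, hj]
  have h3 : (toInput G xs).den j = (G.weight (edge xs[j])).den := by simp [toInput, hj]
  have h4 : ((G.weight (edge xs[j])).den : ℚ≥0) ≠ 0 := by
    exact_mod_cast (G.weight (edge xs[j])).den_ne_zero
  have h5 := NNRat.num_div_den (G.weight (edge xs[j]))
  rw [div_eq_iff h4] at h5
  rw [h1, ← mul_assoc, h3, ← h5, TCInput.intWeight, h2]
  push_cast
  rfl

theorem den_prod_pos (G : TemporalGraph (Fin n)) (xs : List (Fin n × Fin n × ℕ)) :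
    0 < ∏ l ∈ Finset.range xs.length, ((toInput G xs).den l : ℚ≥0) := by
  refine Finset.prod_pos fun l hl => ?_
  have hl' := Finset.mem_range.mp hl
  have : (toInput G xs).den l = (G.weight (edge xs[l])).den := by simp [toInput, hl']
  rw [this]
  exact_mod_cast (G.weight (edge xs[l])).den_pos

/-- The integral weight of a set of temporal edges. -/
theorem sum_intWeight_eq {G : TemporalGraph (Fin n)} {xs : List (Fin n × Fin n × ℕ)}
    (hxs : IsListing xs G.tedges) {S : Finset (Sym2 (Fin n) × ℕ)} (hS : S ⊆ G.tedges)
    (E : ℕ → Prop) [DecidablePred E] (hE : ∀ j (hj : j < xs.length), E j ↔ edge xs[j] ∈ S) :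
    ((∑ j ∈ (Finset.range xs.length).filter E, (toInput G xs).intWeight j : ℕ) : ℚ≥0) =
      G.totalWeight S * ∏ l ∈ Finset.range xs.length, ((toInput G xs).den l : ℚ≥0) := by
  have h1 : S = (Finset.univ.filter fun j : Fin xs.length => E j).image
      fun j : Fin xs.length => edge xs[j] := by
    ext e
    simp only [Finset.mem_image, Finset.mem_filter, Finset.mem_univ, true_and]
    constructor
    · intro he
      obtain ⟨x, hx, rfl⟩ := List.mem_map.mp ((hxs.2 e).mp (hS he))
      obtain ⟨j, hj, rfl⟩ := List.getElem_of_mem hx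
      exact ⟨⟨j, hj⟩, (hE j hj).mpr he, rfl⟩
    · rintro ⟨j, hj, rfl⟩
      exact (hE j j.isLt).mp hj
  have h2 : G.totalWeight S = ∑ j : Fin xs.length, if E j then G.weight (edge xs[j]) else 0 := by
    conv_lhs => rw [totalWeight, h1]
    rw [Finset.sum_image fun a _ b _ h => edge_injective hxs h, Finset.sum_filter]
  rw [h2, Finset.sum_filter, Finset.sum_range, Finset.sum_mul, Nat.cast_sum]
  refine Finset.sum_congr rfl fun j _ => ?_
  split_ifs
  · exact intWeight_eq G xs j.isLt
  · simp

-- Multiplication by the product of all denominators translates weights of edge sets into integral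
-- weights of index sets. The factor is positive and cancels from the guarantee of
-- `TCInput.used_spec`.
open Classical in
theorem exists_solution {i b : ℕ} {h : ℝ} {G : TemporalGraph (Fin n)}
    {xs : List (Fin n × Fin n × ℕ)} (hxs : IsListing xs G.tedges)
    (hG : TemporallyConnected G.tedges) (hi : 0 < i) (hb : 0 < b)
    (hh : ∀ k ≤ n, (harmonic k : ℝ) ≤ h) (hn : n < 2 * b ^ i) :
    ∃ (ys : List (Fin n × Fin n × ℕ)) (S : Finset (Sym2 (Fin n) × ℕ)),
      (toInput G xs).result i = encodeOutput ys ∧ IsListing ys S ∧ G.IsFeasible S ∧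
      ∀ S', G.IsOptimal S' → (G.totalWeight S : ℝ) ≤
        4 * n * Greedy.ratio b h i * (G.totalWeight S' : ℝ) := by
  set T := toInput G xs with hT
  -- every feasible solution yields a spanning set of indices
  have hspan : ∀ S', G.IsFeasible S' → ∃ J ⊆ Finset.range T.m, T.Spans i (· ∈ J) ∧
      ((∑ j ∈ J, T.intWeight j : ℕ) : ℚ≥0) =
        G.totalWeight S' * ∏ l ∈ Finset.range xs.length, (T.den l : ℚ≥0) := by
    intro S' hS'
    set E : ℕ → Prop := fun j => ∃ hj : j < xs.length, edge xs[j] ∈ S' with hE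
    refine ⟨(Finset.range xs.length).filter E, Finset.filter_subset _ _, ?_, ?_⟩
    · refine spans_of_temporallyConnected hS'.2 fun e he => ?_
      have hlab := G.label_mem e (hS'.1 he)
      obtain ⟨x, hx, rfl⟩ := List.mem_map.mp ((hxs.2 e).mp (hS'.1 he))
      obtain ⟨j, hj, rfl⟩ := List.getElem_of_mem hx
      refine ⟨(Finset.mem_Icc.mp hlab).2, j, hj, ?_, rfl⟩
      exact Finset.mem_filter.mpr ⟨Finset.mem_range.mpr hj, hj, he⟩
    · exact sum_intWeight_eq hxs hS'.1 E fun j hj => ⟨fun ⟨_, h⟩ => h, fun h => ⟨hj, h⟩⟩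
  set js : List (Fin xs.length) := (List.finRange xs.length).filter fun j => T.Used i j with hjs
  set ys : List (Fin n × Fin n × ℕ) := js.map fun j => xs[j] with hys
  set S : Finset (Sym2 (Fin n) × ℕ) := (ys.map edge).toFinset with hSdef
  have hmemS : ∀ e, e ∈ S ↔ ∃ j : Fin xs.length, T.Used i j ∧ edge xs[j] = e := by
    intro e
    simp [hSdef, hys, hjs]
  have hsub : S ⊆ G.tedges := by
    intro e he
    obtain ⟨j, -, rfl⟩ := (hmemS e).mp he
    exact (hxs.2 _).mpr (List.mem_map.mpr ⟨xs[j], List.getElem_mem _, rfl⟩)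
  have hres : T.result i = encodeOutput ys := by
    have h1 : List.range T.m = (List.finRange xs.length).map (fun j => j.val) :=
      (List.map_coe_finRange_eq_range).symm
    rw [TCInput.result, h1, List.filter_map, List.flatMap_map, encodeOutput, hys, List.flatMap_map]
    refine List.flatMap_congr fun j _ => ?_
    simp [hT, toInput]
  have hlist : IsListing ys S := by
    constructor
    · have h1 : (ys.map edge).Nodup := by
        rw [hys, List.map_map]
        exact ((List.nodup_finRange _).filter _).map (edge_injective hxs)
      exact h1
    · intro e
      rw [hSdef, List.mem_toFinset]
      rfl
  have hused : ∀ j (hj : j < xs.length), T.Used i j ↔ edge xs[j] ∈ S := by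
    intro j hj
    rw [hmemS]
    constructor
    · exact fun h => ⟨⟨j, hj⟩, h, rfl⟩
    · rintro ⟨j', h1, h2⟩
      have h3 : j' = ⟨j, hj⟩ := edge_injective hxs h2
      rw [h3] at h1
      exact h1
  have hspec : ∀ S', G.IsFeasible S' → T.Spans i (T.Used i) ∧ (G.totalWeight S : ℝ) ≤
        4 * n * Greedy.ratio b h i * (G.totalWeight S' : ℝ) := by
    intro S' hS'
    obtain ⟨J, hJ, hJS, hJw⟩ := hspan S' hS'
    obtain ⟨h1, h2⟩ := TCInput.used_spec hi hJ hJS hb hh hn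
    refine ⟨h1, ?_⟩
    have h3 := sum_intWeight_eq hxs hsub (T.Used i) hused
    have hD := den_prod_pos G xs
    set D := ∏ l ∈ Finset.range xs.length, ((toInput G xs).den l : ℚ≥0) with hDdef
    have h3' : ((∑ j ∈ (Finset.range T.m).filter (T.Used i), T.intWeight j : ℕ) : ℝ) =
        (G.totalWeight S : ℝ) * (D : ℝ) := by
      have := congrArg (fun q : ℚ≥0 => (q : ℝ)) h3
      simp only [NNRat.cast_natCast, NNRat.cast_mul] at this
      exact this
    have hJw' : ((∑ j ∈ J, T.intWeight j : ℕ) : ℝ) = (G.totalWeight S' : ℝ) * (D : ℝ) := by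
      have := congrArg (fun q : ℚ≥0 => (q : ℝ)) hJw
      simpa only [NNRat.cast_natCast, NNRat.cast_mul] using this
    have hD' : (0 : ℝ) < (D : ℝ) := by exact_mod_cast hD
    rw [h3', hJw', ← mul_assoc] at h2
    exact le_of_mul_le_mul_right h2 hD'
  refine ⟨ys, S, hres, hlist, ⟨hsub, ?_⟩, fun S' hS' => (hspec S' hS'.1).2⟩
  -- For feasibility any feasible solution can be compared with, for instance the set of all
  -- temporal edges.
  exact temporallyConnected_of_spans (hspec _ ⟨subset_rfl, hG⟩).1 fun j hj => (hused j hj).mp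

end TemporalGraph

/-! ### Growth of the approximation ratio -/

theorem harmonic_le_one_add_log_of_le {k n : ℕ} (h : k ≤ n) :
    (harmonic k : ℝ) ≤ 1 + Real.log n := by
  rcases Nat.eq_zero_or_pos k with rfl | hk
  · simpa using add_nonneg zero_le_one (Real.log_natCast_nonneg n)
  · refine (harmonic_le_one_add_log k).trans ?_
    have := Real.log_le_log (by exact_mod_cast hk) (by exact_mod_cast h : (k : ℝ) ≤ n)
    linarith

/-- The base with respect to which the tree is split at every level. -/
noncomputable def splitBase (i n : ℕ) : ℕ := ⌈(n : ℝ) ^ (1 / i : ℝ)⌉₊ + 1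

theorem lt_two_mul_splitBase_pow {i : ℕ} (hi : 0 < i) (n : ℕ) : n < 2 * splitBase i n ^ i := by
  have h1 : (n : ℝ) ^ (1 / i : ℝ) ≤ (splitBase i n : ℕ) := by
    rw [splitBase]
    push_cast
    linarith [Nat.le_ceil ((n : ℝ) ^ (1 / i : ℝ))]
  have h2 : (n : ℝ) ≤ (splitBase i n : ℝ) ^ i := by
    calc (n : ℝ) = ((n : ℝ) ^ (1 / i : ℝ)) ^ i := by
          rw [← Real.rpow_natCast, ← Real.rpow_mul (by positivity), one_div,
            inv_mul_cancel₀ (by exact_mod_cast hi.ne'), Real.rpow_one]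
      _ ≤ _ := by gcongr
  have h3 : n ≤ splitBase i n ^ i := by exact_mod_cast h2
  have h4 : 0 < splitBase i n ^ i := by
    have : 0 < splitBase i n := Nat.succ_pos _
    positivity
  omega

/-- The approximation ratio is small. -/
theorem ratio_isBigO {ε : ℝ} {i : ℕ} (hi : 0 < i) (hε : (1 / i : ℝ) < ε) :
    (fun n : ℕ => 1 + 4 * n * Greedy.ratio (splitBase i n) (1 + Real.log n) i)
      =O[Filter.atTop] fun n : ℕ => (n : ℝ) ^ (1 + ε) := by
  have hi' : (0 : ℝ) < i := by exact_mod_cast hi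
  -- The slack `ε - 1 / i` in the exponent is distributed over the `i` logarithmic factors.
  set η := (ε - 1 / i) / i with hη
  have hη0 : 0 < η := div_pos (by linarith) hi'
  set C := 2 * (1 + 1 / η) with hC
  refine Asymptotics.IsBigO.of_bound (1 + 28 * C ^ i) ?_
  filter_upwards [Filter.eventually_ge_atTop 1] with n hn
  have hn1 : (1 : ℝ) ≤ n := by exact_mod_cast hn
  have hn0 : (0 : ℝ) < n := by linarith
  have hlog : 0 ≤ Real.log n := Real.log_natCast_nonneg n
  have h1 : (1 : ℝ) ≤ (n : ℝ) ^ (1 / i : ℝ) := Real.one_le_rpow hn1 (by positivity)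
  have h2 : (splitBase i n : ℝ) ≤ (n : ℝ) ^ (1 / i : ℝ) + 2 := by
    rw [splitBase]
    push_cast
    linarith [(Nat.ceil_lt_add_one (show 0 ≤ (n : ℝ) ^ (1 / i : ℝ) by positivity)).le]
  have h3 : 1 + Real.log n ≤ (1 + 1 / η) * (n : ℝ) ^ η := by
    have h4 := Real.log_le_rpow_div hn0.le hη0
    have h5 : (1 : ℝ) ≤ (n : ℝ) ^ η := Real.one_le_rpow hn1 hη0.le
    calc 1 + Real.log n ≤ (n : ℝ) ^ η + (n : ℝ) ^ η / η := add_le_add h5 h4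
      _ = _ := by ring
  have h4 : (2 * (1 + Real.log n)) ^ i ≤ C ^ i * (n : ℝ) ^ (ε - 1 / i) := by
    calc (2 * (1 + Real.log n)) ^ i ≤ (C * (n : ℝ) ^ η) ^ i := by
          refine pow_le_pow_left₀ (by positivity) ?_ i
          rw [hC]
          linarith
      _ = C ^ i * (n : ℝ) ^ (ε - 1 / i) := by
          rw [mul_pow, ← Real.rpow_natCast ((n : ℝ) ^ η), ← Real.rpow_mul hn0.le, hη,
            div_mul_cancel₀ _ hi'.ne']
  -- For `x = n ^ (1 / i) ≥ 1` the base `b ≤ x + 2` satisfies `2 * b + 1 ≤ 2 * x + 5 ≤ 7 * x`.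
  have h5 : Greedy.ratio (splitBase i n) (1 + Real.log n) i ≤
      7 * (n : ℝ) ^ (1 / i : ℝ) * (C ^ i * (n : ℝ) ^ (ε - 1 / i)) := by
    refine (Greedy.ratio_le (by positivity) (by linarith) i).trans ?_
    gcongr
    linarith
  have h6 : (1 : ℝ) ≤ (n : ℝ) ^ (1 + ε) := Real.one_le_rpow hn1 (by
    have : 0 ≤ (1 / i : ℝ) := by positivity
    linarith)
  have h7 : (n : ℝ) * ((n : ℝ) ^ (1 / i : ℝ) * (n : ℝ) ^ (ε - 1 / i)) = (n : ℝ) ^ (1 + ε) := by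
    rw [← Real.rpow_add hn0, add_sub_cancel, Real.rpow_add hn0, Real.rpow_one]
  have h8 : 0 ≤ Greedy.ratio (splitBase i n) (1 + Real.log n) i :=
    Greedy.ratio_nonneg (by positivity) (by linarith) i
  rw [Real.norm_of_nonneg (by positivity), Real.norm_of_nonneg (by positivity)]
  calc 1 + 4 * n * Greedy.ratio (splitBase i n) (1 + Real.log n) i
      ≤ (n : ℝ) ^ (1 + ε) + 4 * n * (7 * (n : ℝ) ^ (1 / i : ℝ) *
          (C ^ i * (n : ℝ) ^ (ε - 1 / i))) := by gcongr
    _ = (n : ℝ) ^ (1 + ε) + 28 * C ^ i * ((n : ℝ) * ((n : ℝ) ^ (1 / i : ℝ) *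
          (n : ℝ) ^ (ε - 1 / i))) := by ring
    _ = _ := by
      rw [h7]
      ring

theorem mainTheorem6 (ε : ℝ) (hε : 0 < ε) :
    ∃ (P : RAM.Program) (ρ : ℕ → ℝ),
      ρ =O[Filter.atTop] (fun n : ℕ => (n : ℝ) ^ (1 + ε)) ∧
        P.RunsInPolyTime ∧ P.HasApproxRatio ρ := by
  obtain ⟨j, hj⟩ := exists_nat_one_div_lt hε
  set i := j + 1 with hi
  have hi0 : 0 < i := Nat.succ_pos j
  have hiε : (1 / i : ℝ) < ε := by
    rw [hi]
    push_cast
    exact hj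
  obtain ⟨p, hp⟩ := TemporalGraph.exists_exec_tcProg i
  -- The ratio, found by unification, is `1 + 4 * n * ratio`; the summand 1 ensures that it is at
  -- least 1 for every `n`, including `n = 0`.
  refine ⟨RAM.tcProg i, _, ratio_isBigO hi0 hiε, ⟨p, fun n G xs _ => ?_⟩, fun n => ?_, ?_⟩
  · obtain ⟨k, s, hk, hkt, -⟩ := hp n G xs
    exact ⟨k, s, hk, hkt⟩
  · have : 0 ≤ Greedy.ratio (splitBase i n) (1 + Real.log n) i :=
      Greedy.ratio_nonneg (by positivity)
        (add_nonneg zero_le_one (Real.log_natCast_nonneg n)) i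
    have : 0 ≤ 4 * n * Greedy.ratio (splitBase i n) (1 + Real.log n) i := by positivity
    linarith
  · intro n G xs hxs hG
    obtain ⟨k, s, hk, -, hs⟩ := hp n G xs
    obtain ⟨ys, S, hres, hlist, hfeas, hopt⟩ := TemporalGraph.exists_solution hxs hG hi0
      (b := splitBase i n) (Nat.succ_pos _) (fun k hk => harmonic_le_one_add_log_of_le hk)
      (lt_two_mul_splitBase_pow hi0 n)
    refine ⟨k, s, ys, S, hk,
      (hs (TemporalGraph.card_le_of_temporallyConnected hxs hG)).trans hres, hlist, hfeas,
      fun S' hS' => (hopt S' hS').trans ?_⟩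
    have : (0 : ℝ) ≤ (G.totalWeight S' : ℝ) := NNRat.cast_nonneg _
    rw [add_mul, one_mul]
    linarith
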